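/- Let $Q=(Q_0,Q_1,s,t)$ be a finite quiver, $R$ a set of relations in $Q$ (each a $\mathbb C$-linear combination of parallel paths of length $\ge 2$) such that the ideal $J$ of $\mathbb CQ$ generated by $R$ is admissible, and suppose that $A=\mathbb CQ/J$ has finite global dimension. Let $P_j=A\varepsilon_j$ $(j\in Q_0)$ be the indecomposable projective $A$-modules. For a finitely supported sequence of dimension vectors $\underline{\mathbf d}=(\underline d_i)_{i\in\mathbb Z}$, $\underline d_i\in\mathbb N^{Q_0}$, let $\mathcal C^b(A,\underline{\mathbf d})$ be the affine variety (with the Zariski topology) of all $(x_i,\partial_i)_i$, where $x_i$ is an $A$-module structure (a representation of $Q$ satisfying $R$) on $\mathbb C^{\underline d_i}$ and the $\partial_i:(\mathbb C^{\underline d_i},x_i)\to(\mathbb C^{\underline d_{i+1}},x_{i+1})$ are $A$-linear with $\partial_{i+1}\partial_i=0$. The group $G_{\underline{\mathbf d}}=\prod_{i\in\mathbb Z}\prod_{j\in Q_0}GL(\underline d_i(j),\mathbb C)$ acts on it by conjugation. For a finitely supported sequence $\underline{\mathbf e}=(\underline e_i)_i$ in $\mathbb N^{Q_0}$ put $P^i=\bigoplus_j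 e^i_jP_j$ and $\underline{\mathbf d}(\underline{\mathbf e})=(\underline{\dim}\,P^i)_i$, and let $\mathcal P^b(A,\underline{\mathbf e})\subseteq\mathcal C^b(A,\underline{\mathbf d}(\underline{\mathbf e}))$ be the subspace of all $(x_i,\partial_i)_i$ with $(\mathbb C^{\underline d_i},x_i)\cong P^i$ for all $i$; it is stable under $G_{\underline{\mathbf d}(\underline{\mathbf e})}$. Write $\mathcal{QP}^b(A,\underline{\mathbf e})=\mathcal P^b(A,\underline{\mathbf e})/G_{\underline{\mathbf d}(\underline{\mathbf e})}$ for the orbit space with the quotient topology. Fix $\mathbf d\in K_0(\mathcal D^b(A))$, and consider the set of all $\underline{\mathbf e}$ such that complexes with dimension vector sequence $\underline{\mathbf d}(\underline{\mathbf e})$ have class $\mathbf d$. Write $\underline{\mathbf e}_1\le\underline{\mathbf e}_2$ if $\underline{\mathbf e}_2-\underline{\mathbf e}_1$ has non-negative entries and $\mathcal P^b(A,\underline{\mathbf e}_2-\underline{\mathbf e}_1)$ contains a contractible (acyclic) complex. A *coherent system* over $\mathbf d$ consists of a contractible complex $P^\bullet(\underline{\mathbf e}_1,\underline{\mathbf e}_2)\in\mathcal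 P^b(A,\underline{\mathbf e}_2-\underline{\mathbf e}_1)$ for all $\underline{\mathbf e}_1\le\underline{\mathbf e}_2$ and of identifications of the coordinates of $\mathbb C^{\underline{\mathbf d}(\underline{\mathbf e}_1)}\oplus\mathbb C^{\underline{\mathbf d}(\underline{\mathbf e}_2-\underline{\mathbf e}_1)}$ with those of $\mathbb C^{\underline{\mathbf d}(\underline{\mathbf e}_2)}$ (in each degree and at each vertex), such that for $\underline{\mathbf e}_1\le\underline{\mathbf e}_2\le\underline{\mathbf e}_3$ the inclusions $\mathbb C^{\underline{\mathbf d}(\underline{\mathbf e}_1)}\subseteq\mathbb C^{\underline{\mathbf d}(\underline{\mathbf e}_2)}\subseteq\mathbb C^{\underline{\mathbf d}(\underline{\mathbf e}_3)}$ compose to the given one and $X\oplus P^\bullet(\underline{\mathbf e}_1,\underline{\mathbf e}_2)\oplus P^\bullet(\underline{\mathbf e}_2,\underline{\mathbf e}_3)=X\oplus P^\bullet(\underline{\mathbf e}_1,\underline{\mathbf e}_3)$ for all $X\in\mathcal P^b(A,\underline{\mathbf e}_1)$. Given such a system, let $$t_{\underline{\mathbf e}_1\underline{\mathbf e}_2}:\mathcal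 P^b(A,\underline{\mathbf e}_1)\to\mathcal P^b(A,\underline{\mathbf e}_2),\ X\mapsto X\oplus P^\bullet(\underline{\mathbf e}_1,\underline{\mathbf e}_2),\qquad f_{\underline{\mathbf e}_1\underline{\mathbf e}_2}:G_{\underline{\mathbf d}(\underline{\mathbf e}_1)}\to G_{\underline{\mathbf d}(\underline{\mathbf e}_2)},\ g\mapsto\begin{pmatrix}g&0\\0&1\end{pmatrix},$$ and let $\mathcal P^b(A,\mathbf d)=\varinjlim\mathcal P^b(A,\underline{\mathbf e})$ (with the direct limit topology), $G_{\mathbf d}=\varinjlim G_{\underline{\mathbf d}(\underline{\mathbf e})}$ and $\varinjlim\mathcal{QP}^b(A,\underline{\mathbf e})$ (with the direct limit topology, along the maps induced by the $t_{\underline{\mathbf e}_1\underline{\mathbf e}_2}$) be the direct limits, with canonical maps $t_{\underline{\mathbf e}}:\mathcal P^b(A,\underline{\mathbf e})\to\mathcal P^b(A,\mathbf d)$ and $f_{\underline{\mathbf e}}:G_{\underline{\mathbf d}(\underline{\mathbf e})}\to G_{\mathbf d}$. For $x,y\in\mathcal P^b(A,\mathbf d)$ write $x\sim y$ if the corresponding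 projective complexes are quasi-isomorphic, i.e. isomorphic in $\mathcal D^b(A)$, and let $\mathcal{QP}^b(A,\mathbf d)=\mathcal P^b(A,\mathbf d)/\!\sim$ with the quotient topology. **Proposition.** Coherent systems over $\mathbf d$ exist, and the order $\le$ is upward directed. For every coherent system there is a unique action of $G_{\mathbf d}$ on $\mathcal P^b(A,\mathbf d)$ with $$f_{\underline{\mathbf e}}(g).t_{\underline{\mathbf e}'}(X)=t_{\underline{\mathbf e}''}\bigl(f_{\underline{\mathbf e}\,\underline{\mathbf e}''}(g).t_{\underline{\mathbf e}'\underline{\mathbf e}''}(X)\bigr)$$ whenever $\underline{\mathbf e}\le\underline{\mathbf e}''$, $\underline{\mathbf e}'\le\underline{\mathbf e}''$, $g\in G_{\underline{\mathbf d}(\underline{\mathbf e})}$ and $X\in\mathcal P^b(A,\underline{\mathbf e}')$. Two points $x,y\in\mathcal P^b(A,\mathbf d)$ satisfy $x\sim y$ if and only if they lie in the same $G_{\mathbf d}$-orbit, and $$\mathcal{QP}^b(A,\mathbf d)=\mathcal P^b(A,\mathbf d)/G_{\mathbf d}=\varinjlim\mathcal{QP}^b(A,\underline{\mathbf e})$$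 as topological spaces: there are homeomorphisms $\mathcal{QP}^b(A,\mathbf d)\to\mathcal P^b(A,\mathbf d)/G_{\mathbf d}$ sending the class of $x$ to the orbit of $x$, and $\varinjlim\mathcal{QP}^b(A,\underline{\mathbf e})\to\mathcal{QP}^b(A,\mathbf d)$ sending the class of the orbit of $X\in\mathcal P^b(A,\underline{\mathbf e})$ to the class of $t_{\underline{\mathbf e}}(X)$. -/

import Mathlib

open CategoryTheory

namespace BoundQuiver

/-! ### Quivers with relations, their algebras and their representations -/

/-- A set of relations in a quiver: each relation is a linear combination of parallel paths of
length at least two. -/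
structure Relations (V : Type) [Quiver.{0} V] where
  rel : ∀ j k : V, Set (Quiver.Path j k →₀ ℂ)
  two_le_length : ∀ (j k : V), ∀ r ∈ rel j k, ∀ p ∈ r.support, 2 ≤ p.length

section Algebra

variable {V : Type} [Quiver.{0} V] [Fintype V] [DecidableEq V]

/-- The free algebra on the vertices and the arrows of the quiver. -/
abbrev FreeAlg (V : Type) [Quiver.{0} V] : Type :=
  FreeAlgebra ℂ (V ⊕ (Σ j k : V, (j ⟶ k)))

/-- The generator of the free algebra that belongs to a vertex. -/
def vtx (j : V) : FreeAlg V := FreeAlgebra.ι ℂ (Sum.inl j)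

/-- The generator of the free algebra that belongs to an arrow. -/
def arr {j k : V} (a : j ⟶ k) : FreeAlg V := FreeAlgebra.ι ℂ (Sum.inr ⟨j, k, a⟩)

/-- The product of the arrows of a path. As for linear maps, the arrow which is passed last is
the leftmost factor; the trivial path at `j` is the vertex `j`. -/
def pathWord {j : V} : ∀ {k : V}, Quiver.Path j k → FreeAlg V
  | _, .nil => vtx j
  | _, .cons p a => arr a * pathWord p

/-- The defining relations of `ℂQ/J`: those of the path algebra `ℂQ`, and the given ones. -/
inductive AlgRel (R : Relations V) : FreeAlg V → FreeAlg V → Prop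
  | vtx_sq (j : V) : AlgRel R (vtx j * vtx j) (vtx j)
  | vtx_ne (j k : V) (h : j ≠ k) : AlgRel R (vtx j * vtx k) 0
  | vtx_sum : AlgRel R (∑ j, vtx j) 1
  | target (j k : V) (a : j ⟶ k) : AlgRel R (vtx k * arr a) (arr a)
  | source (j k : V) (a : j ⟶ k) : AlgRel R (arr a * vtx j) (arr a)
  | rel (j k : V) (r : Quiver.Path j k →₀ ℂ) (h : r ∈ R.rel j k) :
      AlgRel R (r.sum fun p c => c • pathWord p) 0

/-- The algebra `A = ℂQ/J`, where `J` is the ideal generated by the relations. -/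
abbrev Alg (R : Relations V) : Type := RingQuot (AlgRel R)

/-- The quotient map from the free algebra on vertices and arrows. -/
noncomputable abbrev toAlg (R : Relations V) : FreeAlg V →ₐ[ℂ] Alg R :=
  RingQuot.mkAlgHom ℂ (AlgRel R)

/-- The idempotent of a vertex. -/
noncomputable def idem (R : Relations V) (j : V) : Alg R := toAlg R (vtx j)

/-- The ideal generated by the relations is admissible: it contains all sufficiently long paths
(and consists of combinations of paths of length at least two). -/
def Relations.Admissible (R : Relations V) : Prop :=
  ∃ N : ℕ, ∀ (j k : V) (p : Quiver.Path j k), N ≤ p.length → toAlg R (pathWord p) = 0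

/-- Finite (left) global dimension. -/
def FiniteGlobalDimension (B : Type) [Ring B] : Prop :=
  ∃ n : ℕ, ∀ M : ModuleCat.{0} B, HasProjectiveDimensionLE M n

/-- The indecomposable projective module `P_j = A ε_j` of a vertex `j`. If the relations are
admissible, the `P_j` are a complete set of indecomposable projective `A`-modules. -/
abbrev Proj (R : Relations V) (j : V) : Type := (Ideal.span {idem R j} : Ideal (Alg R))

/-- The projective module `⨁_j e_j P_j`. -/
abbrev ProjSum (R : Relations V) (e : V → ℕ) : Type := ∀ j : V, Fin (e j) → Proj R j

/-- The dimension vector of an `A`-module `M`: its entry at `k` is the dimension of `ε_k M`. -/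
noncomputable def dimVec (R : Relations V) (M : Type) [AddCommGroup M] [Module ℂ M]
    [Module (Alg R) M] [IsScalarTower ℂ (Alg R) M] (k : V) : ℕ :=
  Module.finrank ℂ (LinearMap.range (Algebra.lsmul ℂ ℂ M (idem R k)))

end Algebra

section Representations

variable {V : Type} [Quiver.{0} V] [Fintype V] [DecidableEq V]
variable {W : V → Type} [∀ j, AddCommGroup (W j)] [∀ j, Module ℂ (W j)]
variable {W' : V → Type} [∀ j, AddCommGroup (W' j)] [∀ j, Module ℂ (W' j)]

/-- Representations of the quiver on a given family of vector spaces. -/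
abbrev QRep (W : V → Type) [∀ j, AddCommGroup (W j)] [∀ j, Module ℂ (W j)] : Type :=
  ∀ j k : V, (j ⟶ k) → (W j →ₗ[ℂ] W k)

/-- The linear map `x_p` of a path `p`. -/
def evalPath (x : QRep W) {j : V} : ∀ {k : V}, Quiver.Path j k → (W j →ₗ[ℂ] W k)
  | _, .nil => LinearMap.id
  | _, .cons p a => x _ _ a ∘ₗ evalPath x p

/-- The representation satisfies all the relations. -/
def Satisfies (R : Relations V) (x : QRep W) : Prop :=
  ∀ (j k : V), ∀ r ∈ R.rel j k, (r.sum fun p c => c • evalPath x p) = 0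

/-- The action of the generators on the total space of a representation. -/
def genAct (x : QRep W) : V ⊕ (Σ j k : V, (j ⟶ k)) → Module.End ℂ (∀ j, W j)
  | .inl j => LinearMap.single ℂ W j ∘ₗ LinearMap.proj j
  | .inr ⟨j, k, a⟩ => LinearMap.single ℂ W k ∘ₗ x j k a ∘ₗ LinearMap.proj j

theorem lift_pathWord (x : QRep W) {j k : V} (p : Quiver.Path j k) :
    FreeAlgebra.lift ℂ (genAct x) (pathWord p) =
      LinearMap.single ℂ W k ∘ₗ evalPath x p ∘ₗ LinearMap.proj j := by
  induction p with
  | nil => simp [pathWord, evalPath, vtx, genAct]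
  | cons p a ih =>
    ext v
    simp [pathWord, evalPath, arr, genAct, ih]

theorem lift_rel {R : Relations V} {x : QRep W} (h : Satisfies R x) {a b : FreeAlg V}
    (hab : AlgRel R a b) :
    FreeAlgebra.lift ℂ (genAct x) a = FreeAlgebra.lift ℂ (genAct x) b := by
  induction hab with
  | vtx_sq j => refine LinearMap.ext fun v => ?_; simp [vtx, genAct]
  | vtx_ne j k hjk => refine LinearMap.ext fun v => ?_; simp [vtx, genAct, Pi.single_eq_of_ne hjk]
  | vtx_sum =>
    refine LinearMap.ext fun v => ?_
    simp [vtx, genAct, Finset.univ_sum_single]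
  | target j k a => refine LinearMap.ext fun v => ?_; simp [vtx, arr, genAct]
  | source j k a => refine LinearMap.ext fun v => ?_; simp [vtx, arr, genAct]
  | rel j k r hr =>
    have h0 := h j k r hr
    have : FreeAlgebra.lift ℂ (genAct x) (r.sum fun p c => c • pathWord p) =
        LinearMap.single ℂ W k ∘ₗ (r.sum fun p c => c • evalPath x p) ∘ₗ LinearMap.proj j := by
      refine LinearMap.ext fun v => ?_
      simp only [Finsupp.sum, map_sum, map_smul, lift_pathWord, LinearMap.sum_apply,
        LinearMap.smul_apply, LinearMap.comp_apply]
    rw [this, h0]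
    simp

/-- The action of `A` on the total space of a representation. -/
noncomputable def actHom (R : Relations V) (x : QRep W) (h : Satisfies R x) :
    Alg R →ₐ[ℂ] Module.End ℂ (∀ j, W j) :=
  RingQuot.liftAlgHom ℂ ⟨FreeAlgebra.lift ℂ (genAct x), fun _ _ hab => lift_rel h hab⟩

/-- The `A`-module `M(x)` of a representation `x`, with underlying space `⨁_j W j`. -/
def RepMod (R : Relations V) (x : QRep W) (_h : Satisfies R x) : Type := ∀ j, W j

noncomputable instance (R : Relations V) (x : QRep W) (h : Satisfies R x) :
    AddCommGroup (RepMod R x h) := inferInstanceAs (AddCommGroup (∀ j, W j))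

noncomputable instance (R : Relations V) (x : QRep W) (h : Satisfies R x) :
    Module (Alg R) (RepMod R x h) :=
  Module.compHom (∀ j, W j) (actHom R x h).toRingHom

noncomputable instance (R : Relations V) (x : QRep W) (h : Satisfies R x) :
    Module ℂ (RepMod R x h) := inferInstanceAs (Module ℂ (∀ j, W j))

instance (R : Relations V) (x : QRep W) (h : Satisfies R x) :
    IsScalarTower ℂ (Alg R) (RepMod R x h) where
  smul_assoc c a v := by
    change actHom R x h (c • a) v = c • actHom R x h a v
    rw [map_smul]
    rfl

theorem actHom_comm {R : Relations V} {x : QRep W} {y : QRep W'} (hx : Satisfies R x)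
    (hy : Satisfies R y) (φ : ∀ j, W j →ₗ[ℂ] W' j)
    (hφ : ∀ (j k : V) (a : j ⟶ k), φ k ∘ₗ x j k a = y j k a ∘ₗ φ j) (c : Alg R) (v : ∀ j, W j) :
    LinearMap.piMap φ (actHom R x hx c v) = actHom R y hy c (LinearMap.piMap φ v) := by
  obtain ⟨c, rfl⟩ := RingQuot.mkAlgHom_surjective ℂ (AlgRel R) c
  simp only [actHom, RingQuot.liftAlgHom_mkAlgHom_apply]
  induction c using FreeAlgebra.induction generalizing v with
  | grade0 r => simp [Algebra.algebraMap_eq_smul_one]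
  | grade1 g =>
    rcases g with j | ⟨j, k, a⟩
    · funext l
      rcases eq_or_ne l j with rfl | hl
      · simp [genAct]
      · simp [genAct, Pi.single_eq_of_ne hl]
    · funext l
      rcases eq_or_ne l k with rfl | hl
      · have := LinearMap.congr_fun (hφ j l a) (v j)
        simpa [genAct] using this
      · simp [genAct, Pi.single_eq_of_ne hl]
  | mul a b ha hb => simp [ha, hb]
  | add a b ha hb => simp only [map_add, LinearMap.add_apply, ha, hb]

/-- A family of linear maps that commutes with the arrows, as an `A`-linear map. -/
noncomputable def repLin {R : Relations V} {x : QRep W} {y : QRep W'} (hx : Satisfies R x)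
    (hy : Satisfies R y) (φ : ∀ j, W j →ₗ[ℂ] W' j)
    (hφ : ∀ (j k : V) (a : j ⟶ k), φ k ∘ₗ x j k a = y j k a ∘ₗ φ j) :
    RepMod R x hx →ₗ[Alg R] RepMod R y hy where
  toFun := LinearMap.piMap φ
  map_add' := (LinearMap.piMap φ).map_add
  map_smul' c v := actHom_comm hx hy φ hφ c v

/-- An isomorphism of representations gives an isomorphism of `A`-modules. -/
noncomputable def repEquiv {R : Relations V} {x : QRep W} {y : QRep W'} (hx : Satisfies R x)
    (hy : Satisfies R y) (φ : ∀ j, W j ≃ₗ[ℂ] W' j)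
    (hφ : ∀ (j k : V) (a : j ⟶ k),
      (φ k).toLinearMap ∘ₗ x j k a = y j k a ∘ₗ (φ j).toLinearMap) :
    RepMod R x hx ≃ₗ[Alg R] RepMod R y hy :=
  LinearEquiv.ofBijective (repLin hx hy (fun j => (φ j).toLinearMap) hφ)
    ⟨fun _ _ h => funext fun j => (φ j).injective (congrFun h j),
      fun w => ⟨fun j => (φ j).symm (w j), funext fun j => (φ j).apply_symm_apply (w j)⟩⟩

end Representations

/-! ### Varieties of complexes -/

section Complexes

variable {V : Type} [Quiver.{0} V] [Fintype V] [DecidableEq V]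

/-- Sequences of vectors `V → ℕ` with only finitely many non-zero entries; used both for sequences
of dimension vectors and for projective dimension sequences. -/
abbrev DimSeq (V : Type) : Type := ℤ →₀ (V → ℕ)

/-- The space `ℂ^n`. -/
abbrev Sp (n : ℕ) : Type := Fin n → ℂ

/-- The points of the variety `C^b(A, d)`: complexes of `A`-modules with terms
`(ℂ^{d_i}, x_i)` and differentials `∂_i : ℂ^{d_i} → ℂ^{d_{i+1}}`. -/
@[ext]
structure CPoint (R : Relations V) (d : DimSeq V) where
  x : ∀ i : ℤ, QRep fun j => Sp (d i j)
  sat : ∀ i, Satisfies R (x i)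
  diff : ∀ (i : ℤ) (j : V), Sp (d i j) →ₗ[ℂ] Sp (d (i + 1) j)
  comm : ∀ (i : ℤ) (j k : V) (a : j ⟶ k), diff i k ∘ₗ x i j k a = x (i + 1) j k a ∘ₗ diff i j
  sq_zero : ∀ (i : ℤ) (j : V), diff (i + 1) j ∘ₗ diff i j = 0

namespace CPoint

variable {R : Relations V} {d : DimSeq V}

/-- The `A`-module `M(x_i)`. -/
abbrev mod (p : CPoint R d) (i : ℤ) : Type := RepMod R (p.x i) (p.sat i)

/-- The differential as an `A`-linear map. -/
noncomputable def diffLin (p : CPoint R d) (i : ℤ) : p.mod i →ₗ[Alg R] p.mod (i + 1) :=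
  repLin (p.sat i) (p.sat (i + 1)) (p.diff i) (p.comm i)

/-- The complex of `A`-modules that belongs to a point. -/
noncomputable def complex (p : CPoint R d) : CochainComplex (ModuleCat.{0} (Alg R)) ℤ :=
  CochainComplex.of (fun i => ModuleCat.of (Alg R) (p.mod i))
    (fun i => ModuleCat.ofHom (p.diffLin i))
    (fun i => by
      ext v
      refine funext fun j => ?_
      exact LinearMap.congr_fun (p.sq_zero i j) (v j))

/-- The coordinates of a point: the entries of the matrices of all its arrows and differentials. -/
abbrev Coord (d : DimSeq V) : Type :=
  (Σ (i : ℤ) (j k : V) (_ : j ⟶ k), Fin (d i k) × Fin (d i j)) ⊕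
    (Σ (i : ℤ) (j : V), Fin (d (i + 1) j) × Fin (d i j))

def coord (p : CPoint R d) : Coord d → ℂ
  | .inl ⟨i, j, k, a, r, c⟩ => p.x i j k a (Pi.single c 1) r
  | .inr ⟨i, j, r, c⟩ => p.diff i j (Pi.single c 1) r

/-- The Zariski topology, induced from the affine space of all coordinates. -/
noncomputable instance : TopologicalSpace (CPoint R d) :=
  TopologicalSpace.induced
    (fun p => (MvPolynomial.pointToPoint p.coord : PrimeSpectrum (MvPolynomial (Coord d) ℂ)))
    inferInstance

theorem satisfies_conj {W W' : V → Type} [∀ j, AddCommGroup (W j)] [∀ j, Module ℂ (W j)]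
    [∀ j, AddCommGroup (W' j)] [∀ j, Module ℂ (W' j)] {x : QRep W} {y : QRep W'}
    (hx : Satisfies R x) (φ : ∀ j, W j ≃ₗ[ℂ] W' j)
    (hφ : ∀ (j k : V) (a : j ⟶ k),
      (φ k).toLinearMap ∘ₗ x j k a = y j k a ∘ₗ (φ j).toLinearMap) : Satisfies R y := by
  have key : ∀ (j k : V) (p : Quiver.Path j k),
      (φ k).toLinearMap ∘ₗ evalPath x p = evalPath y p ∘ₗ (φ j).toLinearMap := by
    intro j k p
    induction p with
    | nil => simp [evalPath]
    | cons p a ih =>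
      rw [evalPath, evalPath, ← LinearMap.comp_assoc, hφ, LinearMap.comp_assoc, ih,
        LinearMap.comp_assoc]
  intro j k r hr
  refine LinearMap.ext fun w => ?_
  obtain ⟨v, rfl⟩ := (φ j).surjective w
  have h0 := congrArg (φ k) (LinearMap.congr_fun (hx j k r hr) v)
  simp only [Finsupp.sum, LinearMap.sum_apply, LinearMap.smul_apply, map_sum, map_smul,
    LinearMap.zero_apply, map_zero] at h0 ⊢
  rw [← h0]
  refine Finset.sum_congr rfl fun p _ => ?_
  have := LinearMap.congr_fun (key j k p) v
  simp only [LinearMap.comp_apply, LinearEquiv.coe_coe] at this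
  rw [this]

end CPoint

/-- The group `G_d`, a product of general linear groups. -/
abbrev GLSeq (d : DimSeq V) : Type := ∀ (i : ℤ) (j : V), Sp (d i j) ≃ₗ[ℂ] Sp (d i j)

/-- The conjugation action of `G_d` on `C^b(A, d)`. -/
instance (R : Relations V) (d : DimSeq V) : MulAction (GLSeq d) (CPoint R d) where
  smul g p :=
    { x := fun i j k a => (g i k).toLinearMap ∘ₗ p.x i j k a ∘ₗ (g i j).symm.toLinearMap
      sat := fun i => CPoint.satisfies_conj (p.sat i) (g i) (fun j k a => by
        ext; simp)
      diff := fun i j => (g (i + 1) j).toLinearMap ∘ₗ p.diff i j ∘ₗ (g i j).symm.toLinearMap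
      comm := fun i j k a => by
        refine LinearMap.ext fun v => ?_
        have := LinearMap.congr_fun (p.comm i j k a) ((g i j).symm v)
        simp only [LinearMap.comp_apply, LinearEquiv.coe_coe, LinearEquiv.symm_apply_apply]
          at this ⊢
        rw [this]
      sq_zero := fun i j => by
        refine LinearMap.ext fun v => ?_
        have := LinearMap.congr_fun (p.sq_zero i j) ((g i j).symm v)
        simp only [LinearMap.comp_apply, LinearEquiv.coe_coe, LinearEquiv.symm_apply_apply,
          LinearMap.zero_apply] at this ⊢
        rw [this, map_zero] }
  one_smul _ := rfl
  mul_smul _ _ _ := rfl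

/-- The zero point of `C^b(A, d)`: all arrows and all differentials are zero. -/
def zeroPoint (R : Relations V) (d : DimSeq V) : CPoint R d where
  x := fun _ _ _ _ => 0
  sat := fun i j k r hr => by
    refine Finset.sum_eq_zero fun p hp => ?_
    have h2 := R.two_le_length j k r hr p hp
    cases p with
    | nil => simp at h2
    | cons p a => simp [evalPath]
  diff := fun _ _ => 0
  comm := fun _ _ _ _ => by simp
  sq_zero := fun _ _ => by simp

/-! ### The derived category and its Grothendieck group -/

noncomputable instance (R : Relations V) : HasDerivedCategory.{1} (ModuleCat.{0} (Alg R)) :=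
  HasDerivedCategory.standard _

/-- The objects of `D^b(A)`: bounded complexes of finitely generated (equivalently, if `A` is
finite-dimensional, finite-dimensional) `A`-modules. -/
structure BddComplex (R : Relations V) where
  cplx : CochainComplex (ModuleCat.{0} (Alg R)) ℤ
  finite : ∀ i, Module.Finite (Alg R) (cplx.X i)
  bounded : ∃ n : ℕ, ∀ i : ℤ, n < |i| → Limits.IsZero (cplx.X i)

/-- The relations `[Y] = [X] + [Z]` for the distinguished triangles `X → Y → Z → X[1]`. -/
def triangleRel (R : Relations V) : Set (FreeAbelianGroup (BddComplex R)) :=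
  {c | ∃ (X Y Z : BddComplex R)
      (f : DerivedCategory.Q.obj X.cplx ⟶ DerivedCategory.Q.obj Y.cplx)
      (g : DerivedCategory.Q.obj Y.cplx ⟶ DerivedCategory.Q.obj Z.cplx)
      (h : DerivedCategory.Q.obj Z.cplx ⟶ (DerivedCategory.Q.obj X.cplx)⟦(1 : ℤ)⟧),
      Pretriangulated.Triangle.mk f g h ∈
        Pretriangulated.distinguishedTriangles (C := DerivedCategory (ModuleCat.{0} (Alg R))) ∧
      c = FreeAbelianGroup.of Y - FreeAbelianGroup.of X - FreeAbelianGroup.of Z}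

/-- The Grothendieck group `K_0(D^b(A))`. -/
abbrev K0 (R : Relations V) : Type 1 :=
  FreeAbelianGroup (BddComplex R) ⧸ AddSubgroup.closure (triangleRel R)

/-- A point of `C^b(A, d)` as an object of `D^b(A)`. -/
noncomputable def CPoint.toBdd {R : Relations V} {d : DimSeq V} (p : CPoint R d) :
    BddComplex R where
  cplx := p.complex
  finite i := by
    have : Module.Finite ℂ (p.mod i) :=
      inferInstanceAs (Module.Finite ℂ (∀ j, Sp (d i j)))
    exact (Module.Finite.of_restrictScalars_finite ℂ (Alg R) (p.mod i) :)
  bounded := by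
    obtain ⟨n, hn⟩ := (d.support.image Int.natAbs).bddAbove
    refine ⟨n, fun i hi => ?_⟩
    have h0 : d i = 0 := by
      by_contra h
      have := hn (Finset.mem_coe.2 (Finset.mem_image_of_mem _ (Finsupp.mem_support_iff.2 h)))
      rw [Int.abs_eq_natAbs] at hi
      omega
    have : Subsingleton (p.mod i) := by
      refine ⟨fun v w => funext fun j => funext fun c => ?_⟩
      exact absurd c.2 (by simp [h0])
    exact ModuleCat.isZero_of_subsingleton (ModuleCat.of (Alg R) (p.mod i))

/-- The class in `K_0(D^b(A))` of an object of `D^b(A)`. -/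
def K0.mk {R : Relations V} (X : BddComplex R) : K0 R :=
  QuotientAddGroup.mk (FreeAbelianGroup.of X)

/-- The map from sequences of dimension vectors to `K_0(D^b(A))` induced by the canonical map: it
sends `d` to the class of a complex with this sequence of dimension vectors. The class does not
depend on the complex, and the one with semisimple terms and zero differential is taken. -/
noncomputable def dimClass (R : Relations V) (d : DimSeq V) : K0 R :=
  K0.mk (zeroPoint R d).toBdd

/-! ### Varieties of projective complexes -/

/-- The sequence `d(e)` of dimension vectors of a projective dimension sequence `e`, with
`d(e)_i` the dimension vector of `P^i = ⨁_j e^i_j P_j`. -/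
noncomputable def dimOf (R : Relations V) (e : DimSeq V) : DimSeq V :=
  e.mapRange (fun v => dimVec R (ProjSum R v)) (by
    funext k
    have : Subsingleton (ProjSum R (0 : V → ℕ)) :=
      ⟨fun v w => funext fun j => funext fun c => absurd c.2 (Nat.not_lt_zero _)⟩
    exact Module.finrank_zero_of_subsingleton)

/-- The points of `P^b(A, e)`: the points `(x_i, ∂_i)` of `C^b(A, d(e))` with
`(ℂ^{d_i}, x_i)` isomorphic to `⨁_j e^i_j P_j`, with the subspace topology. -/
abbrev PPoint (R : Relations V) (e : DimSeq V) : Type :=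
  {p : CPoint R (dimOf R e) // ∀ i, Nonempty (p.mod i ≃ₗ[Alg R] ProjSum R (e i))}

/-- The group `G_{d(e)}`. -/
abbrev PGL (R : Relations V) (e : DimSeq V) : Type := GLSeq (dimOf R e)

/-- The action of `G_{d(e)}` on `P^b(A, e)`. -/
noncomputable instance (R : Relations V) (e : DimSeq V) : MulAction (PGL R e) (PPoint R e) where
  smul g p := ⟨g • p.1, fun i => (p.2 i).map fun φ =>
    (repEquiv (p.1.sat i) ((g • p.1).sat i) (g i) (fun j k a => by
      refine LinearMap.ext fun v => ?_
      change _ = g i k (p.1.x i j k a ((g i j).symm (g i j v)))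
      simp)).symm.trans φ⟩
  one_smul p := Subtype.ext (one_smul _ p.1)
  mul_smul g h p := Subtype.ext (mul_smul g h p.1)

/-- The order on projective dimension sequences: `e₂ - e₁` is the projective dimension sequence of
a contractible (that is, acyclic) projective complex. -/
def PLE (R : Relations V) (e₁ e₂ : DimSeq V) : Prop :=
  e₁ ≤ e₂ ∧ ∃ p : PPoint R (e₂ - e₁), p.1.complex.Acyclic

/-- A bijection of coordinates as an isomorphism `ℂ^m ⊕ ℂ^n ≅ ℂ^N`. -/
noncomputable def spEquiv {m n N : ℕ} (s : Fin m ⊕ Fin n ≃ Fin N) : (Sp m × Sp n) ≃ₗ[ℂ] Sp N :=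
  (LinearEquiv.sumArrowLequivProdArrow (Fin m) (Fin n) ℂ ℂ).symm.trans
    (LinearEquiv.funCongrLeft ℂ ℂ s.symm)

/-- The block diagonal map `u ⊕ v`, in the coordinates given by `s` and `s'`. -/
noncomputable def blockSum {m n N m' n' N' : ℕ} (s : Fin m ⊕ Fin n ≃ Fin N)
    (s' : Fin m' ⊕ Fin n' ≃ Fin N') (u : Sp m →ₗ[ℂ] Sp m') (v : Sp n →ₗ[ℂ] Sp n') :
    Sp N →ₗ[ℂ] Sp N' :=
  (spEquiv s').toLinearMap ∘ₗ u.prodMap v ∘ₗ (spEquiv s).symm.toLinearMap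

/-- Identifications `ℂ^{d} ⊕ ℂ^{d'} = ℂ^{d''}` of coordinates, in all degrees and at all
vertices. -/
abbrev CoordSum (d d' d'' : DimSeq V) : Type :=
  ∀ (i : ℤ) (j : V), Fin (d i j) ⊕ Fin (d' i j) ≃ Fin (d'' i j)

theorem satisfies_prod {R : Relations V} {W W' : V → Type} [∀ j, AddCommGroup (W j)]
    [∀ j, Module ℂ (W j)] [∀ j, AddCommGroup (W' j)] [∀ j, Module ℂ (W' j)] {x : QRep W}
    {y : QRep W'} (hx : Satisfies R x) (hy : Satisfies R y) :
    Satisfies (W := fun j => W j × W' j) R fun j k a => (x j k a).prodMap (y j k a) := by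
  have key : ∀ (j k : V) (p : Quiver.Path j k),
      evalPath (W := fun j => W j × W' j) (fun j k a => (x j k a).prodMap (y j k a)) p =
        (evalPath x p).prodMap (evalPath y p) := by
    intro j k p
    induction p with
    | nil => rfl
    | cons p a ih => rw [evalPath, ih]; rfl
  intro j k r hr
  refine LinearMap.ext fun v => ?_
  have h1 := LinearMap.congr_fun (hx j k r hr) v.1
  have h2 := LinearMap.congr_fun (hy j k r hr) v.2
  simp only [Finsupp.sum, LinearMap.sum_apply, LinearMap.smul_apply, LinearMap.zero_apply]
    at h1 h2 ⊢
  refine Prod.ext ?_ ?_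
  · simpa [key, Prod.fst_sum] using h1
  · simpa [key, Prod.snd_sum] using h2

/-- The direct sum of two complexes, in the coordinates given by `s`. -/
noncomputable def sumPoint {R : Relations V} {d d' d'' : DimSeq V} (s : CoordSum d d' d'')
    (p : CPoint R d) (q : CPoint R d') : CPoint R d'' where
  x i j k a := blockSum (s i j) (s i k) (p.x i j k a) (q.x i j k a)
  sat i := CPoint.satisfies_conj (satisfies_prod (p.sat i) (q.sat i)) (fun j => spEquiv (s i j))
    (fun j k a => by refine LinearMap.ext fun v => ?_; simp [blockSum])
  diff i j := blockSum (s i j) (s (i + 1) j) (p.diff i j) (q.diff i j)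
  comm i j k a := by
    refine LinearMap.ext fun v => ?_
    have h1 := LinearMap.congr_fun (p.comm i j k a) ((spEquiv (s i j)).symm v).1
    have h2 := LinearMap.congr_fun (q.comm i j k a) ((spEquiv (s i j)).symm v).2
    simp only [LinearMap.comp_apply] at h1 h2
    simp [blockSum, h1, h2]
  sq_zero i j := by
    refine LinearMap.ext fun v => ?_
    have h1 := LinearMap.congr_fun (p.sq_zero i j) ((spEquiv (s i j)).symm v).1
    have h2 := LinearMap.congr_fun (q.sq_zero i j) ((spEquiv (s i j)).symm v).2
    simp only [LinearMap.comp_apply, LinearMap.zero_apply] at h1 h2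
    simp [blockSum, h1, h2]

/-- The underlying `A`-module of the direct sum in a given degree. -/
noncomputable def sumPointEquiv {R : Relations V} {d d' d'' : DimSeq V} (s : CoordSum d d' d'')
    (p : CPoint R d) (q : CPoint R d') (i : ℤ) :
    (sumPoint s p q).mod i ≃ₗ[Alg R] p.mod i × q.mod i :=
  (repEquiv (satisfies_prod (p.sat i) (q.sat i)) ((sumPoint s p q).sat i)
    (fun j => spEquiv (s i j))
    (fun j k a => by refine LinearMap.ext fun v => ?_; simp [sumPoint, blockSum])).symm.trans
  (LinearEquiv.ofBijective
    ((repLin (satisfies_prod (p.sat i) (q.sat i)) (p.sat i) (fun _ => LinearMap.fst ℂ _ _)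
      (fun _ _ _ => rfl)).prod
    (repLin (satisfies_prod (p.sat i) (q.sat i)) (q.sat i) (fun _ => LinearMap.snd ℂ _ _)
      (fun _ _ _ => rfl)))
    ⟨fun _ _ h => funext fun j => Prod.ext (congrFun (congrArg Prod.fst h) j)
        (congrFun (congrArg Prod.snd h) j),
      fun w => ⟨fun j => (w.1 j, w.2 j), rfl⟩⟩)

theorem projSum_add (R : Relations V) (e f : V → ℕ) :
    Nonempty ((ProjSum R e × ProjSum R f) ≃ₗ[Alg R] ProjSum R (e + f)) := by
  let φ : (ProjSum R e × ProjSum R f) →ₗ[Alg R]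
      (∀ j, Fin (e j) ⊕ Fin (f j) → Proj R j) :=
    { toFun := fun v j => Sum.elim (v.1 j) (v.2 j)
      map_add' := fun v w => by
        funext j c
        cases c <;> rfl
      map_smul' := fun a v => by
        funext j c
        cases c <;> rfl }
  have hφ : Function.Bijective φ :=
    ⟨fun v w h => Prod.ext (funext fun j => funext fun c => congrFun (congrFun h j) (Sum.inl c))
        (funext fun j => funext fun c => congrFun (congrFun h j) (Sum.inr c)),
      fun w => ⟨(fun j c => w j (Sum.inl c), fun j c => w j (Sum.inr c)), by
        funext j c
        cases c <;> rfl⟩⟩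
  exact ⟨(LinearEquiv.ofBijective φ hφ).trans
    (LinearEquiv.piCongrRight fun j => LinearEquiv.funCongrLeft (Alg R) (Proj R j)
      (finSumFinEquiv (m := e j) (n := f j)).symm)⟩

/-- The inclusion `G_d → G_{d''}`, `g ↦ diag(g, 1)`, in the coordinates given by `s`. -/
noncomputable def glSum {d d' d'' : DimSeq V} (s : CoordSum d d' d'') :
    GLSeq d →* GLSeq d'' where
  toFun g i j := (spEquiv (s i j)).symm.trans
    (((g i j).prodCongr (LinearEquiv.refl ℂ _)).trans (spEquiv (s i j)))
  map_one' := by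
    funext i j
    refine LinearEquiv.ext fun v => ?_
    exact (spEquiv (s i j)).apply_symm_apply v
  map_mul' g h := by
    funext i j
    refine LinearEquiv.ext fun v => ?_
    simp

theorem glSum_smul_sumPoint {R : Relations V} {d d' d'' : DimSeq V} (s : CoordSum d d' d'')
    (g : GLSeq d) (p : CPoint R d) (q : CPoint R d') :
    glSum s g • sumPoint s p q = sumPoint s (g • p) q := by
  refine CPoint.ext ?_ ?_
  · funext i j k a
    refine LinearMap.ext fun v => ?_
    change glSum s g i k ((sumPoint s p q).x i j k a ((glSum s g i j).symm v)) =
      blockSum _ _ ((g i k).toLinearMap ∘ₗ p.x i j k a ∘ₗ (g i j).symm.toLinearMap) _ v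
    simp [sumPoint, blockSum, glSum]
  · funext i j
    refine LinearMap.ext fun v => ?_
    change glSum s g (i + 1) j ((sumPoint s p q).diff i j ((glSum s g i j).symm v)) =
      blockSum _ _ ((g (i + 1) j).toLinearMap ∘ₗ p.diff i j ∘ₗ (g i j).symm.toLinearMap) _ v
    simp [sumPoint, blockSum, glSum]

/-- The projective dimension sequences `e` with `d(e)` in the fibre over `d ∈ K_0(D^b(A))`. -/
abbrev Idx (R : Relations V) (d : K0 R) : Type :=
  {e : DimSeq V // dimClass R (dimOf R e) = d}

/-- The direct sum of a projective complex in `P^b(A, e₁)` and one in `P^b(A, e₂ - e₁)`, in the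
coordinates given by `s`. -/
noncomputable def addPoint {R : Relations V} {e₁ e₂ : DimSeq V} (h : e₁ ≤ e₂)
    (s : CoordSum (dimOf R e₁) (dimOf R (e₂ - e₁)) (dimOf R e₂))
    (p : PPoint R e₁) (q : PPoint R (e₂ - e₁)) : PPoint R e₂ :=
  ⟨sumPoint s p.1 q.1, fun i => by
    obtain ⟨φ⟩ := p.2 i
    obtain ⟨ψ⟩ := q.2 i
    obtain ⟨χ⟩ := projSum_add R (e₁ i) ((e₂ - e₁) i)
    have he : e₁ i + (e₂ - e₁) i = e₂ i := by
      rw [← Finsupp.add_apply, add_tsub_cancel_of_le h]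
    rw [he] at χ
    exact ⟨(sumPointEquiv s p.1 q.1 i).trans ((φ.prodCongr ψ).trans χ)⟩⟩

/-! ### The direct systems and their limits -/

/-- A coherent choice of contractible projective complexes `P(e₁, e₂) ∈ P^b(A, e₂ - e₁)` for all
`e₁ ≤ e₂` over `d`, together with identifications of the coordinates of `ℂ^{d(e₂)}` with those of
`ℂ^{d(e₁)} ⊕ ℂ^{d(e₂ - e₁)}`. Coherence means that the inclusions `ℂ^{d(e₁)} ⊆ ℂ^{d(e₂)}` are
compatible with composition, and that `P(e₁, e₂) ⊕ P(e₂, e₃) = P(e₁, e₃)` as direct summands, that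
is, `(X ⊕ P(e₁, e₂)) ⊕ P(e₂, e₃) = X ⊕ P(e₁, e₃)` in `P^b(A, e₃)` for all `X` in
`P^b(A, e₁)`. -/
structure ContractibleSystem (R : Relations V) (d : K0 R) where
  compl : ∀ {e₁ e₂ : Idx R d}, PLE R e₁.1 e₂.1 → PPoint R (e₂.1 - e₁.1)
  acyclic : ∀ {e₁ e₂ : Idx R d} (h : PLE R e₁.1 e₂.1), (compl h).1.complex.Acyclic
  coords : ∀ {e₁ e₂ : Idx R d}, PLE R e₁.1 e₂.1 →
    CoordSum (dimOf R e₁.1) (dimOf R (e₂.1 - e₁.1)) (dimOf R e₂.1)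
  coords_trans : ∀ {e₁ e₂ e₃ : Idx R d} (h : PLE R e₁.1 e₂.1) (h' : PLE R e₂.1 e₃.1)
    (h'' : PLE R e₁.1 e₃.1) (i : ℤ) (j : V) (c : Fin (dimOf R e₁.1 i j)),
    coords h' i j (Sum.inl (coords h i j (Sum.inl c))) = coords h'' i j (Sum.inl c)
  compl_trans : ∀ {e₁ e₂ e₃ : Idx R d} (h : PLE R e₁.1 e₂.1) (h' : PLE R e₂.1 e₃.1)
    (h'' : PLE R e₁.1 e₃.1) (X : PPoint R e₁.1),
    addPoint h'.1 (coords h') (addPoint h.1 (coords h) X (compl h)) (compl h') =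
      addPoint h''.1 (coords h'') X (compl h'')

namespace ContractibleSystem

variable {R : Relations V} {d : K0 R} (S : ContractibleSystem R d)

/-- The map `t : P^b(A, e₁) → P^b(A, e₂)`, `X ↦ X ⊕ P(e₁, e₂)`. -/
noncomputable def t {e₁ e₂ : Idx R d} (h : PLE R e₁.1 e₂.1) (X : PPoint R e₁.1) :
    PPoint R e₂.1 :=
  addPoint h.1 (S.coords h) X (S.compl h)

/-- The map `f : G_{d(e₁)} → G_{d(e₂)}`, `g ↦ diag(g, 1)`. -/
noncomputable def f {e₁ e₂ : Idx R d} (h : PLE R e₁.1 e₂.1) : PGL R e₁.1 →* PGL R e₂.1 :=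
  glSum (S.coords h)

theorem f_smul_t {e₁ e₂ : Idx R d} (h : PLE R e₁.1 e₂.1) (g : PGL R e₁.1) (X : PPoint R e₁.1) :
    S.f h g • S.t h X = S.t h (g • X) :=
  Subtype.ext (glSum_smul_sumPoint (S.coords h) g X.1 (S.compl h).1)

/-- The space `P^b(A, d)`, the direct limit (with the limit topology) of the spaces `P^b(A, e)`
along the maps `t`. -/
abbrev PLim : Type :=
  Quot fun a b : Σ e : Idx R d, PPoint R e.1 => ∃ h : PLE R a.1.1 b.1.1, b.2 = S.t h a.2

/-- The canonical map `P^b(A, e) → P^b(A, d)`. -/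
def toPLim (e : Idx R d) (X : PPoint R e.1) : S.PLim := Quot.mk _ ⟨e, X⟩

/-- The group `G_d`, the direct limit (that is, the colimit) of the groups `G_{d(e)}` along the
maps `f`: the free product modulo the relations `f(g) = g`. -/
abbrev GLim : Type :=
  Monoid.CoprodI (fun e : Idx R d => PGL R e.1) ⧸
    Subgroup.normalClosure {c : Monoid.CoprodI (fun e : Idx R d => PGL R e.1) |
      ∃ (e₁ e₂ : Idx R d) (h : PLE R e₁.1 e₂.1) (g : PGL R e₁.1),
        c = Monoid.CoprodI.of (M := fun e : Idx R d => PGL R e.1) (i := e₂) (S.f h g) *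
          (Monoid.CoprodI.of (M := fun e : Idx R d => PGL R e.1) (i := e₁) g)⁻¹}

/-- The canonical map `G_{d(e)} → G_d`. -/
noncomputable def toGLim (e : Idx R d) : PGL R e.1 →* S.GLim :=
  (QuotientGroup.mk' _).comp (Monoid.CoprodI.of (M := fun e : Idx R d => PGL R e.1) (i := e))

/-- The action of `G_d` on `P^b(A, d)` is induced by the actions of the `G_{d(e)}`. -/
def IsInducedAction (act : MulAction S.GLim S.PLim) : Prop :=
  ∀ (e e' e'' : Idx R d) (h : PLE R e.1 e''.1) (h' : PLE R e'.1 e''.1) (g : PGL R e.1)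
    (X : PPoint R e'.1),
    act.smul (S.toGLim e g) (S.toPLim e' X) = S.toPLim e'' (S.f h g • S.t h' X)

/-- Two points of `P^b(A, d)` are equivalent if the corresponding projective complexes are
quasi-isomorphic, that is, isomorphic in the derived category. -/
def QuasiIsomorphic (x y : S.PLim) : Prop :=
  ∃ a b : Σ e : Idx R d, PPoint R e.1, S.toPLim a.1 a.2 = x ∧ S.toPLim b.1 b.2 = y ∧
    Nonempty (DerivedCategory.Q.obj a.2.1.complex ≅ DerivedCategory.Q.obj b.2.1.complex)

/-- The quotient space `QP^b(A, d)` of quasi-isomorphism classes. -/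
abbrev QP : Type := Quot S.QuasiIsomorphic

/-- The transition map `QP^b(A, e₁) → QP^b(A, e₂)` of orbit spaces induced by `t`. -/
noncomputable def orbitMap {e₁ e₂ : Idx R d} (h : PLE R e₁.1 e₂.1) :
    MulAction.orbitRel.Quotient (PGL R e₁.1) (PPoint R e₁.1) →
      MulAction.orbitRel.Quotient (PGL R e₂.1) (PPoint R e₂.1) :=
  Quotient.map' (S.t h) (by
    rintro _ Y ⟨g, rfl⟩
    exact ⟨S.f h g, S.f_smul_t h g Y⟩)

/-- The direct limit (with the limit topology) of the orbit spaces
`QP^b(A, e) = P^b(A, e)/G_{d(e)}`. -/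
abbrev QPLim : Type :=
  Quot fun a b : Σ e : Idx R d, MulAction.orbitRel.Quotient (PGL R e.1) (PPoint R e.1) =>
    ∃ h : PLE R a.1.1 b.1.1, b.2 = S.orbitMap h a.2

/-- The class in `lim QP^b(A, e)` of the orbit of a point of `P^b(A, e)`. -/
noncomputable def toQPLim (e : Idx R d) (X : PPoint R e.1) : S.QPLim := Quot.mk _ ⟨e, Quotient.mk'' X⟩

end ContractibleSystem

end Complexes

end BoundQuiver

set_option linter.unusedSectionVars false
set_option linter.style.haveILetI false

namespace BoundQuiver

/-! ### The path-length filtration of the algebra -/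

section PathFiltration

variable {V : Type} [Quiver.{0} V] [Fintype V] [DecidableEq V]

/-! The order has a numerical description. A bounded acyclic complex of finitely generated
projectives splits into pieces P → P, so `PLE R e₁ e₂` means that e₂ - e₁ is some `coneSeq a`, with
entry a i + a (i - 1) in degree i for a finitely supported a ≥ 0 (`PLE.exists_coneSeq`,
`ple_add_coneSeq`).

Directedness: the Euler characteristic of homology at a vertex is additive on triangles, so a class
in K_0 determines the alternating sum of the dimension vectors of the terms. By finite global
dimension the Cartan matrix is injective (`cartan_injective`), so the alternating sum of the
multiplicities is determined too. Hence two sequences over one class differ by b i + b (i - 1) with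
b integer-valued and finitely supported (`exists_virtual_coneSeq`), and adding the cones of the
negative and positive parts of b gives a common upper bound.

Coherence: fix a base sequence e₀ and let b belong to e relative to e₀. The copies of P_l in degree
i are put at the integers of the interval [-b i l, b (i - 1) l + e₀ i l). Going up in the order
extends these intervals at both ends, and the reflection m ↦ e₀ (i + 1) l - 1 - m, which does not
depend on e, matches the new left positions in degree i with the new right positions in degree i +
1. The contractible complements obtained from this matching compose strictly
(`sumPoint_contractionPoint_trans`).

Quasi-isomorphism against orbits: an isomorphism in the derived category between bounded complexes
of projectives comes from a homotopy equivalence. After adding complements it yields a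
quasi-isomorphism f : X → Y between complexes with equal dimension vectors. The degreewise split
sequence X → Y ⊕ cone (id X) → cone f splits, because cone f is contractible, so X ⊕ cone f ≅ Y ⊕
cone (id X). Finitely generated projectives are determined by their dimension vectors, and therefore
so are bounded acyclic complexes of them; hence both cones are isomorphic to one complement of the
system. Thus X and Y become conjugate one transition later (`exists_smul_t_eq`). Conversely,
conjugate points have isomorphic complexes.

The rest is formal: the action is defined at common upper bounds, and the homeomorphisms hold
because all three spaces are quotients by the same identifications. -/

theorem toAlg_eq_of_rel {R : Relations V} {a b : FreeAlg V} (h : AlgRel R a b) :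
    toAlg R a = toAlg R b := RingQuot.mkAlgHom_rel ℂ h

/-- The class of a path in the algebra `ℂQ/J`. -/
noncomputable def pathElt (R : Relations V) {j k : V} (p : Quiver.Path j k) : Alg R :=
  toAlg R (pathWord p)

/-- The class of an arrow in the algebra `ℂQ/J`. -/
noncomputable def arrElt (R : Relations V) {j k : V} (a : j ⟶ k) : Alg R := toAlg R (arr a)

variable (R : Relations V)

theorem pathElt_nil (j : V) : pathElt R (Quiver.Path.nil : Quiver.Path j j) = idem R j := rfl

theorem pathElt_cons {j k l : V} (p : Quiver.Path j k) (a : k ⟶ l) :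
    pathElt R (p.cons a) = arrElt R a * pathElt R p := by
  simp [pathElt, pathWord, arrElt]

theorem idem_mul_self (j : V) : idem R j * idem R j = idem R j := by
  simpa [idem] using toAlg_eq_of_rel (AlgRel.vtx_sq (R := R) j)

theorem idem_mul_of_ne {j k : V} (h : j ≠ k) : idem R j * idem R k = 0 := by
  simpa [idem] using toAlg_eq_of_rel (AlgRel.vtx_ne (R := R) j k h)

theorem sum_idem : ∑ j, idem R j = 1 := by
  simpa [idem] using toAlg_eq_of_rel (AlgRel.vtx_sum (R := R))

theorem idem_mul_arrElt {j k : V} (a : j ⟶ k) : idem R k * arrElt R a = arrElt R a := by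
  simpa [idem, arrElt] using toAlg_eq_of_rel (AlgRel.target (R := R) j k a)

theorem arrElt_mul_idem {j k : V} (a : j ⟶ k) : arrElt R a * idem R j = arrElt R a := by
  simpa [idem, arrElt] using toAlg_eq_of_rel (AlgRel.source (R := R) j k a)

theorem idem_mul_pathElt {j k : V} (p : Quiver.Path j k) :
    idem R k * pathElt R p = pathElt R p := by
  cases p with
  | nil => exact idem_mul_self R j
  | cons p a => rw [pathElt_cons, ← mul_assoc, idem_mul_arrElt]

theorem idem_mul_pathElt_of_ne {j k l : V} (h : l ≠ k) (p : Quiver.Path j k) :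
    idem R l * pathElt R p = 0 := by
  rw [← idem_mul_pathElt, ← mul_assoc, idem_mul_of_ne R h, zero_mul]

theorem pathElt_mul_idem {j k : V} (p : Quiver.Path j k) :
    pathElt R p * idem R j = pathElt R p := by
  induction p with
  | nil => exact idem_mul_self R j
  | cons p a ih => rw [pathElt_cons, mul_assoc, ih]

theorem pathElt_mul_pathElt {i j k : V} (q : Quiver.Path j k) (p : Quiver.Path i j) :
    pathElt R q * pathElt R p = pathElt R (p.comp q) := by
  induction q with
  | nil => exact idem_mul_pathElt R p
  | cons q a ih => rw [pathElt_cons, mul_assoc, ih, Quiver.Path.comp_cons, pathElt_cons]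

theorem pathElt_mul_pathElt_of_ne {i j j' k : V} (h : j' ≠ j) (q : Quiver.Path j' k)
    (p : Quiver.Path i j) : pathElt R q * pathElt R p = 0 := by
  rw [← pathElt_mul_idem, mul_assoc, idem_mul_pathElt_of_ne R h, mul_zero]

/-- The subspace of the algebra spanned by the paths of length at least `n`. -/
noncomputable def pathFil (n : ℕ) : Submodule ℂ (Alg R) :=
  Submodule.span ℂ {x | ∃ (j k : V) (p : Quiver.Path j k), n ≤ p.length ∧ x = pathElt R p}

theorem pathElt_mem_pathFil {n : ℕ} {j k : V} (p : Quiver.Path j k) (h : n ≤ p.length) :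
    pathElt R p ∈ pathFil R n := Submodule.subset_span ⟨j, k, p, h, rfl⟩

theorem mul_mem_pathFil {m n : ℕ} {a b : Alg R} (ha : a ∈ pathFil R m) (hb : b ∈ pathFil R n) :
    a * b ∈ pathFil R (m + n) := by
  have : pathFil R m * pathFil R n ≤ pathFil R (m + n) := by
    rw [pathFil, pathFil, Submodule.span_mul_span, Submodule.span_le]
    rintro _ ⟨_, ⟨j', k, q, hq, rfl⟩, _, ⟨i, j, p, hp, rfl⟩, rfl⟩
    rcases eq_or_ne j' j with rfl | h
    · simp only [pathElt_mul_pathElt]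
      exact pathElt_mem_pathFil R _ (by rw [Quiver.Path.length_comp]; omega)
    · simp [pathElt_mul_pathElt_of_ne R h]
  exact this (Submodule.mul_mem_mul ha hb)

/-- The trivial paths sum to one and the span of the paths is closed under products, so it contains
every word in the generators. -/
theorem pathFil_zero : pathFil R 0 = ⊤ := by
  rw [eq_top_iff]
  rintro x -
  obtain ⟨c, rfl⟩ := RingQuot.mkAlgHom_surjective ℂ (AlgRel R) x
  have hone : (1 : Alg R) ∈ pathFil R 0 := by
    rw [← sum_idem]
    exact Submodule.sum_mem _ fun j _ =>
      pathElt_mem_pathFil R (Quiver.Path.nil : Quiver.Path j j) (Nat.zero_le _)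
  induction c using FreeAlgebra.induction with
  | grade0 r =>
    rw [AlgHom.commutes, Algebra.algebraMap_eq_smul_one]
    exact Submodule.smul_mem _ _ hone
  | grade1 g =>
    rcases g with j | ⟨j, k, a⟩
    · exact pathElt_mem_pathFil R (Quiver.Path.nil : Quiver.Path j j) (Nat.zero_le _)
    · have h := pathElt_mem_pathFil R (n := 0) ((Quiver.Path.nil : Quiver.Path j j).cons a)
        (Nat.zero_le _)
      rwa [pathElt_cons, pathElt_nil, arrElt_mul_idem] at h
  | mul a b ha hb =>
    rw [map_mul]
    simpa only [zero_add] using mul_mem_pathFil R ha hb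
  | add a b ha hb => rw [map_add]; exact Submodule.add_mem _ ha hb

/-- Modulo paths of positive length only the vertices survive. The coefficients are the scalars by
which an element acts on the top of a module. -/
theorem exists_sub_mem_pathFil_one (a : Alg R) :
    ∃ c : V → ℂ, a - ∑ k, c k • idem R k ∈ pathFil R 1 := by
  have ha : a ∈ pathFil R 0 := by rw [pathFil_zero]; trivial
  induction ha using Submodule.span_induction with
  | mem x hx =>
    obtain ⟨j, k, p, -, rfl⟩ := hx
    cases p with
    | nil =>
      refine ⟨Pi.single j 1, ?_⟩
      have : ∑ k, (Pi.single j 1 : V → ℂ) k • idem R k = idem R j := by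
        rw [Finset.sum_eq_single j]
        · simp
        · intro b _ hb; simp [hb]
        · simp
      rw [this, pathElt_nil, sub_self]
      exact Submodule.zero_mem _
    | cons p a =>
      refine ⟨0, ?_⟩
      simpa using pathElt_mem_pathFil R (p.cons a) (by simp)
  | zero => exact ⟨0, by simp⟩
  | add x y _ _ hx hy =>
    obtain ⟨c, hc⟩ := hx
    obtain ⟨c', hc'⟩ := hy
    refine ⟨c + c', ?_⟩
    have := Submodule.add_mem _ hc hc'
    simpa [add_smul, Finset.sum_add_distrib, add_sub_add_comm] using this
  | smul r x _ hx =>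
    obtain ⟨c, hc⟩ := hx
    refine ⟨r • c, ?_⟩
    have := Submodule.smul_mem _ r hc
    simpa [smul_sub, Finset.smul_sum, smul_smul] using this

variable {R}

theorem Relations.Admissible.exists_pathFil_eq_bot (hR : R.Admissible) :
    ∃ N, pathFil R N = ⊥ := by
  obtain ⟨N, hN⟩ := hR
  refine ⟨N, ?_⟩
  rw [pathFil, Submodule.span_eq_bot]
  rintro _ ⟨j, k, p, hp, rfl⟩
  exact hN j k p hp

theorem finite_setOf_length_eq {V : Type} [Quiver.{0} V] [Finite V]
    [∀ j k : V, Finite (j ⟶ k)] (n : ℕ) :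
    Finite {q : Σ j k : V, Quiver.Path j k // q.2.2.length = n} := by
  induction n with
  | zero =>
    refine Finite.of_surjective (fun j : V => ⟨⟨j, j, .nil⟩, rfl⟩) ?_
    rintro ⟨⟨j, k, p⟩, hp⟩
    cases p with
    | nil => exact ⟨j, rfl⟩
    | cons p a => simp at hp
  | succ n ih =>
    refine Finite.of_surjective (α := Σ (q : {q : Σ j k : V, Quiver.Path j k // q.2.2.length = n})
      (l : V), (q.1.2.1 ⟶ l)) (fun q => ⟨⟨q.1.1.1, q.2.1, q.1.1.2.2.cons q.2.2⟩, by
        simpa using q.1.2⟩) ?_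
    rintro ⟨⟨j, k, p⟩, hp⟩
    cases p with
    | nil => simp at hp
    | cons p a => exact ⟨⟨⟨⟨_, _, p⟩, by simpa using hp⟩, _, a⟩, rfl⟩

/-- Admissibility leaves only the paths shorter than `N`, and finitely many vertices and arrows give
finitely many of these. -/
theorem Relations.Admissible.finite [∀ j k : V, Finite (j ⟶ k)] (hR : R.Admissible) :
    Module.Finite ℂ (Alg R) := by
  obtain ⟨N, hN⟩ := hR
  let S : Set (Alg R) := ⋃ n ∈ Set.Iio N,
    Set.range fun q : {q : Σ j k : V, Quiver.Path j k // q.2.2.length = n} => pathElt R q.1.2.2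
  have hS : S.Finite := by
    refine Set.Finite.biUnion (Set.finite_Iio N) fun n _ => ?_
    have := finite_setOf_length_eq (V := V) n
    exact Set.finite_range _
  refine Module.finite_def.2 ((Submodule.fg_def).2 ⟨S, hS, ?_⟩)
  rw [eq_top_iff, ← pathFil_zero, pathFil, Submodule.span_le]
  rintro _ ⟨j, k, p, -, rfl⟩
  by_cases h : N ≤ p.length
  · rw [show pathElt R p = 0 from hN j k p h]
    exact Submodule.zero_mem _
  · refine Submodule.subset_span (Set.mem_biUnion (Set.mem_Iio.2 (not_le.1 h)) ?_)
    exact ⟨⟨⟨j, k, p⟩, rfl⟩, rfl⟩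

end PathFiltration

/-! ### Nakayama's lemma for the arrow ideal -/

section Nakayama

variable {V : Type} [Quiver.{0} V] [Fintype V] [DecidableEq V] {R : Relations V}

/-- The submodule generated by the elements `a • m` with `a` a combination of paths of length at
least `n`. -/
noncomputable def radLayer (R : Relations V) (M : Type) [AddCommGroup M] [Module (Alg R) M]
    (n : ℕ) : Submodule (Alg R) M :=
  Submodule.span (Alg R) {x | ∃ a ∈ pathFil R n, ∃ m : M, x = a • m}

variable {M : Type} [AddCommGroup M] [Module (Alg R) M]

theorem smul_mem_radLayer {n : ℕ} {a : Alg R} (ha : a ∈ pathFil R n) (m : M) :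
    a • m ∈ radLayer R M n := Submodule.subset_span ⟨a, ha, m, rfl⟩

/-- The layer allows arbitrary coefficients from the algebra; they are absorbed on the right of `a`
because `pathFil R 0` is everything, without lowering the filtration degree. -/
theorem smul_mem_radLayer_succ {n : ℕ} {a : Alg R} (ha : a ∈ pathFil R n) {m : M}
    (hm : m ∈ radLayer R M 1) : a • m ∈ radLayer R M (n + 1) := by
  induction hm using Submodule.span_induction generalizing a with
  | mem x hx =>
    obtain ⟨b, hb, m, rfl⟩ := hx
    rw [smul_smul]
    exact smul_mem_radLayer (mul_mem_pathFil R ha hb) m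
  | zero => simp
  | add x y _ _ hx hy => rw [smul_add]; exact Submodule.add_mem _ (hx ha) (hy ha)
  | smul c x _ hx =>
    rw [smul_smul]
    refine hx ?_
    have hc : c ∈ pathFil R 0 := by rw [pathFil_zero]; trivial
    simpa using mul_mem_pathFil R ha hc

/-- Nakayama's lemma for the ideal generated by the arrows. -/
theorem eq_top_of_sup_radLayer (hR : R.Admissible) {N : Submodule (Alg R) M}
    (h : N ⊔ radLayer R M 1 = ⊤) : N = ⊤ := by
  -- The equation M = N + JM is substituted into itself; for large `n` the second summand dies by
  -- admissibility.
  have key : ∀ n, N ⊔ radLayer R M n = ⊤ := by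
    intro n
    induction n with
    | zero =>
      refine eq_top_iff.2 fun m _ => Submodule.mem_sup_right ?_
      have h1 : (1 : Alg R) ∈ pathFil R 0 := by rw [pathFil_zero]; trivial
      simpa using smul_mem_radLayer h1 m
    | succ n ih =>
      rw [eq_top_iff, ← ih]
      refine sup_le le_sup_left (Submodule.span_le.2 ?_)
      rintro _ ⟨a, ha, m, rfl⟩
      obtain ⟨y, hy, z, hz, rfl⟩ := Submodule.mem_sup.1 (h ▸ Submodule.mem_top (x := m))
      rw [smul_add]
      exact Submodule.add_mem _ (Submodule.mem_sup_left (N.smul_mem a hy))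
        (Submodule.mem_sup_right (smul_mem_radLayer_succ ha hz))
  obtain ⟨n, hn⟩ := hR.exists_pathFil_eq_bot
  rw [← key n, left_eq_sup, radLayer, Submodule.span_le]
  rintro _ ⟨a, ha, m, rfl⟩
  rw [hn, Submodule.mem_bot] at ha
  simp [ha]

end Nakayama

/-! ### Dimension vectors as additive invariants -/

section VertexDimension

variable {V : Type} [Quiver.{0} V] [Fintype V] [DecidableEq V] (R : Relations V)

/-- The dimension of `ε_k M` for a module without a chosen `ℂ`-structure. -/
noncomputable def vtxDim (M : Type) [AddCommGroup M] [Module (Alg R) M] (k : V) : ℕ :=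
  letI := Module.restrictScalars ℂ (Alg R) M
  haveI := IsScalarTower.restrictScalars ℂ (Alg R) M
  dimVec R M k

/-- A scalar tower forces the `ℂ`-structure to be restriction along `algebraMap`. Dimension vectors
therefore depend on the `Alg R`-module alone, and `vtxDim` applies to kernels and homology without a
chosen `ℂ`-structure. -/
theorem dimVec_eq_vtxDim (M : Type) [AddCommGroup M] [i : Module ℂ M] [Module (Alg R) M]
    [IsScalarTower ℂ (Alg R) M] (k : V) : dimVec R M k = vtxDim R M k := by
  have h : i = Module.restrictScalars ℂ (Alg R) M := by
    refine Module.ext' _ _ fun c m => ?_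
    change c • m = algebraMap ℂ (Alg R) c • m
    rw [algebraMap_smul]
  subst h
  rfl

variable {R}
variable {M N P : Type} [AddCommGroup M] [Module (Alg R) M] [AddCommGroup N] [Module (Alg R) N]
  [AddCommGroup P] [Module (Alg R) P]

theorem vtxDim_congr (φ : M ≃ₗ[Alg R] N) (k : V) : vtxDim R M k = vtxDim R N k := by
  letI := Module.restrictScalars ℂ (Alg R) M
  haveI := IsScalarTower.restrictScalars ℂ (Alg R) M
  letI := Module.restrictScalars ℂ (Alg R) N
  haveI := IsScalarTower.restrictScalars ℂ (Alg R) N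
  rw [← dimVec_eq_vtxDim, ← dimVec_eq_vtxDim, dimVec, dimVec]
  refine (LinearEquiv.finrank_map_eq (φ.restrictScalars ℂ) _).symm.trans ?_
  suffices h : Submodule.map (φ.restrictScalars ℂ).toLinearMap
      (LinearMap.range ((Algebra.lsmul ℂ ℂ M) (idem R k))) =
      LinearMap.range ((Algebra.lsmul ℂ ℂ N) (idem R k)) by rw [h]
  ext x
  simp only [Submodule.mem_map, LinearMap.mem_range]
  constructor
  · rintro ⟨_, ⟨m, rfl⟩, rfl⟩
    exact ⟨φ m, by simp⟩
  · rintro ⟨n, rfl⟩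
    exact ⟨idem R k • φ.symm n, ⟨φ.symm n, rfl⟩, by simp⟩

/-- The corner functor M ↦ ε_k M is exact, so this is rank-nullity for the induced map ε_k M → ε_k
N. -/
theorem vtxDim_of_surjective [Module.Finite ℂ (Alg R)] [Module.Finite (Alg R) M]
    (f : M →ₗ[Alg R] N) (hf : Function.Surjective f) (k : V) :
    vtxDim R M k = vtxDim R (LinearMap.ker f) k + vtxDim R N k := by
  letI := Module.restrictScalars ℂ (Alg R) M
  haveI := IsScalarTower.restrictScalars ℂ (Alg R) M
  letI := Module.restrictScalars ℂ (Alg R) N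
  haveI := IsScalarTower.restrictScalars ℂ (Alg R) N
  haveI : Module.Finite ℂ M := Module.Finite.trans (Alg R) M
  rw [← dimVec_eq_vtxDim, ← dimVec_eq_vtxDim, ← dimVec_eq_vtxDim, dimVec, dimVec, dimVec]
  set EM := LinearMap.range (Algebra.lsmul ℂ ℂ M (idem R k))
  set EN := LinearMap.range (Algebra.lsmul ℂ ℂ N (idem R k))
  have hmem : ∀ m ∈ EM, f.restrictScalars ℂ m ∈ EN := by
    rintro _ ⟨m, rfl⟩
    exact ⟨f m, by simp⟩
  let g : EM →ₗ[ℂ] EN := (f.restrictScalars ℂ).restrict hmem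
  have hg : Function.Surjective g := by
    rintro ⟨_, n, rfl⟩
    obtain ⟨m, rfl⟩ := hf n
    exact ⟨⟨idem R k • m, m, rfl⟩, Subtype.ext (by simp [g, LinearMap.restrict_apply])⟩
  have h1 := LinearMap.finrank_range_add_finrank_ker g
  rw [LinearMap.range_eq_top.2 hg, finrank_top] at h1
  rw [← h1, add_comm]
  congr 1
  set EK := LinearMap.range (Algebra.lsmul ℂ ℂ (LinearMap.ker f) (idem R k))
  let h : EK →ₗ[ℂ] M := (LinearMap.ker f).subtype.restrictScalars ℂ ∘ₗ EK.subtype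
  let h' : LinearMap.ker g →ₗ[ℂ] M := EM.subtype ∘ₗ (LinearMap.ker g).subtype
  have hh : Function.Injective h := fun x y hxy => Subtype.ext (Subtype.ext hxy)
  have hh' : Function.Injective h' := fun x y hxy => Subtype.ext (Subtype.ext hxy)
  rw [← LinearMap.finrank_range_of_inj hh, ← LinearMap.finrank_range_of_inj hh']
  -- Inside M, the kernel of the restricted map is ε_k (ker f), because ε_k acts as the identity on
  -- ε_k M.
  suffices e : LinearMap.range h' = LinearMap.range h by rw [e]
  ext x
  constructor
  · rintro ⟨⟨⟨_, m, rfl⟩, hm⟩, rfl⟩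
    have hm0 : f (idem R k • m) = 0 := congrArg Subtype.val hm
    refine ⟨⟨idem R k • ⟨idem R k • m, hm0⟩, ⟨⟨idem R k • m, hm0⟩, rfl⟩⟩, ?_⟩
    change idem R k • idem R k • m = idem R k • m
    rw [smul_smul, idem_mul_self]
  · rintro ⟨⟨_, m, rfl⟩, rfl⟩
    exact ⟨⟨⟨idem R k • m.1, m.1, rfl⟩, Subtype.ext (by
      change f (idem R k • m.1) = 0
      rw [map_smul, LinearMap.mem_ker.1 m.2, smul_zero])⟩, rfl⟩

theorem vtxDim_eq_zero_of_subsingleton [Subsingleton M] (k : V) : vtxDim R M k = 0 := by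
  letI := Module.restrictScalars ℂ (Alg R) M
  haveI := IsScalarTower.restrictScalars ℂ (Alg R) M
  rw [← dimVec_eq_vtxDim]
  exact Module.finrank_zero_of_subsingleton

theorem vtxDim_prod [Module.Finite ℂ (Alg R)] [Module.Finite (Alg R) M] [Module.Finite (Alg R) N]
    (k : V) : vtxDim R (M × N) k = vtxDim R M k + vtxDim R N k := by
  rw [vtxDim_of_surjective (LinearMap.snd (Alg R) M N) LinearMap.snd_surjective,
    ← vtxDim_congr (M := M) (N := LinearMap.ker (LinearMap.snd (Alg R) M N))
      ((LinearEquiv.ofInjective (LinearMap.inl (Alg R) M N)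
      LinearMap.inl_injective).trans (LinearEquiv.ofEq _ _ (LinearMap.range_inl _ _ _)))]

theorem vtxDim_of_exact [Module.Finite ℂ (Alg R)] [Module.Finite (Alg R) N]
    {f : M →ₗ[Alg R] N} {g : N →ₗ[Alg R] P} (h : Function.Exact f g) (k : V) :
    vtxDim R N k = vtxDim R (LinearMap.range f) k + vtxDim R (LinearMap.range g) k := by
  rw [← vtxDim_congr (N := LinearMap.range g) g.quotKerEquivRange,
    vtxDim_of_surjective (N := N ⧸ LinearMap.ker g) (LinearMap.ker g).mkQ
      (Submodule.mkQ_surjective _), Submodule.ker_mkQ, h.linearMap_ker_eq]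

theorem vtxDim_pi [Module.Finite ℂ (Alg R)] {ι : Type} [Fintype ι] (M : ι → Type)
    [∀ i, AddCommGroup (M i)] [∀ i, Module (Alg R) (M i)] [∀ i, Module.Finite (Alg R) (M i)]
    (k : V) : vtxDim R (∀ i, M i) k = ∑ i, vtxDim R (M i) k := by
  letI := fun i => Module.restrictScalars ℂ (Alg R) (M i)
  haveI := fun i => IsScalarTower.restrictScalars ℂ (Alg R) (M i)
  haveI : ∀ i, Module.Finite ℂ (M i) := fun i => Module.Finite.trans (Alg R) (M i)
  simp_rw [← dimVec_eq_vtxDim, dimVec]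
  rw [← Module.finrank_pi_fintype ℂ]
  refine LinearEquiv.finrank_eq (LinearEquiv.ofBijective
    (LinearMap.pi fun i => LinearMap.codRestrict (LinearMap.range (Algebra.lsmul ℂ ℂ (M i)
      (idem R k))) (LinearMap.proj i ∘ₗ Submodule.subtype _) ?_) ⟨?_, ?_⟩)
  · rintro ⟨_, m, rfl⟩
    exact ⟨m i, rfl⟩
  · intro x y hxy
    exact Subtype.ext (funext fun i => congrArg Subtype.val (congrFun hxy i))
  · intro y
    choose m hm using fun i => (y i).2
    exact ⟨⟨idem R k • m, m, rfl⟩, funext fun i => Subtype.ext (hm i)⟩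

end VertexDimension

/-! ### Finitely generated projectives and the Cartan matrix -/

section ProjectiveModules

variable {V : Type} [Quiver.{0} V] [Fintype V] [DecidableEq V] {R : Relations V}
variable {M : Type} [AddCommGroup M] [Module (Alg R) M]

theorem mul_idem_of_mem {j : V} {a : Alg R} (ha : a ∈ (Ideal.span {idem R j} : Ideal (Alg R))) :
    a * idem R j = a := by
  obtain ⟨b, rfl⟩ := Ideal.mem_span_singleton'.1 ha
  rw [mul_assoc, idem_mul_self]

/-- The generator of the projective module `P_j`. -/
noncomputable def projGen (R : Relations V) (j : V) : Proj R j :=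
  ⟨idem R j, Ideal.mem_span_singleton_self _⟩

theorem smul_projGen {j : V} (v : Proj R j) : v.1 • projGen R j = v :=
  Subtype.ext (mul_idem_of_mem v.2)

instance (j : V) : Module.Finite (Alg R) (Proj R j) :=
  Module.Finite.of_surjective (LinearMap.toSpanSingleton (Alg R) (Proj R j) (projGen R j))
    fun v => ⟨v.1, smul_projGen v⟩

instance (j : V) : Module.Projective (Alg R) (Proj R j) :=
  Module.Projective.of_split (Submodule.subtype _)
    (LinearMap.toSpanSingleton (Alg R) (Proj R j) (projGen R j))
    (LinearMap.ext fun v => smul_projGen v)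

theorem projective_pi {A ι : Type} [Ring A] [Finite ι] (M : ι → Type) [∀ i, AddCommGroup (M i)]
    [∀ i, Module A (M i)] [∀ i, Module.Projective A (M i)] : Module.Projective A (∀ i, M i) := by
  classical
  have := Fintype.ofFinite ι
  exact Module.Projective.of_equiv (DirectSum.linearEquivFunOnFintype A ι M)

instance (e : V → ℕ) : Module.Projective (Alg R) (ProjSum R e) :=
  haveI (j : V) : Module.Projective (Alg R) (Fin (e j) → Proj R j) :=
    projective_pi (A := Alg R) fun _ => Proj R j
  projective_pi (A := Alg R) fun j => Fin (e j) → Proj R j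

/-- The map from `⨁ P_j` that sends the generators to given elements. -/
noncomputable def projSumLift {e : V → ℕ} (m : ∀ j, Fin (e j) → M) : ProjSum R e →ₗ[Alg R] M :=
  ∑ j, ∑ c, (LinearMap.toSpanSingleton (Alg R) M (m j c)) ∘ₗ (Submodule.subtype _) ∘ₗ
    (LinearMap.proj c : (Fin (e j) → Proj R j) →ₗ[Alg R] Proj R j) ∘ₗ LinearMap.proj j

theorem projSumLift_apply {e : V → ℕ} (m : ∀ j, Fin (e j) → M) (v : ProjSum R e) :
    projSumLift m v = ∑ j, ∑ c, (v j c).1 • m j c := by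
  simp [projSumLift]

theorem projSum_eq_sum {e : V → ℕ} (v : ProjSum R e) :
    v = ∑ j, ∑ c, (v j c).1 • (Pi.single j (Pi.single c (projGen R j)) : ProjSum R e) := by
  funext j c
  rw [Finset.sum_apply, Finset.sum_apply, Finset.sum_eq_single j, Finset.sum_apply,
    Finset.sum_apply, Finset.sum_eq_single c]
  · simp [smul_projGen]
  · intro c' _ h
    simp [h.symm]
  · simp
  · intro j' _ h
    rw [Finset.sum_apply, Finset.sum_apply]
    exact Finset.sum_eq_zero fun c' _ => by simp [Pi.single_eq_of_ne h.symm]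
  · simp

/-- Finitely generated projective modules are direct sums of the modules `P_j`. -/
theorem exists_equiv_projSum [Module.Finite ℂ (Alg R)] (hR : R.Admissible)
    (M : Type) [AddCommGroup M] [Module (Alg R) M]
    [Module.Finite (Alg R) M] [Module.Projective (Alg R) M] :
    ∃ e : V → ℕ, Nonempty (M ≃ₗ[Alg R] ProjSum R e) := by
  -- `Q` is the top of M. A basis of each ε_j Q, lifted into ε_j M, defines a projective cover `f`
  -- by a sum of modules P_j, with the dimension of ε_j Q as multiplicity.
  let Q := M ⧸ radLayer R M 1
  let π : M →ₗ[Alg R] Q := (radLayer R M 1).mkQ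
  have hπ : Function.Surjective π := (radLayer R M 1).mkQ_surjective
  have hπ0 : ∀ a ∈ pathFil R 1, ∀ m, a • π m = 0 := fun a ha m => by
    rw [← map_smul]
    exact (Submodule.Quotient.mk_eq_zero _).2 (smul_mem_radLayer ha m)
  letI : Module ℂ Q := Module.restrictScalars ℂ (Alg R) Q
  haveI : IsScalarTower ℂ (Alg R) Q := IsScalarTower.restrictScalars ℂ (Alg R) Q
  haveI : Module.Finite ℂ Q := Module.Finite.trans (Alg R) Q
  let E : V → Submodule ℂ Q := fun j => LinearMap.range (Algebra.lsmul ℂ ℂ Q (idem R j))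
  have hE : ∀ j, ∀ x ∈ E j, idem R j • x = x := by
    rintro j _ ⟨x, rfl⟩
    change idem R j • idem R j • x = idem R j • x
    rw [smul_smul, idem_mul_self]
  let e : V → ℕ := fun j => Module.finrank ℂ (E j)
  let b : ∀ j, Module.Basis (Fin (e j)) ℂ (E j) := fun j => Module.finBasis ℂ (E j)
  have hm : ∀ j c, ∃ m : M, idem R j • m = m ∧ π m = (b j c : Q) := by
    intro j c
    obtain ⟨m, hm⟩ := hπ (b j c : Q)
    refine ⟨idem R j • m, by rw [smul_smul, idem_mul_self], ?_⟩
    rw [map_smul, hm, hE j _ (b j c).2]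
  choose m hm1 hm2 using hm
  let f : ProjSum R e →ₗ[Alg R] M := projSumLift m
  have hfm : ∀ j c, m j c ∈ LinearMap.range f := fun j c =>
    ⟨Pi.single j (Pi.single c (projGen R j)), by
      rw [projSumLift_apply, Finset.sum_eq_single j, Finset.sum_eq_single c]
      · simp [projGen, hm1]
      · intro c' _ h
        simp [h]
      · simp
      · intro j' _ h
        exact Finset.sum_eq_zero fun c' _ => by simp [Pi.single_eq_of_ne h]
      · simp⟩
  have hf : Function.Surjective f := by
    rw [← LinearMap.range_eq_top]
    refine eq_top_of_sup_radLayer hR (eq_top_iff.2 fun x _ => ?_)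
    have hx : π x ∈ (LinearMap.range f).map π := by
      rw [← one_smul (Alg R) (π x), ← sum_idem, Finset.sum_smul]
      refine Submodule.sum_mem _ fun j _ => ?_
      have h := congrArg Subtype.val ((b j).sum_repr ⟨idem R j • π x, π x, rfl⟩)
      rw [AddSubmonoidClass.coe_finsetSum] at h
      change _ = idem R j • π x at h
      rw [← h]
      refine Submodule.sum_mem _ fun c _ => ?_
      change ((b j).repr _ c) • (b j c : Q) ∈ _
      rw [← algebraMap_smul (Alg R), ← hm2]
      exact Submodule.smul_mem _ _ (Submodule.mem_map_of_mem (hfm j c))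
    obtain ⟨y, hy, hxy⟩ := hx
    rw [← add_sub_cancel y x]
    refine Submodule.add_mem_sup hy ?_
    rw [← Submodule.Quotient.mk_eq_zero]
    change π (x - y) = 0
    rw [map_sub, hxy, sub_self]
  -- The scalar part of a kernel element would be a linear relation between the basis vectors of the
  -- top.
  have hker : LinearMap.ker f ≤ radLayer R (ProjSum R e) 1 := by
    intro v hv
    choose l hl using fun (j : V) (c : Fin (e j)) => exists_sub_mem_pathFil_one R (v j c).1
    have hact : ∀ j c, (v j c).1 • (b j c : Q) = l j c j • (b j c : Q) := by
      intro j c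
      have h0 := hπ0 _ (hl j c) (m j c)
      rw [hm2, sub_smul, sub_eq_zero] at h0
      rw [h0, Finset.sum_smul, Finset.sum_eq_single j]
      · rw [smul_assoc, hE j _ (b j c).2]
      · intro k _ hk
        rw [smul_assoc, ← hE j _ (b j c).2, smul_smul, idem_mul_of_ne R hk, zero_smul, smul_zero]
      · simp
    have hsum : ∑ j, ∑ c, l j c j • (b j c : Q) = 0 := by
      have h0 := congrArg π (LinearMap.mem_ker.1 hv)
      rw [projSumLift_apply, map_zero] at h0
      simpa only [map_sum, map_smul, hm2, hact] using h0
    have hzero : ∀ j c, l j c j = 0 := by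
      intro j
      have h0 := congrArg (fun q => idem R j • q) hsum
      simp only [Finset.smul_sum, smul_zero] at h0
      rw [Finset.sum_eq_single j] at h0
      · refine Fintype.linearIndependent_iff.1 (b j).linearIndependent (fun c => l j c j) ?_
        refine Subtype.ext ?_
        rw [AddSubmonoidClass.coe_finsetSum]
        refine (Finset.sum_congr rfl fun c _ => ?_).trans h0
        rw [smul_comm, hE j _ (b j c).2]
        rfl
      · intro k _ hk
        refine Finset.sum_eq_zero fun c _ => ?_
        rw [smul_comm, ← hE k _ (b k c).2, smul_smul, idem_mul_of_ne R hk.symm, zero_smul,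
          smul_zero]
      · simp
    rw [projSum_eq_sum v]
    refine Submodule.sum_mem _ fun j _ => Submodule.sum_mem _ fun c _ => ?_
    -- The entry lies in A ε_j, so right multiplication by ε_j keeps only the coefficient of ε_j,
    -- which is zero by `hzero`.
    have h1 : (v j c).1 = ((v j c).1 - ∑ k, l j c k • idem R k) * idem R j := by
      rw [sub_mul, mul_idem_of_mem (v j c).2, Finset.sum_mul, Finset.sum_eq_single j]
      · rw [hzero, zero_smul, zero_mul, sub_zero]
      · intro k _ hk
        rw [smul_mul_assoc, idem_mul_of_ne R hk, smul_zero]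
      · simp
    rw [h1, mul_smul]
    exact smul_mem_radLayer (hl j c) _
  -- The kernel of `f` lies in the radical layer, so Nakayama applies again and makes the section
  -- surjective.
  obtain ⟨s, hs⟩ := Module.projective_lifting_property f (LinearMap.id : M →ₗ[Alg R] M) hf
  have hs' : ∀ x, f (s x) = x := LinearMap.congr_fun hs
  have hsur : Function.Surjective s := by
    rw [← LinearMap.range_eq_top]
    refine eq_top_of_sup_radLayer (M := ProjSum R e) hR (eq_top_iff.2 fun x _ => ?_)
    rw [← add_sub_cancel (s (f x)) x]
    refine Submodule.add_mem_sup ⟨_, rfl⟩ (hker ?_)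
    rw [LinearMap.mem_ker, map_sub, hs', sub_self]
  exact ⟨e, ⟨LinearEquiv.ofBijective s ⟨fun x y h => by rw [← hs' x, h, hs'], hsur⟩⟩⟩

theorem vtxDim_projSum [Module.Finite ℂ (Alg R)] (e : V → ℕ) (k : V) :
    vtxDim R (ProjSum R e) k = ∑ j, e j * vtxDim R (Proj R j) k := by
  rw [vtxDim_pi fun j => Fin (e j) → Proj R j]
  refine Finset.sum_congr rfl fun j _ => ?_
  rw [vtxDim_pi fun _ => Proj R j]
  simp

section

variable {W : V → Type} [∀ j, AddCommGroup (W j)] [∀ j, Module ℂ (W j)]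

/-- The component of an element of a representation at a vertex. -/
def RepMod.comp {x : QRep W} {hx : Satisfies R x} (v : RepMod R x hx) (j : V) : W j :=
  (show ∀ j, W j from v) j

/-- The element of a representation with given components. -/
def RepMod.of {x : QRep W} (hx : Satisfies R x) (v : ∀ j, W j) : RepMod R x hx := v

theorem RepMod.comp_of {x : QRep W} (hx : Satisfies R x) (v : ∀ j, W j) (j : V) :
    (RepMod.of hx v).comp j = v j := rfl

theorem RepMod.ext {x : QRep W} {hx : Satisfies R x} {v w : RepMod R x hx}
    (h : ∀ j, v.comp j = w.comp j) : v = w := funext h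

theorem idem_smul_repMod {x : QRep W} (hx : Satisfies R x) (k : V) (v : RepMod R x hx) :
    idem R k • v = RepMod.of hx (Pi.single k (v.comp k)) := by
  change actHom R x hx (toAlg R (vtx k)) v = _
  rw [actHom, RingQuot.liftAlgHom_mkAlgHom_apply]
  simp only [vtx, FreeAlgebra.lift_ι_apply, genAct]
  rfl

theorem vtxDim_repMod {x : QRep W} (hx : Satisfies R x) (k : V) :
    vtxDim R (RepMod R x hx) k = Module.finrank ℂ (W k) := by
  rw [← dimVec_eq_vtxDim, dimVec]
  have hinj : Function.Injective (LinearMap.single ℂ W k) := Pi.single_injective k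
  rw [← LinearMap.finrank_range_of_inj hinj]
  suffices h : LinearMap.range (Algebra.lsmul ℂ ℂ (RepMod R x hx) (idem R k)) =
    LinearMap.range (LinearMap.single ℂ W k) by rw [h]; rfl
  ext v
  constructor
  · rintro ⟨w, rfl⟩
    exact ⟨RepMod.comp w k, (idem_smul_repMod hx k w).symm⟩
  · rintro ⟨w, rfl⟩
    refine ⟨RepMod.of hx (Pi.single k w), (idem_smul_repMod hx k _).trans ?_⟩
    exact congrArg (Pi.single k) (Pi.single_eq_same k w)

theorem satisfies_zero (R : Relations V) : Satisfies R (0 : QRep W) := by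
  intro j k r hr
  refine Finset.sum_eq_zero fun p hp => ?_
  have h2 := R.two_le_length j k r hr p hp
  cases p with
  | nil => simp at h2
  | cons p a => simp [evalPath]

end

/-- Induction along a resolution: a finite free cover writes the dimension vector as that of a
projective minus that of the syzygy, for which the bound on the projective dimension drops by one.
-/
theorem exists_vtxDim_eq_of_hasProjectiveDimensionLT [Module.Finite ℂ (Alg R)]
    (hR : R.Admissible) (n : ℕ) (M : ModuleCat.{0} (Alg R)) [Module.Finite (Alg R) M]
    (hM : HasProjectiveDimensionLT M (n + 1)) :
    ∃ z : V → ℤ, ∀ k, (vtxDim R M k : ℤ) = ∑ j, z j * vtxDim R (Proj R j) k := by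
  haveI : IsNoetherianRing (Alg R) := isNoetherian_of_tower ℂ inferInstance
  induction n generalizing M with
  | zero =>
    have h1 : Projective M := projective_iff_hasProjectiveDimensionLT_one.2 hM
    have h2 : Module.Projective (Alg R) M := (IsProjective.iff_projective (R := Alg R) M).2 h1
    obtain ⟨e, ⟨φ⟩⟩ := exists_equiv_projSum hR M
    refine ⟨fun j => e j, fun k => ?_⟩
    rw [vtxDim_congr (N := ProjSum R e) φ, vtxDim_projSum]
    push_cast
    rfl
  | succ n ih =>
    obtain ⟨m, f, hf⟩ := Module.Finite.exists_fin' (Alg R) M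
    have hses := LinearMap.shortExact_shortComplexKer hf
    have hP : HasProjectiveDimensionLT (ModuleCat.of (Alg R) (Fin m → Alg R)) (n + 1) := by
      haveI : Projective (ModuleCat.of (Alg R) (Fin m → Alg R)) :=
        (IsProjective.iff_projective (R := Alg R) (Fin m → Alg R)).1 inferInstance
      exact hasProjectiveDimensionLT_of_ge _ 1 (n + 1) (by omega)
    have hK : HasProjectiveDimensionLT (ModuleCat.of (Alg R) (LinearMap.ker f)) (n + 1) :=
      hses.hasProjectiveDimensionLT_X₁ (n + 1) hP hM
    haveI : Module.Finite (Alg R) (ModuleCat.of (Alg R) (LinearMap.ker f)) :=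
      inferInstanceAs (Module.Finite (Alg R) (LinearMap.ker f))
    obtain ⟨z, hz⟩ := ih _ hK
    obtain ⟨e, ⟨φ⟩⟩ := exists_equiv_projSum hR (Fin m → Alg R)
    refine ⟨fun j => e j - z j, fun k => ?_⟩
    have h1 := vtxDim_of_surjective f hf k
    rw [vtxDim_congr (N := ProjSum R e) φ, vtxDim_projSum] at h1
    have h2 := hz k
    change (vtxDim R (LinearMap.ker f) k : ℤ) = _ at h2
    simp only [sub_mul, Finset.sum_sub_distrib, ← h2]
    have h3 := congrArg (Nat.cast : ℕ → ℤ) h1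
    push_cast at h3
    rw [h3]
    ring

/-- Over an algebra of finite global dimension the dimension vectors of the modules `P_j` are
linearly independent. -/
theorem cartan_injective [Module.Finite ℂ (Alg R)] (hR : R.Admissible)
    (hgl : FiniteGlobalDimension (Alg R)) {z : V → ℤ}
    (hz : ∀ k, ∑ j, z j * (vtxDim R (Proj R j) k : ℤ) = 0) : z = 0 := by
  let L : (V → ℤ) →ₗ[ℤ] (V → ℤ) :=
    LinearMap.pi fun k => ∑ j, (vtxDim R (Proj R j) k : ℤ) • LinearMap.proj j
  have hL : ∀ z k, L z k = ∑ j, z j * (vtxDim R (Proj R j) k : ℤ) := fun z k => by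
    simp [L, mul_comm]
  -- The unit vector at `j` is the dimension vector of the simple module at `j`, realised with zero
  -- arrows. Finite projective dimension makes it an integral combination of the columns of the
  -- Cartan matrix.
  have hsur : Function.Surjective L := by
    rw [← LinearMap.range_eq_top, eq_top_iff, ← (Pi.basisFun ℤ V).span_eq, Submodule.span_le]
    rintro _ ⟨j, rfl⟩
    obtain ⟨n, hn⟩ := hgl
    let d : V → ℕ := Pi.single j 1
    have hs : Satisfies R (0 : QRep fun k => Sp (d k)) := satisfies_zero R
    let S := RepMod R (0 : QRep fun k => Sp (d k)) hs
    haveI : Module.Finite ℂ S := inferInstanceAs (Module.Finite ℂ (∀ k, Sp (d k)))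
    haveI : Module.Finite (Alg R) (ModuleCat.of (Alg R) S) :=
      (Module.Finite.of_restrictScalars_finite ℂ (Alg R) S :)
    obtain ⟨z, hz⟩ := exists_vtxDim_eq_of_hasProjectiveDimensionLT hR n (ModuleCat.of (Alg R) S)
      (hn (ModuleCat.of (Alg R) S))
    refine ⟨z, funext fun k => ?_⟩
    rw [hL, ← hz k]
    change (vtxDim R S k : ℤ) = _
    rw [vtxDim_repMod hs]
    rw [Module.finrank_fin_fun, Pi.basisFun_apply]
    rcases eq_or_ne k j with rfl | h
    · simp [d]
    · simp [d, h]
  have hinj : Function.Injective L := IsNoetherian.injective_of_surjective_endomorphism L hsur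
  refine hinj (funext fun k => ?_)
  rw [hL, hz, map_zero]
  rfl

theorem eq_of_vtxDim_projSum_eq [Module.Finite ℂ (Alg R)] (hR : R.Admissible)
    (hgl : FiniteGlobalDimension (Alg R)) {e f : V → ℕ}
    (h : ∀ k, vtxDim R (ProjSum R e) k = vtxDim R (ProjSum R f) k) : e = f := by
  have : (fun j => (e j : ℤ) - f j) = 0 := cartan_injective hR hgl fun k => by
    have h1 := congrArg (Nat.cast : ℕ → ℤ) (h k)
    rw [vtxDim_projSum, vtxDim_projSum] at h1
    push_cast at h1
    simp only [sub_mul, Finset.sum_sub_distrib, h1, sub_self]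
  funext j
  have := congrFun this j
  simp only [Pi.zero_apply] at this
  omega

/-- Finitely generated projective modules with the same dimension vectors are isomorphic. -/
theorem nonempty_equiv_of_vtxDim_eq [Module.Finite ℂ (Alg R)] (hR : R.Admissible)
    (hgl : FiniteGlobalDimension (Alg R)) (M N : Type) [AddCommGroup M] [Module (Alg R) M]
    [AddCommGroup N] [Module (Alg R) N] [Module.Finite (Alg R) M] [Module.Projective (Alg R) M]
    [Module.Finite (Alg R) N] [Module.Projective (Alg R) N]
    (h : ∀ k, vtxDim R M k = vtxDim R N k) : Nonempty (M ≃ₗ[Alg R] N) := by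
  obtain ⟨e, ⟨φ⟩⟩ := exists_equiv_projSum hR M
  obtain ⟨f, ⟨ψ⟩⟩ := exists_equiv_projSum hR N
  obtain rfl : e = f := eq_of_vtxDim_projSum_eq hR hgl fun k => by
    rw [← vtxDim_congr (N := ProjSum R e) φ, ← vtxDim_congr (N := ProjSum R f) ψ, h]
  exact ⟨φ.trans ψ.symm⟩

end ProjectiveModules

/-! ### Elementary complexes: splitting, cones and cancellation -/

/-- Complexes of modules, given by their terms and differentials. -/
structure LinCplx (A : Type) [Ring A] where
  X : ℤ → Type
  [acg : ∀ i, AddCommGroup (X i)]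
  [mod : ∀ i, Module A (X i)]
  d : ∀ i, X i →ₗ[A] X (i + 1)
  d_d : ∀ (i : ℤ) (x : X i), d (i + 1) (d i x) = 0

/-- A family indexed by all integers from its members with indices written as successors. -/
def ofSucc {F : ℤ → Type} (g : ∀ i, F (i + 1)) (j : ℤ) : F j := (Int.sub_add_cancel j 1) ▸ g (j - 1)

/-- Maps built with a differential live naturally in degrees `i + 1`; this removes the transport
hidden in `ofSucc` there. -/
theorem ofSucc_succ {F : ℤ → Type} (g : ∀ i, F (i + 1)) (i : ℤ) : ofSucc g (i + 1) = g i := by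
  have key : ∀ (m : ℤ) (h : m + 1 = i + 1), (h ▸ g m : F (i + 1)) = g i := by
    intro m h
    obtain rfl : m = i := by omega
    rfl
  exact key _ _

theorem forall_of_succ {P : ℤ → Prop} (h : ∀ i, P (i + 1)) (j : ℤ) : P j := by
  have := h (j - 1)
  rwa [Int.sub_add_cancel] at this

namespace LinCplx

attribute [instance] acg mod

section General

variable {A : Type} [Ring A]

/-- Chain maps. -/
structure Hom (X Y : LinCplx A) where
  f : ∀ i, X.X i →ₗ[A] Y.X i
  comm : ∀ (i : ℤ) (x : X.X i), f (i + 1) (X.d i x) = Y.d i (f i x)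

/-- Isomorphisms of complexes. -/
structure Iso (X Y : LinCplx A) where
  e : ∀ i, X.X i ≃ₗ[A] Y.X i
  comm : ∀ (i : ℤ) (x : X.X i), e (i + 1) (X.d i x) = Y.d i (e i x)

/-- The inverse of an isomorphism of complexes. -/
def Iso.symm {X Y : LinCplx A} (φ : Iso X Y) : Iso Y X where
  e i := (φ.e i).symm
  comm i y := by
    rw [LinearEquiv.symm_apply_eq, φ.comm, LinearEquiv.apply_symm_apply]

/-- The composition of isomorphisms of complexes. -/
def Iso.trans {X Y Z : LinCplx A} (φ : Iso X Y) (ψ : Iso Y Z) : Iso X Z where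
  e i := (φ.e i).trans (ψ.e i)
  comm i x := by simp [φ.comm, ψ.comm]

/-- The direct sum of two complexes. -/
def prod (X Y : LinCplx A) : LinCplx A where
  X i := X.X i × Y.X i
  d i := (X.d i).prodMap (Y.d i)
  d_d i x := by simp [X.d_d, Y.d_d]

/-- The direct sum of isomorphisms. -/
def Iso.prodCongr {X X' Y Y' : LinCplx A} (φ : Iso X X') (ψ : Iso Y Y') :
    Iso (X.prod Y) (X'.prod Y') where
  e i := (φ.e i).prodCongr (ψ.e i)
  comm i x := Prod.ext (φ.comm i x.1) (ψ.comm i x.2)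

/-- The identity isomorphism. -/
def Iso.refl (X : LinCplx A) : Iso X X where
  e _ := LinearEquiv.refl A _
  comm _ _ := rfl

/-- Exactness in all degrees. -/
def Exact (X : LinCplx A) : Prop :=
  ∀ (i : ℤ) (x : X.X (i + 1)), X.d (i + 1) x = 0 → ∃ y, X.d i y = x

/-- Chain maps that induce isomorphisms in homology. -/
structure IsQis {X Y : LinCplx A} (f : Hom X Y) : Prop where
  inj : ∀ (i : ℤ) (z : X.X (i + 1)), X.d (i + 1) z = 0 → ∀ y, f.f (i + 1) z = Y.d i y →
    ∃ x, X.d i x = z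
  surj : ∀ (i : ℤ) (y : Y.X (i + 1)), Y.d (i + 1) y = 0 →
    ∃ x, X.d (i + 1) x = 0 ∧ ∃ y', f.f (i + 1) x - y = Y.d i y'

/-- The identity chain map. -/
def Hom.id (X : LinCplx A) : Hom X X where
  f _ := LinearMap.id
  comm _ _ := rfl

theorem IsQis.id (X : LinCplx A) : IsQis (Hom.id X) where
  inj i z _ y h := ⟨y, h.symm⟩
  surj i y hy := ⟨y, hy, 0, by simp [Hom.id]⟩

/-- A chain map extended by zero to direct sums. -/
def Hom.extend {X Y : LinCplx A} (f : Hom X Y) (C C' : LinCplx A) :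
    Hom (X.prod C) (Y.prod C') where
  f i := LinearMap.inl A _ _ ∘ₗ f.f i ∘ₗ LinearMap.fst A _ _
  comm i x := Prod.ext (f.comm i x.1) (map_zero (C'.d i)).symm

theorem Hom.extend_apply {X Y : LinCplx A} (f : Hom X Y) (C C' : LinCplx A) (i : ℤ) (x : X.X i)
    (c : C.X i) : (f.extend C C').f i (x, c) = (f.f i x, 0) := rfl

theorem prod_d_apply (X Y : LinCplx A) (i : ℤ) (x : X.X i) (y : Y.X i) :
    (X.prod Y).d i (x, y) = (X.d i x, Y.d i y) := rfl

/-- Acyclic summands have no homology, so the zero map between them does no harm. This brings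
complexes of different sizes to a common level. -/
theorem IsQis.extend {X Y : LinCplx A} {f : Hom X Y} (hf : IsQis f) {C C' : LinCplx A}
    (hC : C.Exact) (hC' : C'.Exact) : IsQis (f.extend C C') where
  inj i := by
    rintro ⟨z, c⟩ hz ⟨y, c'⟩ h
    rw [prod_d_apply, Hom.extend_apply] at h
    rw [prod_d_apply] at hz
    obtain ⟨x, hx⟩ := hf.inj i z (congrArg Prod.fst hz) y (congrArg Prod.fst h)
    obtain ⟨c, hc⟩ := hC i c (congrArg Prod.snd hz)
    exact ⟨(x, c), Prod.ext hx hc⟩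
  surj i := by
    rintro ⟨y, c⟩ hy
    rw [prod_d_apply] at hy
    obtain ⟨x, hx, y', hy'⟩ := hf.surj i y (congrArg Prod.fst hy)
    obtain ⟨c', hc⟩ := hC' i c (congrArg Prod.snd hy)
    refine ⟨(x, 0), Prod.ext hx (map_zero (C.d (i + 1))), (y', -c'), ?_⟩
    rw [prod_d_apply, Hom.extend_apply]
    refine Prod.ext hy' ?_
    change (0 : C'.X (i + 1)) - c = C'.d i (-c')
    rw [map_neg, hc, zero_sub]

/-- The mapping cone. -/
def cone {X Y : LinCplx A} (f : Hom X Y) : LinCplx A where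
  X i := X.X (i + 1) × Y.X i
  d i := (-(X.d (i + 1)) ∘ₗ LinearMap.fst A _ _).prod
    (Y.d i ∘ₗ LinearMap.snd A _ _ + f.f (i + 1) ∘ₗ LinearMap.fst A _ _)
  d_d i x := by
    refine Prod.ext ?_ ?_
    · simp [X.d_d]
    · simp [Y.d_d, f.comm]

theorem cone_d_apply {X Y : LinCplx A} (f : Hom X Y) (i : ℤ) (x : X.X (i + 1)) (y : Y.X i) :
    (cone f).d i (x, y) = (-(X.d (i + 1) x), Y.d i y + f.f (i + 1) x) := rfl

/-- For a cycle (x', y) of the cone, f x' is a boundary, so injectivity on homology gives x' = d x0.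
Then y + f x0 is a cycle, and surjectivity writes it as f x1 minus a boundary with x1 a cycle. -/
theorem IsQis.cone_exact {X Y : LinCplx A} {f : Hom X Y} (hf : IsQis f) : (cone f).Exact := by
  rintro i ⟨x', y⟩ h
  rw [cone_d_apply] at h
  have h1 : X.d (i + 1 + 1) x' = 0 := neg_eq_zero.1 (congrArg Prod.fst h)
  have h2 : Y.d (i + 1) y + f.f (i + 1 + 1) x' = 0 := congrArg Prod.snd h
  obtain ⟨x0, rfl⟩ := hf.inj (i + 1) x' h1 (-y) 
    (by rw [map_neg]; exact eq_neg_of_add_eq_zero_right h2)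
  obtain ⟨x1, hx1, y0, hy0⟩ := hf.surj i (y + f.f (i + 1) x0) (by rw [map_add, ← f.comm, h2])
  refine ⟨(x1 - x0, -y0), ?_⟩
  rw [cone_d_apply]
  refine Prod.ext ?_ ?_
  · simp [hx1]
  · simp only [map_neg, ← hy0, map_sub]
    abel

/-- Only finitely many terms are non-zero. -/
def Bounded (X : LinCplx A) : Prop := ∃ n : ℕ, ∀ i : ℤ, n < |i| → Subsingleton (X.X i)

/-- The differential as a map onto the cycles. -/
def toCycles (X : LinCplx A) (i : ℤ) : X.X i →ₗ[A] LinearMap.ker (X.d (i + 1)) :=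
  (X.d i).codRestrict _ (X.d_d i)

theorem ker_toCycles (X : LinCplx A) (i : ℤ) :
    LinearMap.ker (X.toCycles i) = LinearMap.ker (X.d i) := LinearMap.ker_codRestrict _ _ _

theorem Exact.toCycles_surjective {X : LinCplx A} (h : X.Exact) (i : ℤ) :
    Function.Surjective (X.toCycles i) := fun z => by
  obtain ⟨y, hy⟩ := h i z.1 z.2
  exact ⟨y, Subtype.ext hy⟩

/-- Descending induction from the degrees where the complex vanishes: if the cycles in degree i + 1
are projective, the surjection of X^i onto them splits, and the cycles in degree i are a retract of
X^i. -/
theorem Exact.projective_cycles {X : LinCplx A} (h : X.Exact) (hb : X.Bounded)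
    (hp : ∀ i, Module.Projective A (X.X i)) (i : ℤ) :
    Module.Projective A (LinearMap.ker (X.d i)) := by
  obtain ⟨n, hn⟩ := hb
  have big : ∀ i : ℤ, n < i → Module.Projective A (LinearMap.ker (X.d i)) := by
    intro i hi
    have := hn i (hi.trans_le (le_abs_self i))
    infer_instance
  have step : ∀ i : ℤ, Module.Projective A (LinearMap.ker (X.d (i + 1))) →
      Module.Projective A (LinearMap.ker (X.d i)) := by
    intro i hi
    obtain ⟨s, hs⟩ := Module.projective_lifting_property (X.toCycles i)
      (LinearMap.id : LinearMap.ker (X.d (i + 1)) →ₗ[A] _) (h.toCycles_surjective i)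
    let r : X.X i →ₗ[A] LinearMap.ker (X.d i) :=
      (LinearMap.id - s ∘ₗ X.toCycles i).codRestrict _ fun x => by
        have := congrArg Subtype.val (LinearMap.congr_fun hs (X.toCycles i x))
        change X.d i (x - s (X.toCycles i x)) = 0
        rw [map_sub, sub_eq_zero]
        exact this.symm
    refine Module.Projective.of_split (LinearMap.ker (X.d i)).subtype r (LinearMap.ext fun z => ?_)
    refine Subtype.ext ?_
    change z.1 - s (X.toCycles i z.1) = z.1
    have : X.toCycles i z.1 = 0 := Subtype.ext z.2
    rw [this, map_zero, sub_zero]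
  rcases lt_or_ge (n : ℤ) i with hi | hi
  · exact big i hi
  · refine Int.leInductionDown (motive := fun i _ =>
      Module.Projective A (LinearMap.ker (X.d i))) (m := (n : ℤ) + 1) (big _ (by omega)) ?_ i
      (by omega)
    intro j _ hj
    refine step _ ?_
    rwa [Int.sub_add_cancel]

theorem Exact.exists_sections {X : LinCplx A} (h : X.Exact) (hb : X.Bounded)
    (hp : ∀ i, Module.Projective A (X.X i)) :
    ∃ s : ∀ i, LinearMap.ker (X.d (i + 1)) →ₗ[A] X.X i, ∀ i z, X.d i (s i z) = z.1 := by
  have := h.projective_cycles hb hp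
  choose s hs using fun i => Module.projective_lifting_property (X.toCycles i)
      (LinearMap.id : LinearMap.ker (X.d (i + 1)) →ₗ[A] _) (h.toCycles_surjective i)
  exact ⟨s, fun i z => congrArg Subtype.val (LinearMap.congr_fun (hs i) z)⟩

/-- The projection to the cycles that belongs to sections of the differential. -/
def cyclesProj (X : LinCplx A) (s : ∀ i, LinearMap.ker (X.d (i + 1)) →ₗ[A] X.X i)
    (hs : ∀ i z, X.d i (s i z) = z.1) (i : ℤ) : X.X i →ₗ[A] LinearMap.ker (X.d i) :=
  (LinearMap.id - s i ∘ₗ X.toCycles i).codRestrict _ fun x => by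
    change X.d i (x - s i (X.toCycles i x)) = 0
    rw [map_sub, hs, sub_eq_zero]
    rfl

/-- The terms of a split exact complex as sums of cycles. -/
def splitEquiv (X : LinCplx A) (s : ∀ i, LinearMap.ker (X.d (i + 1)) →ₗ[A] X.X i)
    (hs : ∀ i z, X.d i (s i z) = z.1) (i : ℤ) :
    X.X i ≃ₗ[A] LinearMap.ker (X.d i) × LinearMap.ker (X.d (i + 1)) :=
  LinearEquiv.ofLinearMap ((X.cyclesProj s hs i).prod (X.toCycles i))
    ((LinearMap.ker (X.d i)).subtype.coprod (s i))
    (by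
      refine LinearMap.ext fun z => ?_
      have h2 : X.toCycles i (z.1.1 + s i z.2) = z.2 := Subtype.ext (by
        change X.d i (z.1.1 + s i z.2) = _
        rw [map_add, hs, LinearMap.mem_ker.1 z.1.2, zero_add])
      refine Prod.ext (Subtype.ext ?_) h2
      change z.1.1 + s i z.2 - s i (X.toCycles i (z.1.1 + s i z.2)) = z.1.1
      rw [h2, add_sub_cancel_right])
    (by
      refine LinearMap.ext fun x => ?_
      change x - s i (X.toCycles i x) + s i (X.toCycles i x) = x
      rw [sub_add_cancel])

/-- Split exact complexes with isomorphic cycles are isomorphic. -/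
def isoOfCycles {X Y : LinCplx A} {s : ∀ i, LinearMap.ker (X.d (i + 1)) →ₗ[A] X.X i}
    (hs : ∀ i z, X.d i (s i z) = z.1) {s' : ∀ i, LinearMap.ker (Y.d (i + 1)) →ₗ[A] Y.X i}
    (hs' : ∀ i z, Y.d i (s' i z) = z.1)
    (ψ : ∀ i, LinearMap.ker (X.d i) ≃ₗ[A] LinearMap.ker (Y.d i)) : Iso X Y where
  e i := (X.splitEquiv s hs i).trans (((ψ i).prodCongr (ψ (i + 1))).trans (Y.splitEquiv s' hs' i).symm)
  comm i x := by
    change (ψ (i + 1) (X.cyclesProj s hs (i + 1) (X.d i x))).1 +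
      s' (i + 1) (ψ (i + 1 + 1) (X.toCycles (i + 1) (X.d i x))) =
      Y.d i ((ψ i (X.cyclesProj s hs i x)).1 + s' i (ψ (i + 1) (X.toCycles i x)))
    have h0 : X.toCycles (i + 1) (X.d i x) = 0 := Subtype.ext (X.d_d i x)
    have h1 : X.cyclesProj s hs (i + 1) (X.d i x) = X.toCycles i x := Subtype.ext (by
      change X.d i x - s (i + 1) (X.toCycles (i + 1) (X.d i x)) = X.d i x
      rw [h0, map_zero, sub_zero])
    rw [h0, h1, map_zero, map_zero, add_zero, map_add, hs', LinearMap.mem_ker.1 (ψ i _).2, zero_add]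

/-- A degreewise split surjection onto a bounded acyclic complex of projectives has a section. -/
theorem Exact.exists_section {E K : LinCplx A} (h : K.Exact) (hb : K.Bounded)
    (hp : ∀ i, Module.Projective A (K.X i)) (π : Hom E K) (σ : ∀ i, K.X i →ₗ[A] E.X i)
    (hσ : ∀ i k, π.f i (σ i k) = k) : ∃ g : Hom K E, ∀ i k, π.f i (g.f i k) = k := by
  obtain ⟨s, hs⟩ := h.exists_sections hb hp
  -- K^{i+1} is the sum of its cycles and the image of `s`. Vectors s z' are lifted by `σ`, and a
  -- cycle z = d (s z) must then go to d (σ (s z)) for the lift to be a chain map.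
  let g : ∀ i, K.X (i + 1) →ₗ[A] E.X (i + 1) := fun i =>
    E.d i ∘ₗ σ i ∘ₗ s i ∘ₗ K.cyclesProj s hs (i + 1) +
      σ (i + 1) ∘ₗ s (i + 1) ∘ₗ K.toCycles (i + 1)
  have hg : ∀ i k, g i k = E.d i (σ i (s i (K.cyclesProj s hs (i + 1) k))) +
      σ (i + 1) (s (i + 1) (K.toCycles (i + 1) k)) := fun _ _ => rfl
  let G : ∀ i, K.X i →ₗ[A] E.X i := ofSucc (F := fun i => K.X i →ₗ[A] E.X i) g
  have hG : ∀ i, G (i + 1) = g i := ofSucc_succ (F := fun i => K.X i →ₗ[A] E.X i) g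
  refine ⟨⟨G, ?_⟩, ?_⟩
  · refine forall_of_succ fun i x => ?_
    have h0 : K.toCycles (i + 1 + 1) (K.d (i + 1) x) = 0 := Subtype.ext (K.d_d (i + 1) x)
    have h1 : K.cyclesProj s hs (i + 1 + 1) (K.d (i + 1) x) = K.toCycles (i + 1) x :=
      Subtype.ext (by
        change K.d (i + 1) x - s (i + 1 + 1) (K.toCycles (i + 1 + 1) (K.d (i + 1) x)) = _
        rw [h0, map_zero, sub_zero]
        rfl)
    rw [hG, hG, hg, hg, h0, h1, map_zero, map_zero, add_zero, map_add, E.d_d, zero_add]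
  · refine forall_of_succ fun i x => ?_
    change π.f (i + 1) (G (i + 1) x) = x
    rw [hG, hg, map_add, π.comm, hσ, hσ, hs]
    change x - s (i + 1) (K.toCycles (i + 1) x) + s (i + 1) (K.toCycles (i + 1) x) = x
    rw [sub_add_cancel]

/-- The inclusion of `X` into `Y ⊕ cone (id X)` has the cokernel `cone f`, which splits off. -/
theorem IsQis.nonempty_iso {X Y : LinCplx A} {f : Hom X Y} (hf : IsQis f)
    (hXb : X.Bounded) (hYb : Y.Bounded) (hX : ∀ i, Module.Projective A (X.X i))
    (hY : ∀ i, Module.Projective A (Y.X i)) :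
    Nonempty (Iso (X.prod (cone f)) (Y.prod (cone (Hom.id X)))) := by
  let E := Y.prod (cone (Hom.id X))
  -- On (y, (x', x)) this is (x', f x - y). Its kernel is the image of `ι`, which sends x to (f x,
  -- (0, x)), and `σ` splits it degree by degree without having to be a chain map.
  let π : Hom E (cone f) :=
    { f := fun i => (LinearMap.fst A _ _ ∘ₗ LinearMap.snd A _ _).prod
        (f.f i ∘ₗ LinearMap.snd A _ _ ∘ₗ LinearMap.snd A _ _ - LinearMap.fst A _ _)
      comm := fun i x => by
        refine Prod.ext rfl ?_
        change f.f (i + 1) (X.d i x.2.2 + x.2.1) - Y.d i x.1 =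
          Y.d i (f.f i x.2.2 - x.1) + f.f (i + 1) x.2.1
        rw [map_add, map_sub, f.comm]
        abel }
  let ι : Hom X E :=
    { f := fun i => (f.f i).prod ((0 : X.X i →ₗ[A] X.X (i + 1)).prod LinearMap.id)
      comm := fun i x => by
        refine Prod.ext (f.comm i x) (Prod.ext ?_ ?_)
        · change (0 : X.X (i + 1 + 1)) = - X.d (i + 1) 0
          simp
        · change X.d i x = X.d i x + 0
          rw [add_zero] }
  let σ : ∀ i, (cone f).X i →ₗ[A] E.X i := fun i =>
    (-LinearMap.snd A (X.X (i + 1)) (Y.X i)).prod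
      ((LinearMap.fst A (X.X (i + 1)) (Y.X i)).prod (0 : _ →ₗ[A] X.X i))
  have hb : (cone f).Bounded := by
    obtain ⟨n, hn⟩ := hXb
    obtain ⟨m, hm⟩ := hYb
    -- The extra one is for the term of degree i + 1 in the cone.
    refine ⟨n + m + 1, fun i hi => ?_⟩
    have h1 := hn (i + 1) (by have := abs_sub_abs_le_abs_sub i (-1); simp at this; push_cast at hi; linarith)
    have h2 := hm i (by push_cast at hi; linarith)
    exact inferInstanceAs (Subsingleton (X.X (i + 1) × Y.X i))
  obtain ⟨g, hg⟩ := hf.cone_exact.exists_section hb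
    (fun i => inferInstanceAs (Module.Projective A (X.X (i + 1) × Y.X i))) π σ (by
      rintro i ⟨x', y⟩
      refine Prod.ext rfl ?_
      change f.f i 0 - -y = y
      simp)
  have hπι : ∀ i x, π.f i (ι.f i x) = 0 := fun i x => by
    refine Prod.ext rfl ?_
    change f.f i x - f.f i x = 0
    rw [sub_self]
  refine ⟨⟨fun i => LinearEquiv.ofBijective ((ι.f i).coprod (g.f i)) ⟨?_, ?_⟩, fun i x => ?_⟩⟩
  · rw [← LinearMap.ker_eq_bot, LinearMap.ker_eq_bot']
    rintro ⟨x, k⟩ h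
    rw [LinearMap.coprod_apply] at h
    have hk : k = 0 := by
      have := congrArg (π.f i) h
      rwa [map_add, hπι, zero_add, hg, map_zero] at this
    subst hk
    rw [map_zero, add_zero] at h
    exact Prod.ext (congrArg (fun v => v.2.2) h) rfl
  · intro v
    have h0 : π.f i (v - g.f i (π.f i v)) = 0 := by rw [map_sub, hg, sub_self]
    set w := v - g.f i (π.f i v) with hw
    refine ⟨(w.2.2, π.f i v), ?_⟩
    rw [LinearMap.coprod_apply, ← eq_sub_iff_add_eq, ← hw]
    have h1 : w.2.1 = 0 := congrArg Prod.fst h0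
    have h2 : f.f i w.2.2 - w.1 = 0 := congrArg Prod.snd h0
    exact Prod.ext (sub_eq_zero.1 h2) (Prod.ext h1.symm rfl)
  · change ι.f (i + 1) (X.d i x.1) + g.f (i + 1) ((cone f).d i x.2) =
      E.d i (ι.f i x.1 + g.f i x.2)
    rw [map_add, ι.comm, g.comm]

end General

section VertexDimension

variable {V : Type} [Quiver.{0} V] [Fintype V] [DecidableEq V] {R : Relations V}

/-- Bounded complexes of finitely generated projective modules. -/
structure IsPerfect (X : LinCplx (Alg R)) : Prop where
  bounded : X.Bounded
  projective : ∀ i, Module.Projective (Alg R) (X.X i)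
  finite : ∀ i, Module.Finite (Alg R) (X.X i)

theorem IsPerfect.cone {X Y : LinCplx (Alg R)} (hX : X.IsPerfect) (hY : Y.IsPerfect)
    (f : Hom X Y) : (cone f).IsPerfect where
  bounded := by
    obtain ⟨n, hn⟩ := hX.bounded
    obtain ⟨m, hm⟩ := hY.bounded
    refine ⟨n + m + 1, fun i hi => ?_⟩
    have h1 := hn (i + 1) (by have := abs_sub_abs_le_abs_sub i (-1); simp at this; push_cast at hi; linarith)
    have h2 := hm i (by push_cast at hi; linarith)
    exact inferInstanceAs (Subsingleton (X.X (i + 1) × Y.X i))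
  projective i := by
    have := hX.projective
    have := hY.projective
    exact inferInstanceAs (Module.Projective (Alg R) (X.X (i + 1) × Y.X i))
  finite i := by
    have := hX.finite
    have := hY.finite
    exact inferInstanceAs (Module.Finite (Alg R) (X.X (i + 1) × Y.X i))

variable [Module.Finite ℂ (Alg R)]

theorem Exact.vtxDim_eq {X : LinCplx (Alg R)} (h : X.Exact)
    (hf : ∀ i, Module.Finite (Alg R) (X.X i)) (i : ℤ) (k : V) :
    vtxDim R (X.X i) k =
      vtxDim R (LinearMap.ker (X.d i)) k + vtxDim R (LinearMap.ker (X.d (i + 1))) k := by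
  have := hf i
  rw [vtxDim_of_surjective (N := LinearMap.ker (X.d (i + 1))) (X.toCycles i)
    (h.toCycles_surjective i), ker_toCycles]

theorem finite_ker (X : LinCplx (Alg R)) (hf : ∀ i, Module.Finite (Alg R) (X.X i)) (i : ℤ) :
    Module.Finite (Alg R) (LinearMap.ker (X.d i)) := by
  haveI : IsNoetherianRing (Alg R) := isNoetherian_of_tower ℂ inferInstance
  have := hf i
  infer_instance

/-- Acyclic bounded complexes of projectives with the same dimension vectors are isomorphic. -/
theorem Exact.nonempty_iso (hR : R.Admissible) (hgl : FiniteGlobalDimension (Alg R))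
    {X Y : LinCplx (Alg R)} (hX : X.Exact) (hY : Y.Exact) (pX : X.IsPerfect) (pY : Y.IsPerfect)
    (hdim : ∀ i k, vtxDim R (X.X i) k = vtxDim R (Y.X i) k) : Nonempty (Iso X Y) := by
  have hker : ∀ i k, vtxDim R (LinearMap.ker (X.d i)) k = vtxDim R (LinearMap.ker (Y.d i)) k := by
    obtain ⟨n, hn⟩ := pX.bounded
    obtain ⟨m, hm⟩ := pY.bounded
    -- Far to the left all cycles vanish; from there their dimension vectors are determined step by
    -- step, since X^i is composed of the cycles in degrees i and i + 1.
    have small : ∀ i : ℤ, i < -(n + m : ℕ) → ∀ k,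
        vtxDim R (LinearMap.ker (X.d i)) k = vtxDim R (LinearMap.ker (Y.d i)) k := by
      intro i hi k
      have h1 := neg_le_abs i
      have := hn i (by push_cast at hi; linarith)
      have := hm i (by push_cast at hi; linarith)
      rw [vtxDim_eq_zero_of_subsingleton, vtxDim_eq_zero_of_subsingleton]
    have step : ∀ i : ℤ, (∀ k, vtxDim R (LinearMap.ker (X.d i)) k =
        vtxDim R (LinearMap.ker (Y.d i)) k) → ∀ k, vtxDim R (LinearMap.ker (X.d (i + 1))) k =
        vtxDim R (LinearMap.ker (Y.d (i + 1))) k := by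
      intro i hi k
      have h1 := hdim i k
      rw [hX.vtxDim_eq pX.finite, hY.vtxDim_eq pY.finite, hi] at h1
      omega
    intro i
    rcases lt_or_ge i (-(n + m : ℕ)) with hi | hi
    · exact small i hi
    · refine Int.leInduction (motive := fun i _ => ∀ k, vtxDim R (LinearMap.ker (X.d i)) k =
        vtxDim R (LinearMap.ker (Y.d i)) k) (m := -(n + m : ℕ) - 1) (small _ (by omega)) ?_ i
        (by omega)
      exact fun j _ hj => step j hj
  obtain ⟨s, hs⟩ := hX.exists_sections pX.bounded pX.projective
  obtain ⟨s', hs'⟩ := hY.exists_sections pY.bounded pY.projective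
  have := hX.projective_cycles pX.bounded pX.projective
  have := hY.projective_cycles pY.bounded pY.projective
  have := X.finite_ker pX.finite
  have := Y.finite_ker pY.finite
  have ψ := fun i => Classical.choice (nonempty_equiv_of_vtxDim_eq hR hgl
    (LinearMap.ker (X.d i)) (LinearMap.ker (Y.d i)) (hker i))
  exact ⟨isoOfCycles hs hs' ψ⟩

/-- Quasi-isomorphic perfect complexes with the same dimension vectors become isomorphic after
adding a suitable acyclic complex. -/
theorem IsQis.nonempty_iso_prod (hR : R.Admissible) (hgl : FiniteGlobalDimension (Alg R))
    {X Y C : LinCplx (Alg R)} {f : Hom X Y} (hf : IsQis f) (pX : X.IsPerfect) (pY : Y.IsPerfect)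
    (pC : C.IsPerfect) (hC : C.Exact)
    (hXY : ∀ i k, vtxDim R (X.X i) k = vtxDim R (Y.X i) k)
    (hXC : ∀ i k, vtxDim R (C.X i) k = vtxDim R (X.X (i + 1)) k + vtxDim R (X.X i) k) :
    Nonempty (Iso (X.prod C) (Y.prod C)) := by
  have := pX.finite
  have := pY.finite
  obtain ⟨φ⟩ := hf.nonempty_iso pX.bounded pY.bounded pX.projective pY.projective
  -- As X and Y have equal dimension vectors, cone f and cone (id X) have the same ones, and `C` can
  -- stand for either.
  obtain ⟨α⟩ := hC.nonempty_iso hR hgl hf.cone_exact pC (pX.cone pY f) fun i k => by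
    rw [hXC, hXY i]
    exact (vtxDim_prod k).symm
  obtain ⟨β⟩ := hC.nonempty_iso hR hgl (IsQis.id X).cone_exact pC (pX.cone pX _) fun i k => by
    rw [hXC]
    exact (vtxDim_prod k).symm
  exact ⟨((Iso.refl X).prodCongr α).trans (φ.trans ((Iso.refl Y).prodCongr β.symm))⟩

end VertexDimension

end LinCplx

/-! ### Modules as representations on coordinate spaces -/

section Realisation

variable {V : Type} [Quiver.{0} V] [Fintype V] [DecidableEq V] {R : Relations V}
variable {W : V → Type} [∀ j, AddCommGroup (W j)] [∀ j, Module ℂ (W j)]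
variable {W' : V → Type} [∀ j, AddCommGroup (W' j)] [∀ j, Module ℂ (W' j)]

theorem arrElt_smul_repMod {x : QRep W} (hx : Satisfies R x) {j k : V} (a : j ⟶ k)
    (v : RepMod R x hx) :
    arrElt R a • v = RepMod.of hx (Pi.single k (x j k a (v.comp j))) := by
  change actHom R x hx (toAlg R (arr a)) v = _
  rw [actHom, RingQuot.liftAlgHom_mkAlgHom_apply]
  simp only [arr, FreeAlgebra.lift_ι_apply, genAct]
  rfl

theorem map_smul_of_generators {M N : Type} [AddCommGroup M] [Module ℂ M] [Module (Alg R) M]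
    [IsScalarTower ℂ (Alg R) M] [AddCommGroup N] [Module ℂ N] [Module (Alg R) N]
    [IsScalarTower ℂ (Alg R) N] (f : M →ₗ[ℂ] N) (h0 : ∀ k m, f (idem R k • m) = idem R k • f m)
    (h1 : ∀ (j k : V) (a : j ⟶ k) m, f (arrElt R a • m) = arrElt R a • f m) (c : Alg R) (m : M) :
    f (c • m) = c • f m := by
  obtain ⟨c, rfl⟩ := RingQuot.mkAlgHom_surjective ℂ (AlgRel R) c
  induction c using FreeAlgebra.induction generalizing m with
  | grade0 r => simp
  | grade1 g =>
    rcases g with j | ⟨j, k, a⟩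
    · exact h0 j m
    · exact h1 j k a m
  | mul a b ha hb => rw [map_mul, mul_smul, mul_smul, ha, hb]
  | add a b ha hb => rw [map_add, add_smul, add_smul, map_add, ha, hb]

/-- The components of an `A`-linear map between representations. -/
noncomputable def repComponent {x : QRep W} {y : QRep W'} {hx : Satisfies R x} {hy : Satisfies R y}
    (φ : RepMod R x hx →ₗ[Alg R] RepMod R y hy) (j : V) : W j →ₗ[ℂ] W' j :=
  LinearMap.proj j ∘ₗ (φ.restrictScalars ℂ : (∀ j, W j) →ₗ[ℂ] ∀ j, W' j) ∘ₗ
    LinearMap.single ℂ W j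

theorem repComponent_apply {x : QRep W} {y : QRep W'} {hx : Satisfies R x} {hy : Satisfies R y}
    (φ : RepMod R x hx →ₗ[Alg R] RepMod R y hy) (j : V) (w : W j) :
    repComponent φ j w = (φ (RepMod.of hx (Pi.single j w))).comp j := rfl

/-- Linearity over the idempotents makes a map of representations diagonal with respect to the
vertices. -/
theorem comp_apply_eq_repComponent {x : QRep W} {y : QRep W'} {hx : Satisfies R x}
    {hy : Satisfies R y} (φ : RepMod R x hx →ₗ[Alg R] RepMod R y hy) (v : RepMod R x hx) (j : V) :
    (φ v).comp j = repComponent φ j (v.comp j) := by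
  have h := φ.map_smul (idem R j) v
  rw [idem_smul_repMod, idem_smul_repMod] at h
  rw [repComponent_apply, h, RepMod.comp_of, Pi.single_eq_same]

theorem repComponent_comm {x : QRep W} {y : QRep W'} {hx : Satisfies R x}
    {hy : Satisfies R y} (φ : RepMod R x hx →ₗ[Alg R] RepMod R y hy) {j k : V} (a : j ⟶ k)
    (w : W j) : repComponent φ k (x j k a w) = y j k a (repComponent φ j w) := by
  have h := φ.map_smul (arrElt R a) (RepMod.of hx (Pi.single j w))
  rw [arrElt_smul_repMod, arrElt_smul_repMod, RepMod.comp_of, Pi.single_eq_same] at h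
  rw [repComponent_apply, h, RepMod.comp_of, Pi.single_eq_same, repComponent_apply]

/-- The components of an isomorphism of representations. -/
noncomputable def repComponentEquiv {x : QRep W} {y : QRep W'} {hx : Satisfies R x}
    {hy : Satisfies R y} (φ : RepMod R x hx ≃ₗ[Alg R] RepMod R y hy) (j : V) : W j ≃ₗ[ℂ] W' j :=
  LinearEquiv.ofLinearMap (repComponent φ.toLinearMap j) (repComponent φ.symm.toLinearMap j)
    (LinearMap.ext fun w => by
      rw [LinearMap.comp_apply, repComponent_apply φ.symm.toLinearMap,
        ← comp_apply_eq_repComponent]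
      change (φ (φ.symm _)).comp j = w
      rw [φ.apply_symm_apply, RepMod.comp_of, Pi.single_eq_same])
    (LinearMap.ext fun w => by
      rw [LinearMap.comp_apply, repComponent_apply φ.toLinearMap,
        ← comp_apply_eq_repComponent]
      change (φ.symm (φ _)).comp j = w
      rw [φ.symm_apply_apply, RepMod.comp_of, Pi.single_eq_same])

/-- Arrows act between the corners ε_k M, and M is the direct sum of its corners because the
idempotents are orthogonal with sum one. -/
theorem exists_rep_of_corner (M : Type) [AddCommGroup M] [Module ℂ M] [Module (Alg R) M]
    [IsScalarTower ℂ (Alg R) M] :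
    ∃ (x : QRep fun k => LinearMap.range (Algebra.lsmul ℂ ℂ M (idem R k))) (hx : Satisfies R x),
      Nonempty (M ≃ₗ[Alg R] RepMod R x hx) := by
  let E : V → Submodule ℂ M := fun k => LinearMap.range (Algebra.lsmul ℂ ℂ M (idem R k))
  have hE : ∀ j, ∀ x ∈ E j, idem R j • x = x := by
    rintro j _ ⟨x, rfl⟩
    change idem R j • idem R j • x = idem R j • x
    rw [smul_smul, idem_mul_self]
  let x : QRep fun k => E k := fun j k a =>
    ((Algebra.lsmul ℂ ℂ M (arrElt R a)) ∘ₗ (E j).subtype).codRestrict (E k) fun m =>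
      ⟨arrElt R a • m.1, by
        change idem R k • arrElt R a • m.1 = arrElt R a • m.1
        rw [smul_smul, idem_mul_arrElt]⟩
  have hx0 : ∀ (j k : V) (a : j ⟶ k) (m : E j), (x j k a m).1 = arrElt R a • m.1 :=
    fun _ _ _ _ => rfl
  have hpath : ∀ {j k : V} (p : Quiver.Path j k) (m : E j),
      (evalPath x p m).1 = pathElt R p • m.1 := by
    intro j k p m
    induction p with
    | nil => exact (hE j _ m.2).symm
    | cons p a ih =>
      rw [pathElt_cons, mul_smul, ← ih]
      rfl
  have hx : Satisfies R x := by
    intro j k r hr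
    refine LinearMap.ext fun m => Subtype.ext ?_
    have h1 : (toAlg R (r.sum fun p c => c • pathWord p)) = 0 := by
      rw [toAlg_eq_of_rel (AlgRel.rel j k r hr), map_zero]
    have h2 := congrArg (fun c => c • m.1) h1
    simp only [Finsupp.sum, map_sum, map_smul, Finset.sum_smul, zero_smul] at h2
    simp only [Finsupp.sum, LinearMap.sum_apply, AddSubmonoidClass.coe_finsetSum,
      LinearMap.smul_apply, LinearMap.zero_apply, Submodule.coe_smul, hpath, ZeroMemClass.coe_zero]
    rw [← h2]
    refine Finset.sum_congr rfl fun p _ => ?_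
    rw [smul_assoc]
    rfl
  let ψ : M →ₗ[ℂ] RepMod R x hx := (LinearMap.pi fun k =>
    (Algebra.lsmul ℂ ℂ M (idem R k)).rangeRestrict : M →ₗ[ℂ] ∀ k, E k)
  have hψ : ∀ m k, ((ψ m).comp k).1 = idem R k • m := fun _ _ => rfl
  have hlin := map_smul_of_generators (R := R) ψ (fun l m => by
      rw [idem_smul_repMod]
      refine RepMod.ext fun k => Subtype.ext ?_
      rw [hψ, RepMod.comp_of]
      rcases eq_or_ne k l with rfl | h
      · rw [Pi.single_eq_same, hψ, smul_smul, idem_mul_self]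
      · rw [Pi.single_eq_of_ne h, smul_smul, idem_mul_of_ne R h, zero_smul]
        rfl) (fun j l a m => by
      rw [arrElt_smul_repMod]
      refine RepMod.ext fun k => Subtype.ext ?_
      rw [hψ, RepMod.comp_of]
      rcases eq_or_ne k l with rfl | h
      · rw [Pi.single_eq_same, hx0, hψ, smul_smul, smul_smul, idem_mul_arrElt, arrElt_mul_idem]
      · rw [Pi.single_eq_of_ne h, smul_smul, ← idem_mul_arrElt, ← mul_assoc, idem_mul_of_ne R h,
          zero_mul, zero_smul]
        rfl)
  let Ψ : M →ₗ[Alg R] RepMod R x hx :=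
    { toFun := ψ
      map_add' := ψ.map_add
      map_smul' := hlin }
  refine ⟨x, hx, ⟨LinearEquiv.ofBijective Ψ ⟨?_, ?_⟩⟩⟩
  · intro m n h
    rw [← one_smul (Alg R) m, ← one_smul (Alg R) n, ← sum_idem, Finset.sum_smul, Finset.sum_smul]
    exact Finset.sum_congr rfl fun k _ => congrArg Subtype.val (congrFun h k)
  · intro v
    refine ⟨∑ k, (v.comp k).1, RepMod.ext fun l => Subtype.ext ((hψ _ _).trans ?_)⟩
    rw [Finset.smul_sum, Finset.sum_eq_single l]
    · exact hE l _ (v.comp l).2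
    · intro k _ h
      rw [← hE k _ (v.comp k).2, smul_smul, idem_mul_of_ne R h.symm, zero_smul]
    · simp

/-- Finite-dimensional modules come from representations on spaces `ℂ^n`. -/
theorem exists_rep [Module.Finite ℂ (Alg R)] (M : Type) [AddCommGroup M] [Module (Alg R) M]
    [Module.Finite (Alg R) M] :
    ∃ (x : QRep fun k => Sp (vtxDim R M k)) (hx : Satisfies R x),
      Nonempty (M ≃ₗ[Alg R] RepMod R x hx) := by
  letI := Module.restrictScalars ℂ (Alg R) M
  haveI := IsScalarTower.restrictScalars ℂ (Alg R) M
  haveI : Module.Finite ℂ M := Module.Finite.trans (Alg R) M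
  obtain ⟨x, hx, ⟨ψ⟩⟩ := exists_rep_of_corner (R := R) M
  let b : ∀ k, LinearMap.range (Algebra.lsmul ℂ ℂ M (idem R k)) ≃ₗ[ℂ] Sp (vtxDim R M k) :=
    fun k => LinearEquiv.ofFinrankEq _ _ (by
      rw [Module.finrank_fin_fun, ← dimVec_eq_vtxDim, dimVec])
  let y : QRep fun k => Sp (vtxDim R M k) := fun j k a =>
    (b k).toLinearMap ∘ₗ x j k a ∘ₗ (b j).symm.toLinearMap
  have hb : ∀ (j k : V) (a : j ⟶ k),
      (b k).toLinearMap ∘ₗ x j k a = y j k a ∘ₗ (b j).toLinearMap := fun j k a =>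
    LinearMap.ext fun v => by simp [y]
  exact ⟨y, CPoint.satisfies_conj hx b hb, ⟨ψ.trans (repEquiv hx _ b hb)⟩⟩

end Realisation

/-! ### Points of the varieties as elementary complexes -/

section Points

variable {V : Type} [Quiver.{0} V] [Fintype V] [DecidableEq V] {R : Relations V} {d d' d'' : DimSeq V}

namespace CPoint

theorem comp_diffLin (p : CPoint R d) (i : ℤ) (v : p.mod i) (j : V) :
    (p.diffLin i v).comp j = p.diff i j (v.comp j) := rfl

/-- The elementary complex of a point. -/
noncomputable def lin (p : CPoint R d) : LinCplx (Alg R) where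
  X := p.mod
  d := p.diffLin
  d_d i v := RepMod.ext fun j => LinearMap.congr_fun (p.sq_zero i j) (v.comp j)

theorem complex_d (p : CPoint R d) (i : ℤ) :
    p.complex.d i (i + 1) = ModuleCat.ofHom (p.diffLin i) :=
  by simp [complex]

theorem acyclic_iff (p : CPoint R d) : p.complex.Acyclic ↔ p.lin.Exact := by
  have h : ∀ i, p.complex.ExactAt (i + 1) ↔
      ∀ v : p.mod (i + 1), p.diffLin (i + 1) v = 0 → ∃ w, p.diffLin i w = v := by
    intro i
    rw [p.complex.exactAt_iff' i (i + 1) (i + 1 + 1) (by simp) (by simp),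
      ShortComplex.moduleCat_exact_iff]
    change (∀ v, (p.complex.d (i + 1) (i + 1 + 1)).hom v = 0 →
      ∃ w, (p.complex.d i (i + 1)).hom w = v) ↔ _
    rw [complex_d, complex_d]
    rfl
  exact ⟨fun H i => (h i).1 (H (i + 1)), fun H => forall_of_succ fun i => (h i).2 (H i)⟩

theorem bounded_lin (p : CPoint R d) : p.lin.Bounded := by
  obtain ⟨n, hn⟩ := p.toBdd.bounded
  exact ⟨n, fun i hi => ModuleCat.subsingleton_of_isZero (hn i hi)⟩

theorem finite_lin (p : CPoint R d) (i : ℤ) : Module.Finite (Alg R) (p.lin.X i) :=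
  p.toBdd.finite i

/-- Isomorphic complexes with the same underlying spaces lie in the same orbit. -/
theorem exists_smul_eq_of_iso {p q : CPoint R d} (φ : LinCplx.Iso p.lin q.lin) :
    ∃ g : GLSeq d, g • p = q := by
  let e : ∀ i, RepMod R (p.x i) (p.sat i) ≃ₗ[Alg R] RepMod R (q.x i) (q.sat i) := φ.e
  let g : GLSeq d := fun i j => repComponentEquiv (e i) j
  have hg : ∀ i j v, g i j v = repComponent (e i).toLinearMap j v := fun _ _ _ => rfl
  refine ⟨g, CPoint.ext ?_ ?_⟩
  · funext i j k a
    refine LinearMap.ext fun v => ?_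
    change g i k (p.x i j k a ((g i j).symm v)) = q.x i j k a v
    rw [hg, repComponent_comm, ← hg, LinearEquiv.apply_symm_apply]
  · funext i j
    refine LinearMap.ext fun v => ?_
    change g (i + 1) j (p.diff i j ((g i j).symm v)) = q.diff i j v
    let w : p.mod i := RepMod.of (p.sat i) (Pi.single j ((g i j).symm v))
    have hw : w.comp j = (g i j).symm v := Pi.single_eq_same j _
    have h : (e (i + 1) (p.diffLin i w)).comp j = q.diff i j ((e i w).comp j) :=
      congrArg (fun u : RepMod R (q.x (i + 1)) (q.sat (i + 1)) => u.comp j) (φ.comm i w)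
    have h1 := comp_apply_eq_repComponent (e (i + 1)).toLinearMap (p.diffLin i w) j
    have h2 := comp_apply_eq_repComponent (e i).toLinearMap w j
    rw [hw, ← hg, LinearEquiv.apply_symm_apply] at h2
    rw [comp_diffLin, hw, ← hg] at h1
    exact h1.symm.trans (h.trans (congrArg (q.diff i j) h2))

theorem sumPointEquiv_apply (s : CoordSum d d' d'') (p : CPoint R d) (q : CPoint R d') (i : ℤ)
    (v : (sumPoint s p q).mod i) : sumPointEquiv s p q i v =
      (RepMod.of (p.sat i) (fun j => ((spEquiv (s i j)).symm (v.comp j)).1),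
        RepMod.of (q.sat i) (fun j => ((spEquiv (s i j)).symm (v.comp j)).2)) := by
  let e := repEquiv (satisfies_prod (p.sat i) (q.sat i)) ((sumPoint s p q).sat i)
    (fun j => spEquiv (s i j))
    (fun j k a => by refine LinearMap.ext fun v => ?_; simp [sumPoint, blockSum])
  have h : e.symm v = RepMod.of (satisfies_prod (p.sat i) (q.sat i))
      (fun j => (spEquiv (s i j)).symm (v.comp j)) := by
    rw [LinearEquiv.symm_apply_eq]
    exact RepMod.ext fun j => ((spEquiv (s i j)).apply_symm_apply _).symm
  refine (congrArg (fun w : RepMod R _ (satisfies_prod (p.sat i) (q.sat i)) =>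
    ((RepMod.of (p.sat i) fun j => (w.comp j).1 : p.mod i),
      (RepMod.of (q.sat i) fun j => (w.comp j).2 : q.mod i))) h :)

/-- The elementary complex of a direct sum. -/
noncomputable def linSum (s : CoordSum d d' d'') (p : CPoint R d) (q : CPoint R d') :
    LinCplx.Iso (sumPoint s p q).lin (p.lin.prod q.lin) where
  e := sumPointEquiv s p q
  comm i v := by
    refine (sumPointEquiv_apply s p q (i + 1) _).trans ?_
    refine Eq.trans ?_ (congrArg ((p.lin.prod q.lin).d i) (sumPointEquiv_apply s p q i v)).symm
    refine Prod.ext (RepMod.ext fun j => ?_) (RepMod.ext fun j => ?_)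
    · change ((spEquiv (s (i + 1) j)).symm (blockSum _ _ (p.diff i j) (q.diff i j) _)).1 = _
      simp [blockSum]
      rfl
    · change ((spEquiv (s (i + 1) j)).symm (blockSum _ _ (p.diff i j) (q.diff i j) _)).2 = _
      simp [blockSum]
      rfl

/-- A point and its conjugates have isomorphic complexes. -/
noncomputable def complexSMulIso (g : GLSeq d) (p : CPoint R d) : p.complex ≅ (g • p).complex :=
  HomologicalComplex.Hom.isoOfComponents
    (fun i => (repEquiv (p.sat i) ((g • p).sat i) (g i) (fun j k a => by
      refine LinearMap.ext fun v => ?_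
      change _ = g i k (p.x i j k a ((g i j).symm (g i j v)))
      simp)).toModuleIso)
    (by
      rintro i _ rfl
      rw [complex_d, complex_d]
      refine ModuleCat.hom_ext (LinearMap.ext fun v => funext fun j => ?_)
      change g (i + 1) j (p.diff i j ((g i j).symm (g i j _))) = _
      rw [LinearEquiv.symm_apply_apply]
      rfl)

end CPoint

end Points

/-! ### From the derived category to quasi-isomorphisms of complexes -/

/-- `Qh` is bijective on morphisms out of a K-projective complex: surjectivity lifts the isomorphism
and its inverse to the homotopy category, and injectivity lifts the relations between them. -/
theorem nonempty_homotopyEquiv_of_iso {C : Type 1} [Category.{0} C] [Abelian C]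
    [HasDerivedCategory.{1} C] {K L : CochainComplex C ℤ} [K.IsKProjective] [L.IsKProjective]
    (e : DerivedCategory.Q.obj K ≅ DerivedCategory.Q.obj L) : Nonempty (HomotopyEquiv K L) := by
  let ε := DerivedCategory.quotientCompQhIso C
  obtain ⟨α, hα⟩ := (CochainComplex.IsKProjective.Qh_map_bijective K
    ((HomotopyCategory.quotient C (.up ℤ)).obj L)).surjective
      (ε.hom.app K ≫ e.hom ≫ ε.inv.app L)
  obtain ⟨β, hβ⟩ := (CochainComplex.IsKProjective.Qh_map_bijective L
    ((HomotopyCategory.quotient C (.up ℤ)).obj K)).surjective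
      (ε.hom.app L ≫ e.inv ≫ ε.inv.app K)
  refine ⟨HomotopyCategory.homotopyEquivOfIso ⟨α, β,
    (CochainComplex.IsKProjective.Qh_map_bijective K _).injective ?_,
    (CochainComplex.IsKProjective.Qh_map_bijective L _).injective ?_⟩⟩
  · rw [Functor.map_comp, hα, hβ, CategoryTheory.Functor.map_id]
    simp
  · rw [Functor.map_comp, hα, hβ, CategoryTheory.Functor.map_id]
    simp

section

variable {V : Type} [Quiver.{0} V] [Fintype V] [DecidableEq V] {R : Relations V}
  {d d' : DimSeq V}

/-- The terms of a morphism of complexes as linear maps. -/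
noncomputable def CPoint.homLin {p : CPoint R d} {q : CPoint R d'} (f : p.complex ⟶ q.complex) (i : ℤ) :
    p.mod i →ₗ[Alg R] q.mod i := (f.f i).hom

theorem CPoint.homLin_comm {p : CPoint R d} {q : CPoint R d'} (f : p.complex ⟶ q.complex) (i : ℤ)
    (x : p.mod i) : homLin f (i + 1) (p.diffLin i x) = q.diffLin i (homLin f i x) := by
  have h := f.comm i (i + 1)
  rw [complex_d, complex_d] at h
  exact (congrArg (fun φ : p.complex.X i ⟶ q.complex.X (i + 1) => φ.hom x) h).symm

theorem CPoint.exists_homotopy {p : CPoint R d} {q : CPoint R d'} {f g : p.complex ⟶ q.complex}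
    (h : Homotopy f g) (i : ℤ) :
    ∃ (a : p.mod (i + 1 + 1) →ₗ[Alg R] q.mod (i + 1)) (b : p.mod (i + 1) →ₗ[Alg R] q.mod i),
      ∀ z : p.mod (i + 1), homLin f (i + 1) z =
        a (p.diffLin (i + 1) z) + q.diffLin i (b z) + homLin g (i + 1) z := by
  refine ⟨(h.hom (i + 1 + 1) (i + 1)).hom, (h.hom (i + 1) i).hom, fun z => ?_⟩
  have h1 := h.comm (i + 1)
  rw [dNext_eq h.hom (show (ComplexShape.up ℤ).Rel (i + 1) (i + 1 + 1) by simp),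
    prevD_eq h.hom (show (ComplexShape.up ℤ).Rel i (i + 1) by simp), complex_d, complex_d] at h1
  exact congrArg (fun φ : p.complex.X (i + 1) ⟶ q.complex.X (i + 1) => φ.hom z) h1

theorem CPoint.isKProjective (p : CPoint R d) (hp : ∀ i, Module.Projective (Alg R) (p.mod i)) :
    p.complex.IsKProjective := by
  obtain ⟨n, hn⟩ := p.toBdd.bounded
  have : p.complex.IsStrictlyLE n := by
    rw [CochainComplex.isStrictlyLE_iff]
    exact fun i hi => hn i (hi.trans_le (le_abs_self i))
  have (i : ℤ) : Projective (p.complex.X i) :=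
    (IsProjective.iff_projective (R := Alg R) (p.mod i)).1 (hp i)
  exact CochainComplex.isKProjective_of_projective p.complex n

/-- Bounded complexes of projectives are K-projective, so the isomorphism comes from a homotopy
equivalence, whose homotopies give bijectivity on homology in terms of elements. -/
theorem CPoint.exists_isQis_of_iso {p : CPoint R d} {q : CPoint R d'}
    (hp : ∀ i, Module.Projective (Alg R) (p.mod i)) (hq : ∀ i, Module.Projective (Alg R) (q.mod i))
    (e : DerivedCategory.Q.obj p.complex ≅ DerivedCategory.Q.obj q.complex) :
    ∃ f : LinCplx.Hom p.lin q.lin, LinCplx.IsQis f := by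
  have := p.isKProjective hp
  have := q.isKProjective hq
  obtain ⟨H⟩ := nonempty_homotopyEquiv_of_iso e
  let f := homLin H.hom
  let g := homLin H.inv
  refine ⟨⟨f, homLin_comm H.hom⟩, ⟨fun i (z : p.mod (i + 1)) hz (y : q.mod i) hy => ?_,
    fun i (y : q.mod (i + 1)) hy => ?_⟩⟩
  · obtain ⟨a, b, h⟩ := exists_homotopy H.homotopyHomInvId i
    have h : g (i + 1) (f (i + 1) z) = a (p.diffLin (i + 1) z) + p.diffLin i (b z) + z := h z
    have hz' : p.diffLin (i + 1) z = 0 := hz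
    have hy' : f (i + 1) z = q.diffLin i y := hy
    have hc : g (i + 1) (q.diffLin i y) = p.diffLin i (g i y) := homLin_comm H.inv i y
    rw [hz', map_zero, zero_add, hy', hc] at h
    refine ⟨g i y - b z, ?_⟩
    refine ((p.diffLin i).map_sub _ _).trans ?_
    rw [h]
    exact add_sub_cancel_left _ _
  · obtain ⟨a, b, h⟩ := exists_homotopy H.homotopyInvHomId i
    have h : f (i + 1) (g (i + 1) y) = a (q.diffLin (i + 1) y) + q.diffLin i (b y) + y := h y
    have hy' : q.diffLin (i + 1) y = 0 := hy
    rw [hy', map_zero, zero_add] at h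
    refine ⟨g (i + 1) y, ?_, b y, ?_⟩
    · exact (homLin_comm H.inv (i + 1) y).symm.trans ((congrArg (g _) hy').trans (map_zero _))
    · change f (i + 1) (g (i + 1) y) - y = _
      rw [h]
      exact add_sub_cancel_right _ _

end

/-! ### Euler characteristics on K_0 -/

section AlternatingSum

/-- The alternating sum of a finitely supported sequence of integers. -/
noncomputable def altSum (f : ℤ → ℤ) : ℤ := ∑ᶠ i, (i.negOnePow : ℤ) * f i

theorem altSum_add {f g : ℤ → ℤ} (hf : f.HasFiniteSupport) (hg : g.HasFiniteSupport) :
    altSum (fun i => f i + g i) = altSum f + altSum g := by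
  simp only [altSum, mul_add]
  refine finsum_add_distrib (Set.Finite.subset hf ?_) (Set.Finite.subset hg ?_) <;>
  · intro i hi h
    simp [h] at hi

theorem altSum_shift (f : ℤ → ℤ) : altSum (fun i => f (i - 1)) = -altSum f := by
  simp only [altSum]
  rw [← finsum_comp_equiv (Equiv.addRight (1 : ℤ)), ← finsum_neg_distrib]
  refine finsum_congr fun i => ?_
  simp [Int.negOnePow_succ]

end AlternatingSum

section

variable {V : Type} [Quiver.{0} V] [Fintype V] [DecidableEq V] {R : Relations V}

/-- The homology modules of an object of the derived category. -/
noncomputable abbrev derivedHomology (X : DerivedCategory (ModuleCat.{0} (Alg R))) (i : ℤ) :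
    ModuleCat.{0} (Alg R) := (DerivedCategory.homologyFunctor _ i).obj X

theorem BddComplex.finite_derivedHomology [Module.Finite ℂ (Alg R)] (X : BddComplex R) (i : ℤ) :
    Module.Finite (Alg R) (derivedHomology (DerivedCategory.Q.obj X.cplx) i) := by
  have : IsNoetherianRing (Alg R) := IsNoetherianRing.of_finite ℂ (Alg R)
  let S := X.cplx.sc i
  have : Module.Finite (Alg R) S.X₂ := X.finite i
  have : Module.Finite (Alg R) S.cycles :=
    Module.Finite.of_injective S.iCycles.hom ((ModuleCat.mono_iff_injective _).1 inferInstance)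
  have : Module.Finite (Alg R) S.homology :=
    Module.Finite.of_surjective S.homologyπ.hom ((ModuleCat.epi_iff_surjective _).1 inferInstance)
  let e : derivedHomology (DerivedCategory.Q.obj X.cplx) i ≅ S.homology :=
    (DerivedCategory.homologyFunctorFactors _ i).app X.cplx
  exact Module.Finite.equiv e.toLinearEquiv.symm

theorem BddComplex.hasFiniteSupport_vtxDim (X : BddComplex R) (k : V) :
    Function.HasFiniteSupport fun i =>
      (vtxDim R (derivedHomology (DerivedCategory.Q.obj X.cplx) i) k : ℤ) := by
  obtain ⟨n, hn⟩ := X.bounded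
  refine Set.Finite.subset (Set.finite_Icc (-n : ℤ) n) fun i hi => ?_
  by_contra h
  refine hi ?_
  have h0 : Limits.IsZero (X.cplx.X i) := hn i (by
    by_contra h'
    exact h (abs_le.1 (not_lt.1 h')))
  have h1 : Limits.IsZero (derivedHomology (DerivedCategory.Q.obj X.cplx) i) :=
    ((ShortComplex.exact_iff_isZero_homology _).1
      (ShortComplex.exact_of_isZero_X₂ (X.cplx.sc i) h0)).of_iso
      ((DerivedCategory.homologyFunctorFactors _ i).app X.cplx)
  have := ModuleCat.subsingleton_of_isZero h1
  simp [vtxDim_eq_zero_of_subsingleton]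

variable (R) in
/-- The Euler characteristic of the homology of a bounded complex at a vertex. -/
noncomputable def eulerChar (k : V) (X : BddComplex R) : ℤ :=
  altSum fun i => (vtxDim R (derivedHomology (DerivedCategory.Q.obj X.cplx) i) k : ℤ)

/-- With a, b, c the ranks in the long exact homology sequence, every term is a sum of two
consecutive ranks. What remains of X + Z - Y is c plus its shift, and this cancels in the
alternating sum. -/
theorem eulerChar_of_distTriang [Module.Finite ℂ (Alg R)] (k : V) {X Y Z : BddComplex R}
    {f : DerivedCategory.Q.obj X.cplx ⟶ DerivedCategory.Q.obj Y.cplx}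
    {g : DerivedCategory.Q.obj Y.cplx ⟶ DerivedCategory.Q.obj Z.cplx}
    {h : DerivedCategory.Q.obj Z.cplx ⟶ (DerivedCategory.Q.obj X.cplx)⟦(1 : ℤ)⟧}
    (hT : Pretriangulated.Triangle.mk f g h ∈ Pretriangulated.distinguishedTriangles
      (C := DerivedCategory (ModuleCat.{0} (Alg R)))) :
    eulerChar R k Y = eulerChar R k X + eulerChar R k Z := by
  let T := Pretriangulated.Triangle.mk f g h
  let H := fun X : BddComplex R => derivedHomology (DerivedCategory.Q.obj X.cplx)
  let α : ∀ i, H X i →ₗ[Alg R] H Y i := fun i => ((DerivedCategory.homologyFunctor _ i).map f).hom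
  let β : ∀ i, H Y i →ₗ[Alg R] H Z i := fun i => ((DerivedCategory.homologyFunctor _ i).map g).hom
  let δ : ∀ i, H Z i →ₗ[Alg R] H X (i + 1) := fun i =>
    (DerivedCategory.HomologySequence.δ T i (i + 1) rfl).hom
  have hαβ : ∀ i, Function.Exact (α i) (β i) := fun i =>
    (ShortComplex.ShortExact.moduleCat_exact_iff_function_exact _).1
      (DerivedCategory.HomologySequence.exact₂ T hT i)
  have hβδ : ∀ i, Function.Exact (β i) (δ i) := fun i =>
    (ShortComplex.ShortExact.moduleCat_exact_iff_function_exact _).1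
      (DerivedCategory.HomologySequence.exact₃ T hT i (i + 1) rfl)
  have hδα : ∀ i, Function.Exact (δ i) (α (i + 1)) := fun i =>
    (ShortComplex.ShortExact.moduleCat_exact_iff_function_exact _).1
      (DerivedCategory.HomologySequence.exact₁ T hT i (i + 1) rfl)
  let a : ℤ → ℕ := fun i => vtxDim R (LinearMap.range (α i)) k
  let b : ℤ → ℕ := fun i => vtxDim R (LinearMap.range (β i)) k
  let c : ℤ → ℕ := fun i => vtxDim R (LinearMap.range (δ i)) k
  have hY : ∀ i, vtxDim R (H Y i) k = a i + b i := fun i =>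
    have : Module.Finite (Alg R) (H Y i) := Y.finite_derivedHomology i
    vtxDim_of_exact (hαβ i) k
  have hZ : ∀ i, vtxDim R (H Z i) k = b i + c i := fun i =>
    have : Module.Finite (Alg R) (H Z i) := Z.finite_derivedHomology i
    vtxDim_of_exact (hβδ i) k
  have hX : ∀ i, vtxDim R (H X (i + 1)) k = c i + a (i + 1) := fun i =>
    have : Module.Finite (Alg R) (H X (i + 1)) := X.finite_derivedHomology (i + 1)
    vtxDim_of_exact (hδα i) k
  -- The ranks are bounded by the homology of Z. Finite support matters because `finsum` is zero by
  -- default otherwise and additivity would fail.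
  have hc : Function.HasFiniteSupport fun i => (c i : ℤ) :=
    Set.Finite.subset (Z.hasFiniteSupport_vtxDim k) fun i hi h0 => hi (by
      have : vtxDim R (derivedHomology (DerivedCategory.Q.obj Z.cplx) i) k = b i + c i := hZ i
      simp only [Nat.cast_eq_zero] at h0 ⊢
      omega)
  have hc' : Function.HasFiniteSupport fun i => (c (i - 1) : ℤ) :=
    Set.Finite.preimage (sub_left_injective.injOn) hc
  have key : (fun i => (vtxDim R (H X i) k : ℤ) + vtxDim R (H Z i) k) =
      fun i => (vtxDim R (H Y i) k : ℤ) +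
        ((c i : ℤ) + (c (i - 1) : ℤ)) := by
    funext i
    have h1 := hX (i - 1)
    rw [sub_add_cancel] at h1
    have h2 := hY i
    have h3 := hZ i
    omega
  have h1 := congrArg altSum key
  rw [altSum_add (X.hasFiniteSupport_vtxDim k) (Z.hasFiniteSupport_vtxDim k),
    altSum_add (Y.hasFiniteSupport_vtxDim k) (hc.fun_add hc'), altSum_add hc hc',
    altSum_shift (fun i => (c i : ℤ)), add_neg_cancel, add_zero] at h1
  exact h1.symm

theorem eulerChar_eq_of_mk_eq [Module.Finite ℂ (Alg R)] (k : V) {X Y : BddComplex R}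
    (h : K0.mk X = K0.mk Y) : eulerChar R k X = eulerChar R k Y := by
  have hle : AddSubgroup.closure (triangleRel R) ≤
      (FreeAbelianGroup.lift (eulerChar R k)).ker := by
    rw [AddSubgroup.closure_le]
    rintro _ ⟨X, Y, Z, f, g, h, hT, rfl⟩
    simp [AddMonoidHom.mem_ker, eulerChar_of_distTriang k hT]
  have := congrArg (QuotientAddGroup.lift _ _ hle) h
  simpa [K0.mk] using this

/-- All differentials vanish, so the homology modules are the terms. -/
theorem eulerChar_zeroPoint (d : DimSeq V) (k : V) :
    eulerChar R k (zeroPoint R d).toBdd = altSum fun i => (d i k : ℤ) := by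
  refine congrArg altSum (funext fun i => congrArg Nat.cast ?_)
  have hd : ∀ i j, (zeroPoint R d).complex.d i j = 0 := by
    intro i j
    by_cases h : (ComplexShape.up ℤ).Rel i j
    · obtain rfl : i + 1 = j := h
      rw [CPoint.complex_d]
      rfl
    · exact (zeroPoint R d).complex.shape i j h
  let e : derivedHomology (DerivedCategory.Q.obj (zeroPoint R d).complex) i ≅
      (zeroPoint R d).complex.X i :=
    (DerivedCategory.homologyFunctorFactors _ i).app (zeroPoint R d).complex ≪≫
      (ShortComplex.LeftHomologyData.ofZeros ((zeroPoint R d).complex.sc i)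
        (hd _ _) (hd _ _)).homologyIso
  refine (vtxDim_congr e.toLinearEquiv k).trans ?_
  exact (vtxDim_repMod ((zeroPoint R d).sat i) k).trans (by simp)

theorem altSum_eq_of_dimClass_eq [Module.Finite ℂ (Alg R)] {d d' : DimSeq V}
    (h : dimClass R d = dimClass R d') (k : V) :
    altSum (fun i => (d i k : ℤ)) = altSum (fun i => (d' i k : ℤ)) := by
  rw [← eulerChar_zeroPoint (R := R), ← eulerChar_zeroPoint (R := R)]
  exact eulerChar_eq_of_mk_eq k h

end

/-! ### Relations in K_0 between dimension sequences -/

section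

variable {V : Type} [Quiver.{0} V] [Fintype V] [DecidableEq V] {R : Relations V}

theorem K0.mk_of_distTriang {X Y Z : BddComplex R}
    {f : DerivedCategory.Q.obj X.cplx ⟶ DerivedCategory.Q.obj Y.cplx}
    {g : DerivedCategory.Q.obj Y.cplx ⟶ DerivedCategory.Q.obj Z.cplx}
    {h : DerivedCategory.Q.obj Z.cplx ⟶ (DerivedCategory.Q.obj X.cplx)⟦(1 : ℤ)⟧}
    (hT : Pretriangulated.Triangle.mk f g h ∈ Pretriangulated.distinguishedTriangles
      (C := DerivedCategory (ModuleCat.{0} (Alg R)))) :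
    K0.mk Y = K0.mk X + K0.mk Z := by
  have : (QuotientAddGroup.mk (FreeAbelianGroup.of Y - FreeAbelianGroup.of X -
      FreeAbelianGroup.of Z) : K0 R) = 0 :=
    (QuotientAddGroup.eq_zero_iff _).2 (AddSubgroup.subset_closure ⟨X, Y, Z, f, g, h, hT, rfl⟩)
  have h2 : K0.mk Y - K0.mk X - K0.mk Z = 0 := this
  rw [sub_sub, sub_eq_zero] at h2
  exact h2

/-- An acyclic X is a zero object of the derived category, so X itself can serve as the third term
of the triangle on the identity of X. This gives [X] = [X] + [X]. -/
theorem K0.mk_eq_zero {X : BddComplex R} (hX : X.cplx.Acyclic) : K0.mk X = 0 := by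
  have hz : Limits.IsZero (DerivedCategory.Q.obj X.cplx) := by
    rw [Limits.IsZero.iff_id_eq_zero]
    -- Isomorphisms are detected on homology, which vanishes here; a zero endomorphism that is mono
    -- forces the identity to be zero.
    have : IsIso (0 : DerivedCategory.Q.obj X.cplx ⟶ DerivedCategory.Q.obj X.cplx) := by
      rw [DerivedCategory.isIso_iff]
      intro n
      have h1 : Limits.IsZero (derivedHomology (DerivedCategory.Q.obj X.cplx) n) :=
        ((ShortComplex.exact_iff_isZero_homology _).1 (hX n)).of_iso
          ((DerivedCategory.homologyFunctorFactors _ n).app X.cplx)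
      exact ⟨0, h1.eq_of_src _ _, h1.eq_of_src _ _⟩
    exact (cancel_mono (0 : DerivedCategory.Q.obj X.cplx ⟶ DerivedCategory.Q.obj X.cplx)).1
      (by simp)
  have hT : Pretriangulated.Triangle.mk (𝟙 (DerivedCategory.Q.obj X.cplx))
      (0 : DerivedCategory.Q.obj X.cplx ⟶ DerivedCategory.Q.obj X.cplx) 0 ∈
      Pretriangulated.distinguishedTriangles
        (C := DerivedCategory (ModuleCat.{0} (Alg R))) :=
    Pretriangulated.isomorphic_distinguished _
      (Pretriangulated.contractible_distinguished (DerivedCategory.Q.obj X.cplx)) _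
      (Pretriangulated.Triangle.isoMk _ _ (Iso.refl _) (Iso.refl _) hz.isoZero
        (hz.eq_of_src _ _) (hz.eq_of_src _ _) (hz.eq_of_src _ _))
  have := K0.mk_of_distTriang hT
  exact (left_eq_add.1 this)

/-- A family of `A`-linear maps that commutes with the differentials, as a morphism. -/
noncomputable def CPoint.homOfLin {d d' : DimSeq V} {p : CPoint R d} {q : CPoint R d'}
    (f : ∀ i, p.mod i →ₗ[Alg R] q.mod i)
    (hf : ∀ i x, f (i + 1) (p.diffLin i x) = q.diffLin i (f i x)) : p.complex ⟶ q.complex :=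
  CochainComplex.ofHom (fun i => ModuleCat.ofHom (f i)) (fun i => by
    rw [complex_d, complex_d]
    exact ModuleCat.hom_ext (LinearMap.ext fun x => (hf i x).symm))

theorem CPoint.mk_eq_add {d d' d'' : DimSeq V} {p : CPoint R d} {q : CPoint R d''}
    {r : CPoint R d'} (f : ∀ i, p.mod i →ₗ[Alg R] q.mod i)
    (hf : ∀ i x, f (i + 1) (p.diffLin i x) = q.diffLin i (f i x))
    (g : ∀ i, q.mod i →ₗ[Alg R] r.mod i)
    (hg : ∀ i x, g (i + 1) (q.diffLin i x) = r.diffLin i (g i x))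
    (hfi : ∀ i, Function.Injective (f i)) (hfg : ∀ i, Function.Exact (f i) (g i))
    (hgs : ∀ i, Function.Surjective (g i)) :
    K0.mk q.toBdd = K0.mk p.toBdd + K0.mk r.toBdd := by
  let S : ShortComplex (CochainComplex (ModuleCat.{0} (Alg R)) ℤ) :=
    ShortComplex.mk (homOfLin f hf) (homOfLin g hg) (by
      ext i x
      exact (hfg i).apply_apply_eq_zero x)
  have hS : S.ShortExact :=
    HomologicalComplex.shortExact_of_degreewise_shortExact S fun i => 
      ModuleCat.shortComplex_shortExact _ (hfg i) (hfi i) (hgs i)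
  exact K0.mk_of_distTriang (X := p.toBdd) (Y := q.toBdd) (Z := r.toBdd)
    (DerivedCategory.triangleOfSES_distinguished hS)

/-- The complex with zero arrows on `ℂ^d ⊕ ℂ^{d'}` whose differentials are given by maps from
the first summand to the second one. -/
noncomputable def glueZero (R : Relations V) {d d' d'' : DimSeq V} (s : CoordSum d d' d'')
    (u : ∀ (i : ℤ) (j : V), Sp (d i j) →ₗ[ℂ] Sp (d' (i + 1) j)) : CPoint R d'' where
  x := (zeroPoint R d'').x
  sat := (zeroPoint R d'').sat
  diff i j := (spEquiv (s (i + 1) j)).toLinearMap ∘ₗ LinearMap.inr ℂ _ _ ∘ₗ u i j ∘ₗ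
    LinearMap.fst ℂ _ _ ∘ₗ (spEquiv (s i j)).symm.toLinearMap
  comm i j k a := by
    simp [zeroPoint]
  sq_zero i j := by
    refine LinearMap.ext fun v => ?_
    simp

/-- The second summand is a subcomplex with the first as quotient, whatever `u` is. Taking u = 0
gives additivity of `dimClass`; taking u invertible gives an acyclic complex, hence the cancellation
of a sequence with its shift. -/
theorem mk_glueZero {d d' d'' : DimSeq V} (s : CoordSum d d' d'')
    (u : ∀ (i : ℤ) (j : V), Sp (d i j) →ₗ[ℂ] Sp (d' (i + 1) j)) :
    K0.mk (glueZero R s u).toBdd = dimClass R d + dimClass R d' := by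
  rw [add_comm]
  refine CPoint.mk_eq_add
    (fun i => repLin ((zeroPoint R d').sat i) ((zeroPoint R d'').sat i)
      (fun j => (spEquiv (s i j)).toLinearMap ∘ₗ LinearMap.inr ℂ _ _) (by simp [zeroPoint]))
    (fun i x => RepMod.ext fun j => ?_)
    (fun i => repLin ((zeroPoint R d'').sat i) ((zeroPoint R d).sat i)
      (fun j => LinearMap.fst ℂ _ _ ∘ₗ (spEquiv (s i j)).symm.toLinearMap) (by simp [zeroPoint]))
    (fun i x => RepMod.ext fun j => ?_) (fun i => ?_) (fun i => ?_) (fun i => ?_)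
  · change spEquiv (s (i + 1) j) (0, 0) =
      spEquiv (s (i + 1) j) (0, u i j ((spEquiv (s i j)).symm (spEquiv (s i j) (0, x.comp j))).1)
    simp
  · change ((spEquiv (s (i + 1) j)).symm (spEquiv (s (i + 1) j)
      (0, u i j ((spEquiv (s i j)).symm (x.comp j)).1))).1 = 0
    simp
  · intro x y h
    refine RepMod.ext fun j => ?_
    have h1 : spEquiv (s i j) (0, x.comp j) = spEquiv (s i j) (0, y.comp j) :=
      congrArg (fun v : RepMod R _ ((zeroPoint R d'').sat i) => v.comp j) h
    exact congrArg Prod.snd ((spEquiv (s i j)).injective h1)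
  · intro x
    constructor
    · intro h
      refine ⟨RepMod.of _ fun j => ((spEquiv (s i j)).symm (x.comp j)).2, RepMod.ext fun j => ?_⟩
      have h1 : ((spEquiv (s i j)).symm (x.comp j)).1 = 0 :=
        congrArg (fun v : RepMod R _ ((zeroPoint R d).sat i) => v.comp j) h
      change spEquiv (s i j) (0, ((spEquiv (s i j)).symm (x.comp j)).2) = x.comp j
      rw [← h1]
      exact (spEquiv (s i j)).apply_symm_apply _
    · rintro ⟨y, rfl⟩
      refine RepMod.ext fun j => ?_
      change ((spEquiv (s i j)).symm (spEquiv (s i j) (0, y.comp j))).1 = 0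
      simp
  · intro y
    refine ⟨RepMod.of _ fun j => spEquiv (s i j) (y.comp j, 0), RepMod.ext fun j => ?_⟩
    change ((spEquiv (s i j)).symm (spEquiv (s i j) (y.comp j, 0))).1 = y.comp j
    simp

theorem dimClass_add (d d' : DimSeq V) :
    dimClass R (d + d') = dimClass R d + dimClass R d' := by
  let s : CoordSum d d' (d + d') := fun _ _ => finSumFinEquiv
  have h : zeroPoint R (d + d') = glueZero R s (fun _ _ => 0) :=
    CPoint.ext rfl (by funext i j; simp [zeroPoint, glueZero]; rfl)
  rw [← mk_glueZero s (fun _ _ => 0), ← h]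
  rfl

theorem dimClass_add_shift (d d' : DimSeq V) (h : ∀ i, d' (i + 1) = d i) :
    dimClass R d + dimClass R d' = 0 := by
  let s : CoordSum d d' (d + d') := fun _ _ => finSumFinEquiv
  let u : ∀ (i : ℤ) (j : V), Sp (d i j) ≃ₗ[ℂ] Sp (d' (i + 1) j) := fun i j =>
    LinearEquiv.funCongrLeft ℂ ℂ (finCongr (by rw [h]))
  rw [← mk_glueZero s (fun i j => (u i j).toLinearMap)]
  let p := glueZero R s (fun i j => (u i j).toLinearMap)
  refine K0.mk_eq_zero ((CPoint.acyclic_iff p).2 fun i (x : p.mod (i + 1)) hx => ?_)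
  refine ⟨RepMod.of (p.sat i) fun j => spEquiv (s i j)
    ((u i j).symm ((spEquiv (s (i + 1) j)).symm (x.comp j)).2, 0),
    RepMod.ext (v := p.diffLin i _) (w := x) fun j => ?_⟩
  have h1 : spEquiv (s (i + 1 + 1) j)
      (0, u (i + 1) j ((spEquiv (s (i + 1) j)).symm (x.comp j)).1) = 0 :=
    congrArg (fun v : p.mod (i + 1 + 1) => v.comp j) hx
  have h2 : ((spEquiv (s (i + 1) j)).symm (x.comp j)).1 = 0 := by
    have := congrArg Prod.snd ((LinearEquiv.map_eq_zero_iff _).1 h1)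
    exact (LinearEquiv.map_eq_zero_iff _).1 this
  change spEquiv (s (i + 1) j) (0, u i j ((spEquiv (s i j)).symm (spEquiv (s i j)
    ((u i j).symm ((spEquiv (s (i + 1) j)).symm (x.comp j)).2, 0))).1) = x.comp j
  rw [LinearEquiv.symm_apply_apply, LinearEquiv.apply_symm_apply, ← h2]
  exact (spEquiv (s (i + 1) j)).apply_symm_apply _

end

/-! ### Contractible complexes built from matched copies of representations -/

section Contraction

variable {V : Type} [Quiver.{0} V] [Fintype V] [DecidableEq V] {R : Relations V}

/-- A splitting of the positions `T` of the summands of a graded module into sources `L` and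
targets, matched by the reflections `m ↦ s - m`. -/
structure IsContraction (T L : ℤ → V → Finset ℤ) (s : ℤ → V → ℤ) : Prop where
  subset : ∀ i l, L i l ⊆ T i l
  target_mem : ∀ i l, ∀ m ∈ L i l, s i l - m ∈ T (i + 1) l
  target_not_mem : ∀ i l, ∀ m ∈ L i l, s i l - m ∉ L (i + 1) l
  source_mem : ∀ i l, ∀ m ∈ T (i + 1) l, m ∉ L (i + 1) l → s i l - m ∈ L i l

variable {n : V → V → ℕ} (ρ : ∀ l, QRep fun k => Sp (n l k)) {T L : ℤ → V → Finset ℤ}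
  {s : ℤ → V → ℤ}

/-- The space at the vertex `k` of a direct sum of copies, indexed by `T`, of representations with
dimension vectors `n l`. -/
abbrev SlotSpace (n : V → V → ℕ) (T : V → Finset ℤ) (k : V) : Type :=
  ∀ l, T l → Sp (n l k)

/-- The direct sum of copies, indexed by `T`, of the representations `ρ l`. -/
def slotRep (T : V → Finset ℤ) : QRep (SlotSpace n T) := fun j k a =>
  LinearMap.pi fun l => LinearMap.pi fun t =>
    ρ l j k a ∘ₗ LinearMap.proj t ∘ₗ LinearMap.proj l

theorem slotRep_apply (T : V → Finset ℤ) {j k : V} (a : j ⟶ k) (w : SlotSpace n T j) (l : V)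
    (t : T l) : slotRep ρ T j k a w l t = ρ l j k a (w l t) := rfl

theorem evalPath_slotRep (T : V → Finset ℤ) {j k : V} (p : Quiver.Path j k)
    (w : SlotSpace n T j) (l : V) (t : T l) :
    evalPath (slotRep ρ T) p w l t = evalPath (ρ l) p (w l t) := by
  induction p with
  | nil => rfl
  | cons p a ih => exact congrArg (ρ l _ _ a) ih

variable {ρ}

theorem satisfies_slotRep (hρ : ∀ l, Satisfies R (ρ l)) (T : V → Finset ℤ) :
    Satisfies R (slotRep ρ T) := by
  intro j k r hr
  refine LinearMap.ext fun w => funext fun l => funext fun t => ?_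
  have h := LinearMap.congr_fun (hρ l j k r hr) (w l t)
  simp only [Finsupp.sum, LinearMap.sum_apply, LinearMap.smul_apply, LinearMap.zero_apply]
    at h ⊢
  rw [Finset.sum_apply, Finset.sum_apply]
  simp only [Pi.smul_apply, evalPath_slotRep]
  exact h

/-- The differential that maps the summand in position `m ∈ L i l` to that in position
`s i l - m`. -/
def slotDiff (n : V → V → ℕ) (h : IsContraction T L s) (i : ℤ) (k : V) :
    SlotSpace n (T i) k →ₗ[ℂ] SlotSpace n (T (i + 1)) k where
  toFun w l t := if ht : s i l - t ∈ L i l then w l ⟨_, h.subset i l ht⟩ else 0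
  map_add' v w := by
    funext l t
    by_cases ht : s i l - t ∈ L i l <;> simp [ht]
  map_smul' c w := by
    funext l t
    by_cases ht : s i l - t ∈ L i l <;> simp [ht]

theorem slotDiff_of_mem (h : IsContraction T L s) {i : ℤ} {k : V} (w : SlotSpace n (T i) k)
    {l : V} {t : T (i + 1) l} (ht : s i l - t ∈ L i l) :
    slotDiff n h i k w l t = w l ⟨_, h.subset i l ht⟩ := dif_pos ht

theorem slotDiff_of_not_mem (h : IsContraction T L s) {i : ℤ} {k : V} (w : SlotSpace n (T i) k)
    {l : V} {t : T (i + 1) l} (ht : s i l - t ∉ L i l) :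
    slotDiff n h i k w l t = 0 := dif_neg ht

theorem slotDiff_slotDiff (h : IsContraction T L s) (i : ℤ) (k : V) (w : SlotSpace n (T i) k) :
    slotDiff n h (i + 1) k (slotDiff n h i k w) = 0 := by
  funext l t
  by_cases ht : s (i + 1) l - t ∈ L (i + 1) l
  · rw [slotDiff_of_mem h _ ht, slotDiff_of_not_mem]
    · rfl
    · intro h2
      have := h.target_not_mem i l _ h2
      rw [sub_sub_cancel] at this
      exact this ht
  · exact slotDiff_of_not_mem h _ ht

theorem slotDiff_slotRep (h : IsContraction T L s) (i : ℤ) {j k : V} (a : j ⟶ k)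
    (w : SlotSpace n (T i) j) :
    slotDiff n h i k (slotRep ρ (T i) j k a w) =
      slotRep ρ (T (i + 1)) j k a (slotDiff n h i j w) := by
  funext l t
  rw [slotRep_apply]
  by_cases ht : s i l - t ∈ L i l
  · rw [slotDiff_of_mem h _ ht, slotDiff_of_mem h _ ht, slotRep_apply]
  · rw [slotDiff_of_not_mem h _ ht, slotDiff_of_not_mem h _ ht, map_zero]

/-- A cycle vanishes at all sources, because the differential copies each source entry to its own
target. It is therefore supported on targets and can be pulled back to the matching sources. -/
theorem exists_slotDiff_eq (h : IsContraction T L s) (i : ℤ) (k : V)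
    (w : SlotSpace n (T (i + 1)) k) (hw : slotDiff n h (i + 1) k w = 0) :
    ∃ v, slotDiff n h i k v = w := by
  classical
  refine ⟨fun l m => if hm : m.1 ∈ L i l then w l ⟨_, h.target_mem i l _ hm⟩ else 0,
    funext fun l => funext fun t => ?_⟩
  by_cases ht : s i l - t ∈ L i l
  · rw [slotDiff_of_mem h _ ht, dif_pos ht]
    congr 1
    exact Subtype.ext (sub_sub_cancel _ _)
  · rw [slotDiff_of_not_mem h _ ht]
    have htL : t.1 ∈ L (i + 1) l := by
      by_contra hL
      exact ht (h.source_mem i l _ t.2 hL)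
    have h0 := congrFun (congrFun hw l) ⟨_, h.target_mem (i + 1) l _ htL⟩
    rw [slotDiff_of_mem h _ (by simpa using htL)] at h0
    rw [Pi.zero_apply, Pi.zero_apply] at h0
    rw [← h0]
    congr 1
    exact Subtype.ext (sub_sub_cancel _ _)

variable {d : DimSeq V}

/-- Coordinates of a space `ℂ^m` that is identified with a `SlotSpace`. -/
def slotEquiv {T : V → Finset ℤ} {m : ℕ} {k : V} (lab : Fin m ≃ Σ l, T l × Fin (n l k)) :
    Sp m ≃ₗ[ℂ] SlotSpace n T k where
  toFun v l t y := v (lab.symm ⟨l, t, y⟩)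
  invFun w r := w (lab r).1 (lab r).2.1 (lab r).2.2
  left_inv v := funext fun r => congrArg v (lab.symm_apply_apply r)
  right_inv w := by
    funext l t y
    exact congrArg (fun u : Σ l, T l × Fin (n l k) => w u.1 u.2.1 u.2.2)
      (lab.apply_symm_apply ⟨l, t, y⟩)
  map_add' _ _ := rfl
  map_smul' _ _ := rfl

/-- The contractible complex with terms the direct sums of copies, indexed by `T i`, of the
representations `ρ l`. -/
def contractionPoint (hρ : ∀ l, Satisfies R (ρ l)) (h : IsContraction T L s)
    (lab : ∀ i k, Fin (d i k) ≃ Σ l, T i l × Fin (n l k)) : CPoint R d where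
  x i j k a := (slotEquiv (lab i k)).symm.toLinearMap ∘ₗ slotRep ρ (T i) j k a ∘ₗ
    (slotEquiv (lab i j)).toLinearMap
  sat i := CPoint.satisfies_conj (satisfies_slotRep hρ (T i))
    (fun k => (slotEquiv (lab i k)).symm) (fun j k a => by ext; simp)
  diff i k := (slotEquiv (lab (i + 1) k)).symm.toLinearMap ∘ₗ slotDiff n h i k ∘ₗ
    (slotEquiv (lab i k)).toLinearMap
  comm i j k a := by
    refine LinearMap.ext fun v => ?_
    simp [slotDiff_slotRep]
  sq_zero i k := by
    refine LinearMap.ext fun v => ?_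
    simp [slotDiff_slotDiff]

theorem acyclic_contractionPoint (hρ : ∀ l, Satisfies R (ρ l)) (h : IsContraction T L s)
    (lab : ∀ i k, Fin (d i k) ≃ Σ l, T i l × Fin (n l k)) :
    (contractionPoint hρ h lab).complex.Acyclic := by
  let p := contractionPoint hρ h lab
  refine (CPoint.acyclic_iff p).2 fun i (x : p.mod (i + 1)) hx => ?_
  have key : ∀ k, ∃ v, slotDiff n h i k v = slotEquiv (lab (i + 1) k) (x.comp k) := fun k =>
    exists_slotDiff_eq h i k _ ((LinearEquiv.map_eq_zero_iff (slotEquiv (lab (i + 1 + 1) k)).symm).1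
      (congrArg (fun v : p.mod (i + 1 + 1) => v.comp k) hx))
  choose v hv using key
  refine ⟨RepMod.of (p.sat i) fun k => (slotEquiv (lab i k)).symm (v k),
    RepMod.ext (v := p.diffLin i _) (w := x) fun k => ?_⟩
  change (slotEquiv (lab (i + 1) k)).symm (slotDiff n h i k (slotEquiv (lab i k)
    ((slotEquiv (lab i k)).symm (v k)))) = x.comp k
  rw [LinearEquiv.apply_symm_apply, hv, LinearEquiv.symm_apply_apply]

theorem nonempty_mod_contractionPoint (hρ : ∀ l, Satisfies R (ρ l)) (h : IsContraction T L s)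
    (lab : ∀ i k, Fin (d i k) ≃ Σ l, T i l × Fin (n l k)) (i : ℤ) :
    Nonempty ((contractionPoint hρ h lab).mod i ≃ₗ[Alg R]
      ∀ l, T i l → RepMod R (ρ l) (hρ l)) := by
  let p := contractionPoint hρ h lab
  let e₁ : RepMod R (slotRep ρ (T i)) (satisfies_slotRep hρ (T i)) ≃ₗ[Alg R] p.mod i :=
    repEquiv (satisfies_slotRep hρ (T i)) (p.sat i)
      (fun k => (slotEquiv (lab i k)).symm) (fun j k a => by ext; simp [p, contractionPoint])
  let e₂ : RepMod R (slotRep ρ (T i)) (satisfies_slotRep hρ (T i)) →ₗ[Alg R]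
      ∀ l, T i l → RepMod R (ρ l) (hρ l) :=
    LinearMap.pi fun l => LinearMap.pi fun t =>
      repLin (satisfies_slotRep hρ (T i)) (hρ l)
        (fun k => LinearMap.proj t ∘ₗ LinearMap.proj l) (fun _ _ _ => rfl)
  refine ⟨e₁.symm.trans (LinearEquiv.ofBijective e₂ ⟨fun v w hvw => ?_, fun w => ?_⟩)⟩
  · exact RepMod.ext fun k => funext fun l => funext fun t =>
      congrFun (congrFun (congrFun hvw l) t) k
  · exact ⟨RepMod.of _ fun k l t => (w l t).comp k, rfl⟩

end Contraction

/-! ### The equation b i + b (i - 1) = f i -/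

section AlternatingSum

/-- To the right of the support b is zero, and the relation carries the zero downwards. This is the
uniqueness of the virtual cone between two sequences. -/
theorem eq_zero_of_add_pred_eq_zero {b : ℤ → ℤ} (hb : b.HasFiniteSupport)
    (h : ∀ i, b i + b (i - 1) = 0) : b = 0 := by
  obtain ⟨n, hn⟩ := hb.bddAbove
  have key : ∀ m : ℕ, ∀ i : ℤ, n < i + m → b i = 0 := by
    intro m
    induction m with
    | zero =>
      intro i hi
      by_contra h0
      have := hn (Function.mem_support.2 h0)
      simp only [Nat.cast_zero] at hi
      omega
    | succ m ih =>
      intro i hi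
      have h1 := h (i + 1)
      rw [ih (i + 1) (by push_cast at hi; omega), zero_add, add_sub_cancel_right] at h1
      exact h1
  funext i
  exact key (n + 1 - i).toNat i (by omega)

theorem exists_add_pred_eq {f : ℤ → ℤ} (hf : f.HasFiniteSupport) (h0 : altSum f = 0) :
    ∃ b : ℤ → ℤ, b.HasFiniteSupport ∧ ∀ i, b i + b (i - 1) = f i := by
  let S : Finset ℤ := Set.Finite.toFinset hf
  have hS : ∀ i, i ∉ S → f i = 0 := fun i hi => by
    by_contra h
    exact hi ((Set.Finite.mem_toFinset hf).2 h)
  -- The solution is (-1)^i times the partial alternating sum up to i: zero to the left of the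
  -- support, and zero to the right because the full alternating sum vanishes.
  let g : ℤ → ℤ := fun i => ∑ m ∈ S, if m ≤ i then (m.negOnePow : ℤ) * f m else 0
  obtain ⟨n, hn⟩ := S.bddAbove
  obtain ⟨n', hn'⟩ := S.bddBelow
  refine ⟨fun i => (i.negOnePow : ℤ) * g i, ?_, fun i => ?_⟩
  · refine Set.Finite.subset (Set.finite_Icc n' n) fun i hi => ?_
    by_contra hI
    refine hi ?_
    suffices g i = 0 by simp [this]
    rcases lt_or_ge i n' with h1 | h1
    · refine Finset.sum_eq_zero fun m hm => if_neg ?_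
      have := hn' hm
      omega
    · have h2 : n < i := by
        by_contra h2
        exact hI ⟨h1, by omega⟩
      rw [altSum, finsum_eq_sum_of_support_subset (s := S)] at h0
      · rw [← h0]
        refine Finset.sum_congr rfl fun m hm => if_pos ?_
        have := hn hm
        omega
      · intro m hm
        by_contra h3
        exact hm (by simp [hS m h3])
  · have h1 : g i = g (i - 1) + (i.negOnePow : ℤ) * f i := by
      have h2 : ∀ m ∈ S, (if m ≤ i then (m.negOnePow : ℤ) * f m else 0) =
          (if m ≤ i - 1 then (m.negOnePow : ℤ) * f m else 0) +
            if m = i then (m.negOnePow : ℤ) * f m else 0 := by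
        intro m _
        rcases lt_trichotomy m i with h | h | h
        · rw [if_pos h.le, if_pos (by omega), if_neg h.ne, add_zero]
        · rw [if_pos h.le, if_neg (by omega), if_pos h, zero_add]
        · rw [if_neg (by omega), if_neg (by omega), if_neg h.ne', add_zero]
      rw [show g i = _ from Finset.sum_congr rfl h2, Finset.sum_add_distrib]
      congr 1
      rw [Finset.sum_ite_eq']
      split_ifs with h
      · rfl
      · rw [hS i h, mul_zero]
    have h2 : (i.negOnePow : ℤ) * i.negOnePow = 1 := by
      rw [← Units.val_mul, ← Int.negOnePow_add]
      simp [← two_mul]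
    have h3 : ((i - 1).negOnePow : ℤ) = -i.negOnePow := by
      rw [Int.negOnePow_sub]
      simp
    change (i.negOnePow : ℤ) * g i + ((i - 1).negOnePow : ℤ) * g (i - 1) = f i
    rw [h1, h3]
    linear_combination (f i) * h2

end AlternatingSum

/-! ### Cone sequences and the order -/

section Cones

variable {V : Type} [Quiver.{0} V] [Fintype V] [DecidableEq V] {R : Relations V}

/-- The sequence `a`, shifted by one place. -/
noncomputable def shiftSeq (a : DimSeq V) : DimSeq V := a.equivMapDomain (Equiv.addRight 1)

theorem shiftSeq_apply (a : DimSeq V) (i : ℤ) : shiftSeq a i = a (i - 1) := by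
  simp [shiftSeq, Finsupp.equivMapDomain_apply, sub_eq_add_neg]

/-- The dimension sequence of the cone of an identity map. -/
noncomputable def coneSeq (a : DimSeq V) : DimSeq V := a + shiftSeq a

theorem coneSeq_apply (a : DimSeq V) (i : ℤ) (j : V) : coneSeq a i j = a i j + a (i - 1) j := by
  rw [coneSeq, Finsupp.add_apply, Pi.add_apply, shiftSeq_apply]

theorem coneSeq_add (a b : DimSeq V) : coneSeq (a + b) = coneSeq a + coneSeq b := by
  ext i j
  simp only [coneSeq_apply, Finsupp.add_apply, Pi.add_apply]
  omega

section

variable [Module.Finite ℂ (Alg R)]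

theorem dimOf_apply_eq_vtxDim (e : DimSeq V) (i : ℤ) (k : V) :
    dimOf R e i k = vtxDim R (ProjSum R (e i)) k := dimVec_eq_vtxDim _ _ _

theorem dimOf_apply (e : DimSeq V) (i : ℤ) (k : V) :
    dimOf R e i k = ∑ j, e i j * vtxDim R (Proj R j) k := by
  rw [dimOf_apply_eq_vtxDim, vtxDim_projSum]

theorem dimOf_add (e f : DimSeq V) : dimOf R (e + f) = dimOf R e + dimOf R f := by
  ext i k
  simp only [Finsupp.add_apply, Pi.add_apply, dimOf_apply, add_mul, Finset.sum_add_distrib]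

/-- A sequence and its shift have opposite classes, so adding a cone stays in the same fibre over
K_0. -/
theorem dimClass_dimOf_add_coneSeq (e a : DimSeq V) :
    dimClass R (dimOf R (e + coneSeq a)) = dimClass R (dimOf R e) := by
  rw [dimOf_add, dimClass_add, coneSeq, dimOf_add, dimClass_add, dimClass_add_shift, add_zero]
  intro i
  ext k
  rw [dimOf_apply, dimOf_apply, shiftSeq_apply, add_sub_cancel_right]

theorem hasFiniteSupport_apply (e : DimSeq V) (j : V) :
    Function.HasFiniteSupport fun i => (e i j : ℤ) :=
  Set.Finite.subset e.support.finite_toSet fun i hi => Finsupp.mem_support_iff.2 fun h =>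
    hi (by simp [h])

/-- The class fixes the alternating sums of the dimension vectors. These are the Cartan matrix
applied to the alternating sums of the multiplicities, and that matrix is injective. -/
theorem altSum_apply_eq (hR : R.Admissible) (hgl : FiniteGlobalDimension (Alg R))
    {e e' : DimSeq V} (h : dimClass R (dimOf R e) = dimClass R (dimOf R e')) (j : V) :
    altSum (fun i => (e i j : ℤ)) = altSum (fun i => (e' i j : ℤ)) := by
  have key : ∀ (e : DimSeq V) (k : V), altSum (fun i => (dimOf R e i k : ℤ)) =
      ∑ j, altSum (fun i => (e i j : ℤ)) * (vtxDim R (Proj R j) k : ℤ) := by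
    intro e k
    simp only [altSum, finsum_mul]
    rw [← finsum_sum_comm]
    · refine finsum_congr fun i => ?_
      rw [dimOf_apply, Nat.cast_sum, Finset.mul_sum]
      simp [mul_assoc]
    · intro j _
      refine Set.Finite.subset (hasFiniteSupport_apply e j) fun i hi h0 => hi ?_
      simp only at h0
      simp [h0]
  have hz : (fun j => altSum (fun i => (e i j : ℤ)) - altSum (fun i => (e' i j : ℤ))) = 0 := by
    refine cartan_injective hR hgl fun k => ?_
    simp only [sub_mul, Finset.sum_sub_distrib]
    rw [← key, ← key, altSum_eq_of_dimClass_eq h, sub_self]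
  exact sub_eq_zero.1 (congrFun hz j)

/-- Two projective dimension sequences over the same class differ by a virtual cone. -/
theorem exists_virtual_coneSeq (hR : R.Admissible) (hgl : FiniteGlobalDimension (Alg R))
    {e e' : DimSeq V} (h : dimClass R (dimOf R e) = dimClass R (dimOf R e')) :
    ∃ b : ℤ → V → ℤ, (∀ j, Function.HasFiniteSupport fun i => b i j) ∧
      ∀ i j, (e' i j : ℤ) = e i j + b i j + b (i - 1) j := by
  have key : ∀ j, ∃ b : ℤ → ℤ, b.HasFiniteSupport ∧
      ∀ i, b i + b (i - 1) = (e' i j : ℤ) + -(e i j : ℤ) := by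
    intro j
    have hs : Function.HasFiniteSupport fun i => -(e i j : ℤ) :=
      Set.Finite.subset (hasFiniteSupport_apply e j) fun i hi h0 => hi (by simpa using h0)
    refine exists_add_pred_eq ((hasFiniteSupport_apply e' j).fun_add hs) ?_
    have h1 := altSum_add (hasFiniteSupport_apply e j) hs
    rw [altSum_add (hasFiniteSupport_apply e' j) hs, ← altSum_apply_eq hR hgl h j, ← h1]
    simp [altSum]
  choose b hb hb' using key
  refine ⟨fun i j => b j i, hb, fun i j => ?_⟩
  have := hb' j i
  change (e' i j : ℤ) = e i j + b j i + b j (i - 1)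
  omega

/-- In an acyclic complex of projectives the cycles are projective and the dimension vector of a
term is the sum of those of the cycles in its own degree and in the next one. Multiplicities can be
compared because dimension vectors determine them. -/
theorem PLE.exists_coneSeq (hR : R.Admissible) (hgl : FiniteGlobalDimension (Alg R))
    {e₁ e₂ : DimSeq V} (h : PLE R e₁ e₂) : ∃ a : DimSeq V, e₂ = e₁ + coneSeq a := by
  obtain ⟨hle, p, hp⟩ := h
  have hex := (CPoint.acyclic_iff p.1).1 hp
  have hproj : ∀ i, Module.Projective (Alg R) (p.1.lin.X i) := fun i =>
    have ⟨φ⟩ := p.2 i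
    Module.Projective.of_equiv φ.symm
  have := hex.projective_cycles p.1.bounded_lin hproj
  have := p.1.lin.finite_ker p.1.finite_lin
  have hz := fun i => exists_equiv_projSum hR (LinearMap.ker (p.1.lin.d i))
  choose z hz using hz
  have hsum : ∀ i, (e₂ - e₁) i = z i + z (i + 1) := by
    intro i
    refine eq_of_vtxDim_projSum_eq hR hgl fun k => ?_
    obtain ⟨φ⟩ := p.2 i
    obtain ⟨ψ⟩ := hz i
    obtain ⟨χ⟩ := hz (i + 1)
    rw [← vtxDim_congr (N := ProjSum R ((e₂ - e₁) i)) φ]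
    refine (hex.vtxDim_eq p.1.finite_lin i k).trans ?_
    rw [vtxDim_congr (N := ProjSum R (z i)) ψ,
      vtxDim_congr (N := ProjSum R (z (i + 1))) χ, vtxDim_projSum, vtxDim_projSum, vtxDim_projSum,
      ← Finset.sum_add_distrib]
    simp only [Pi.add_apply, add_mul]
  have hfin : (Function.support fun i => z (i + 1)).Finite :=
    (e₂ - e₁).support.finite_toSet.subset fun i hi => Finsupp.mem_support_iff.2 fun h0 => hi (by
      have := hsum i
      rw [h0] at this
      exact (add_eq_zero.1 this.symm).2)
  -- With z i the multiplicities of the cycles in degree i, the term has z i + z (i + 1), which is a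
  -- i + a (i - 1) for a i = z (i + 1).
  refine ⟨Finsupp.ofSupportFinite _ hfin, ?_⟩
  ext i j
  have h1 := congrFun (hsum i) j
  have h2 : e₁ i j ≤ e₂ i j := hle i j
  rw [Finsupp.add_apply, Pi.add_apply, coneSeq_apply]
  simp only [Finsupp.ofSupportFinite_coe, sub_add_cancel]
  simp only [Finsupp.tsub_apply, Pi.sub_apply, Pi.add_apply] at h1
  omega

end

end Cones

/-! ### Strict associativity of sums in labelled coordinates -/

section Slots

variable {V : Type} [Quiver.{0} V] [Fintype V] [DecidableEq V] {R : Relations V}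
variable {n : V → V → ℕ}

/-- Labels of the coordinates of a direct sum of copies indexed by `T`. -/
abbrev Slot (n : V → V → ℕ) (T : V → Finset ℤ) (k : V) : Type := Σ l, T l × Fin (n l k)

/-- The inclusion of labels that belongs to an inclusion of index sets. -/
def slotIncl {T T' : V → Finset ℤ} (h : ∀ l, T l ⊆ T' l) (k : V) (u : Slot n T k) :
    Slot n T' k := ⟨u.1, ⟨u.2.1.1, h _ u.2.1.2⟩, u.2.2⟩

/-- The inclusion of the labels in a complement. -/
def slotInclCompl (T T' : V → Finset ℤ) (k : V) (u : Slot n (fun l => T' l \ T l) k) :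
    Slot n T' k := slotIncl (fun _ => Finset.sdiff_subset) k u

theorem slotIncl_injective {T T' : V → Finset ℤ} (h : ∀ l, T l ⊆ T' l) (k : V) :
    Function.Injective (slotIncl (n := n) h k) := by
  rintro ⟨l, ⟨t, ht⟩, y⟩ ⟨l', ⟨t', ht'⟩, y'⟩ e
  simp only [slotIncl, Sigma.mk.injEq] at e
  obtain ⟨rfl, e⟩ := e
  simpa using e

/-- The labels of `T'` are those of `T` together with those of `T' \ T`. -/
noncomputable def slotSum {T T' : V → Finset ℤ} (h : ∀ l, T l ⊆ T' l) (k : V) :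
    Slot n T k ⊕ Slot n (fun l => T' l \ T l) k ≃ Slot n T' k :=
  Equiv.ofBijective (Sum.elim (slotIncl h k) (slotInclCompl T T' k)) (by
    constructor
    · rintro (u | u) (v | v) e
      · exact congrArg _ (slotIncl_injective h k e)
      · obtain ⟨l, ⟨t, ht⟩, y⟩ := u
        obtain ⟨l', ⟨t', ht'⟩, y'⟩ := v
        simp only [Sum.elim_inl, Sum.elim_inr, slotInclCompl, slotIncl, Sigma.mk.injEq] at e
        obtain ⟨rfl, e⟩ := e
        simp only [heq_eq_eq, Prod.mk.injEq, Subtype.mk.injEq] at e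
        exact absurd (e.1 ▸ ht) (Finset.mem_sdiff.1 ht').2
      · obtain ⟨l, ⟨t, ht⟩, y⟩ := u
        obtain ⟨l', ⟨t', ht'⟩, y'⟩ := v
        simp only [Sum.elim_inl, Sum.elim_inr, slotInclCompl, slotIncl, Sigma.mk.injEq] at e
        obtain ⟨rfl, e⟩ := e
        simp only [heq_eq_eq, Prod.mk.injEq, Subtype.mk.injEq] at e
        exact absurd (e.1 ▸ ht') (Finset.mem_sdiff.1 ht).2
      · exact congrArg _ (slotIncl_injective (fun _ => Finset.sdiff_subset) k e)
    · rintro ⟨l, ⟨t, ht⟩, y⟩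
      by_cases h' : t ∈ T l
      · exact ⟨Sum.inl ⟨l, ⟨t, h'⟩, y⟩, rfl⟩
      · exact ⟨Sum.inr ⟨l, ⟨t, Finset.mem_sdiff.2 ⟨ht, h'⟩⟩, y⟩, rfl⟩)

variable {T₁ T₂ T₃ : ℤ → V → Finset ℤ} {d₁ d₂ d₃ d₁₂ d₂₃ d₁₃ : DimSeq V}

/-- Labellings of all coordinates. -/
abbrev Labelling (n : V → V → ℕ) (T : ℤ → V → Finset ℤ) (d : DimSeq V) : Type :=
  ∀ i k, Fin (d i k) ≃ Slot n (T i) k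

/-- The identification of coordinates that is given by labellings. -/
noncomputable def slotCoords (h : ∀ i l, T₁ i l ⊆ T₂ i l) (g₁ : Labelling n T₁ d₁)
    (g₁₂ : Labelling n (fun i l => T₂ i l \ T₁ i l) d₁₂) (g₂ : Labelling n T₂ d₂) :
    CoordSum d₁ d₁₂ d₂ := fun i k =>
  ((g₁ i k).sumCongr (g₁₂ i k)).trans ((slotSum (h i) k).trans (g₂ i k).symm)

theorem slotCoords_inl (h : ∀ i l, T₁ i l ⊆ T₂ i l) (g₁ : Labelling n T₁ d₁)
    (g₁₂ : Labelling n (fun i l => T₂ i l \ T₁ i l) d₁₂) (g₂ : Labelling n T₂ d₂) (i : ℤ) (k : V)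
    (c : Fin (d₁ i k)) : slotCoords h g₁ g₁₂ g₂ i k (Sum.inl c) =
      (g₂ i k).symm (slotIncl (h i) k (g₁ i k c)) := rfl

theorem slotCoords_inr (h : ∀ i l, T₁ i l ⊆ T₂ i l) (g₁ : Labelling n T₁ d₁)
    (g₁₂ : Labelling n (fun i l => T₂ i l \ T₁ i l) d₁₂) (g₂ : Labelling n T₂ d₂) (i : ℤ) (k : V)
    (u : Slot n (fun l => T₂ i l \ T₁ i l) k) :
    slotCoords h g₁ g₁₂ g₂ i k (Sum.inr ((g₁₂ i k).symm u)) =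
      (g₂ i k).symm (slotInclCompl (T₁ i) (T₂ i) k u) := by
  change (g₂ i k).symm (slotInclCompl _ _ k (g₁₂ i k ((g₁₂ i k).symm u))) = _
  rw [Equiv.apply_symm_apply]

theorem slotCoords_trans (h : ∀ i l, T₁ i l ⊆ T₂ i l) (h' : ∀ i l, T₂ i l ⊆ T₃ i l)
    (h'' : ∀ i l, T₁ i l ⊆ T₃ i l) (g₁ : Labelling n T₁ d₁) (g₂ : Labelling n T₂ d₂)
    (g₃ : Labelling n T₃ d₃) (g₁₂ : Labelling n (fun i l => T₂ i l \ T₁ i l) d₁₂)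
    (g₂₃ : Labelling n (fun i l => T₃ i l \ T₂ i l) d₂₃)
    (g₁₃ : Labelling n (fun i l => T₃ i l \ T₁ i l) d₁₃) (i : ℤ) (k : V) (c : Fin (d₁ i k)) :
    slotCoords h' g₂ g₂₃ g₃ i k (Sum.inl (slotCoords h g₁ g₁₂ g₂ i k (Sum.inl c))) =
      slotCoords h'' g₁ g₁₃ g₃ i k (Sum.inl c) := by
  rw [slotCoords_inl, slotCoords_inl, slotCoords_inl, Equiv.apply_symm_apply]
  rfl

theorem blockSum_apply_inl {m n N m' n' N' : ℕ} (s : Fin m ⊕ Fin n ≃ Fin N)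
    (s' : Fin m' ⊕ Fin n' ≃ Fin N') (u : Sp m →ₗ[ℂ] Sp m') (v : Sp n →ₗ[ℂ] Sp n') (f : Sp N)
    (r : Fin m') : blockSum s s' u v f (s' (Sum.inl r)) = u (fun c => f (s (Sum.inl c))) r := by
  change Sum.elim _ _ (s'.symm (s' (Sum.inl r))) = _
  rw [Equiv.symm_apply_apply]
  rfl

theorem blockSum_apply_inr {m n N m' n' N' : ℕ} (s : Fin m ⊕ Fin n ≃ Fin N)
    (s' : Fin m' ⊕ Fin n' ≃ Fin N') (u : Sp m →ₗ[ℂ] Sp m') (v : Sp n →ₗ[ℂ] Sp n') (f : Sp N)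
    (r : Fin n') : blockSum s s' u v f (s' (Sum.inr r)) = v (fun c => f (s (Sum.inr c))) r := by
  change Sum.elim _ _ (s'.symm (s' (Sum.inr r))) = _
  rw [Equiv.symm_apply_apply]
  rfl

section Points

variable {ρ : ∀ l, QRep fun k => Sp (n l k)} {T L : ℤ → V → Finset ℤ} {s : ℤ → V → ℤ}
  {d : DimSeq V}

theorem contractionPoint_x_apply (hρ : ∀ l, Satisfies R (ρ l)) (h : IsContraction T L s)
    (g : Labelling n T d) (i : ℤ) {j k : V} (a : j ⟶ k) (v : Sp (d i j)) (l : V) (t : T i l)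
    (y : Fin (n l k)) : (contractionPoint hρ h g).x i j k a v ((g i k).symm ⟨l, t, y⟩) =
      ρ l j k a (fun y' => v ((g i j).symm ⟨l, t, y'⟩)) y := by
  change slotEquiv (g i k) ((slotEquiv (g i k)).symm _) l t y = _
  rw [LinearEquiv.apply_symm_apply]
  rfl

theorem contractionPoint_diff_of_mem (hρ : ∀ l, Satisfies R (ρ l)) (h : IsContraction T L s)
    (g : Labelling n T d) (i : ℤ) (k : V) (v : Sp (d i k)) (l : V) (t : T (i + 1) l)
    (y : Fin (n l k)) (ht : s i l - t ∈ L i l) :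
    (contractionPoint hρ h g).diff i k v ((g (i + 1) k).symm ⟨l, t, y⟩) =
      v ((g i k).symm ⟨l, ⟨_, h.subset i l ht⟩, y⟩) := by
  change slotEquiv (g (i + 1) k) ((slotEquiv (g (i + 1) k)).symm
    (slotDiff n h i k (slotEquiv (g i k) v))) l t y = _
  rw [LinearEquiv.apply_symm_apply, slotDiff_of_mem h _ ht]
  rfl

theorem contractionPoint_diff_of_not_mem (hρ : ∀ l, Satisfies R (ρ l)) (h : IsContraction T L s)
    (g : Labelling n T d) (i : ℤ) (k : V) (v : Sp (d i k)) (l : V) (t : T (i + 1) l)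
    (y : Fin (n l k)) (ht : s i l - t ∉ L i l) :
    (contractionPoint hρ h g).diff i k v ((g (i + 1) k).symm ⟨l, t, y⟩) = 0 := by
  change slotEquiv (g (i + 1) k) ((slotEquiv (g (i + 1) k)).symm
    (slotDiff n h i k (slotEquiv (g i k) v))) l t y = _
  rw [LinearEquiv.apply_symm_apply, slotDiff_of_not_mem h _ ht]
  rfl

end Points

variable {ρ : ∀ l, QRep fun k => Sp (n l k)} {L₁₂ L₂₃ L₁₃ : ℤ → V → Finset ℤ} {s : ℤ → V → ℤ}

/-- Every coordinate belongs to one of the three summands. -/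
theorem slotCoords_cases (h' : ∀ i l, T₂ i l ⊆ T₃ i l)
    (h'' : ∀ i l, T₁ i l ⊆ T₃ i l) (g₁ : Labelling n T₁ d₁)
    (g₃ : Labelling n T₃ d₃) (g₁₃ : Labelling n (fun i l => T₃ i l \ T₁ i l) d₁₃) (i : ℤ) (k : V)
    (P : Fin (d₃ i k) → Prop)
    (H₁ : ∀ c, P (slotCoords h'' g₁ g₁₃ g₃ i k (Sum.inl c)))
    (H₂ : ∀ l t y, ∀ ht : t ∈ T₂ i l, t ∉ T₁ i l → P ((g₃ i k).symm ⟨l, ⟨t, h' i l ht⟩, y⟩))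
    (H₃ : ∀ l t y, ∀ ht : t ∈ T₃ i l, t ∉ T₂ i l → P ((g₃ i k).symm ⟨l, ⟨t, ht⟩, y⟩))
    (r : Fin (d₃ i k)) : P r := by
  obtain ⟨⟨l, ⟨t, ht⟩, y⟩, rfl⟩ := (g₃ i k).symm.surjective r
  by_cases h2 : t ∈ T₂ i l
  · by_cases h1 : t ∈ T₁ i l
    · have := H₁ ((g₁ i k).symm ⟨l, ⟨t, h1⟩, y⟩)
      rw [slotCoords_inl, Equiv.apply_symm_apply] at this
      exact this
    · exact H₂ l t y h2 h1
  · exact H₃ l t y ht h2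

/-- Both sides are compared entry by entry on the labels of T₃. Different positions do not interact
in the module structures, and the differentials use one common reflection `s`; so only membership in
the source sets has to agree, which is `hL₁₂` and `hL₂₃`. -/
theorem sumPoint_contractionPoint_trans (hρ : ∀ l, Satisfies R (ρ l))
    (h : ∀ i l, T₁ i l ⊆ T₂ i l) (h' : ∀ i l, T₂ i l ⊆ T₃ i l)
    (h'' : ∀ i l, T₁ i l ⊆ T₃ i l) (g₁ : Labelling n T₁ d₁) (g₂ : Labelling n T₂ d₂)
    (g₃ : Labelling n T₃ d₃) (g₁₂ : Labelling n (fun i l => T₂ i l \ T₁ i l) d₁₂)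
    (g₂₃ : Labelling n (fun i l => T₃ i l \ T₂ i l) d₂₃)
    (g₁₃ : Labelling n (fun i l => T₃ i l \ T₁ i l) d₁₃)
    (c₁₂ : IsContraction (fun i l => T₂ i l \ T₁ i l) L₁₂ s)
    (c₂₃ : IsContraction (fun i l => T₃ i l \ T₂ i l) L₂₃ s)
    (c₁₃ : IsContraction (fun i l => T₃ i l \ T₁ i l) L₁₃ s)
    (hL₁₂ : ∀ i l t, t ∈ T₂ (i + 1) l → t ∉ T₁ (i + 1) l →
      (s i l - t ∈ L₁₂ i l ↔ s i l - t ∈ L₁₃ i l))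
    (hL₂₃ : ∀ i l t, t ∈ T₃ (i + 1) l → t ∉ T₂ (i + 1) l →
      (s i l - t ∈ L₂₃ i l ↔ s i l - t ∈ L₁₃ i l)) (X : CPoint R d₁) :
    sumPoint (slotCoords h' g₂ g₂₃ g₃)
      (sumPoint (slotCoords h g₁ g₁₂ g₂) X (contractionPoint hρ c₁₂ g₁₂))
      (contractionPoint hρ c₂₃ g₂₃) =
    sumPoint (slotCoords h'' g₁ g₁₃ g₃) X (contractionPoint hρ c₁₃ g₁₃) := by
  -- These equations say that both decompositions place a label of T₃ at the same coordinate,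
  -- whether it lies in T₁, in T₂ \ T₁ or in T₃ \ T₂.
  have e1 := slotCoords_trans h h' h'' g₁ g₂ g₃ g₁₂ g₂₃ g₁₃
  have e12 : ∀ i k l t y, ∀ ht : t ∈ T₂ i l, ∀ ht' : t ∉ T₁ i l,
      slotCoords h' g₂ g₂₃ g₃ i k (Sum.inl (slotCoords h g₁ g₁₂ g₂ i k (Sum.inr
        ((g₁₂ i k).symm ⟨l, ⟨t, Finset.mem_sdiff.2 ⟨ht, ht'⟩⟩, y⟩)))) =
      (g₃ i k).symm ⟨l, ⟨t, h' i l ht⟩, y⟩ := by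
    intro i k l t y ht ht'
    rw [slotCoords_inr, slotCoords_inl, Equiv.apply_symm_apply]
    rfl
  have e23 : ∀ i k l t y, ∀ ht : t ∈ T₃ i l, ∀ ht' : t ∉ T₂ i l,
      slotCoords h' g₂ g₂₃ g₃ i k (Sum.inr
        ((g₂₃ i k).symm ⟨l, ⟨t, Finset.mem_sdiff.2 ⟨ht, ht'⟩⟩, y⟩)) =
      (g₃ i k).symm ⟨l, ⟨t, ht⟩, y⟩ := fun i k l t y ht ht' => slotCoords_inr _ _ _ _ _ _ _
  have e13 : ∀ i k l t y, ∀ ht : t ∈ T₃ i l, ∀ ht' : t ∉ T₁ i l,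
      slotCoords h'' g₁ g₁₃ g₃ i k (Sum.inr
        ((g₁₃ i k).symm ⟨l, ⟨t, Finset.mem_sdiff.2 ⟨ht, ht'⟩⟩, y⟩)) =
      (g₃ i k).symm ⟨l, ⟨t, ht⟩, y⟩ := fun i k l t y ht ht' => slotCoords_inr _ _ _ _ _ _ _
  refine CPoint.ext ?_ ?_
  · funext i j k a
    refine LinearMap.ext fun v => funext fun r => ?_
    refine slotCoords_cases h' h'' g₁ g₃ g₁₃ i k
      (fun r => blockSum _ _ (blockSum _ _ _ _) _ v r = blockSum _ _ _ _ v r)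
      (fun c => ?_) (fun l t y ht ht' => ?_) (fun l t y ht ht' => ?_) r
    · rw [blockSum_apply_inl, ← e1, blockSum_apply_inl, blockSum_apply_inl]
      simp only [e1]
    · rw [← e13 i k l t y (h' i l ht) ht', blockSum_apply_inr, e13 i k l t y (h' i l ht) ht', ← e12 i k l t y ht ht',
        blockSum_apply_inl, blockSum_apply_inr, contractionPoint_x_apply, contractionPoint_x_apply]
      simp only [e12 i j l t _ ht ht', e13 i j l t _ (h' i l ht) ht']
    · have ht1 : t ∉ T₁ i l := fun h1 => ht' (h i l h1)
      rw [← e13 i k l t y ht ht1, blockSum_apply_inr, e13 i k l t y ht ht1, ← e23 i k l t y ht ht',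
        blockSum_apply_inr, contractionPoint_x_apply, contractionPoint_x_apply]
      simp only [e23 i j l t _ ht ht', e13 i j l t _ ht ht1]
  · funext i k
    refine LinearMap.ext fun v => funext fun r => ?_
    refine slotCoords_cases h' h'' g₁ g₃ g₁₃ (i + 1) k
      (fun r => blockSum _ _ (blockSum _ _ _ _) _ v r = blockSum _ _ _ _ v r)
      (fun c => ?_) (fun l t y ht ht' => ?_) (fun l t y ht ht' => ?_) r
    · rw [blockSum_apply_inl, ← e1, blockSum_apply_inl, blockSum_apply_inl]
      simp only [e1]
    · rw [← e13 (i + 1) k l t y (h' _ l ht) ht', blockSum_apply_inr, e13 (i + 1) k l t y (h' _ l ht) ht',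
        ← e12 (i + 1) k l t y ht ht', blockSum_apply_inl, blockSum_apply_inr]
      by_cases hm : s i l - t ∈ L₁₂ i l
      · have hm' := (hL₁₂ i l t ht ht').1 hm
        rw [contractionPoint_diff_of_mem hρ c₁₂ _ _ _ _ _ _ _ hm,
          contractionPoint_diff_of_mem hρ c₁₃ _ _ _ _ _ _ _ hm']
        have h1 := Finset.mem_sdiff.1 (c₁₂.subset i l hm)
        rw [e12 i k l _ y h1.1 h1.2, e13 i k l _ y (h' i l h1.1) h1.2]
      · have hm' := (hL₁₂ i l t ht ht').not.1 hm
        rw [contractionPoint_diff_of_not_mem hρ c₁₂ _ _ _ _ _ _ _ hm,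
          contractionPoint_diff_of_not_mem hρ c₁₃ _ _ _ _ _ _ _ hm']
    · have ht1 : t ∉ T₁ (i + 1) l := fun h1 => ht' (h _ l h1)
      rw [← e13 (i + 1) k l t y ht ht1, blockSum_apply_inr, e13 (i + 1) k l t y ht ht1,
        ← e23 (i + 1) k l t y ht ht', blockSum_apply_inr]
      by_cases hm : s i l - t ∈ L₂₃ i l
      · have hm' := (hL₂₃ i l t ht ht').1 hm
        rw [contractionPoint_diff_of_mem hρ c₂₃ _ _ _ _ _ _ _ hm,
          contractionPoint_diff_of_mem hρ c₁₃ _ _ _ _ _ _ _ hm']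
        have h1 := Finset.mem_sdiff.1 (c₂₃.subset i l hm)
        rw [e23 i k l _ y h1.1 h1.2, e13 i k l _ y h1.1 (fun h2 => h1.2 (h i l h2))]
      · have hm' := (hL₂₃ i l t ht ht').not.1 hm
        rw [contractionPoint_diff_of_not_mem hρ c₂₃ _ _ _ _ _ _ _ hm,
          contractionPoint_diff_of_not_mem hρ c₁₃ _ _ _ _ _ _ _ hm']

end Slots

/-! ### Interval positions for virtual cones -/

section System

variable {V : Type} [Quiver.{0} V] [Fintype V] [DecidableEq V]

section Intervals

variable (e₀ : DimSeq V) (b b₁ b₂ b₃ : ℤ → V → ℤ)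

/-- The positions of the summands of the terms of the virtual sum of `e₀` and the cone of the
identity of `b`. -/
noncomputable def conePos : ℤ → V → Finset ℤ := fun i l =>
  Finset.Ico (-b i l) (b (i - 1) l + e₀ i l)

/-- The positions of the sources of the differential in a difference of virtual cones. -/
noncomputable def coneSource : ℤ → V → Finset ℤ := fun i l => Finset.Ico (-b₂ i l) (-b₁ i l)

variable {e₀ b b₁ b₂ b₃}

theorem mem_conePos {i : ℤ} {l : V} {t : ℤ} :
    t ∈ conePos e₀ b i l ↔ -b i l ≤ t ∧ t < b (i - 1) l + e₀ i l := Finset.mem_Ico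

theorem mem_coneSource {i : ℤ} {l : V} {t : ℤ} :
    t ∈ coneSource b₁ b₂ i l ↔ -b₂ i l ≤ t ∧ t < -b₁ i l := Finset.mem_Ico

theorem conePos_subset (h : ∀ i l, b₁ i l ≤ b₂ i l) (i : ℤ) (l : V) :
    conePos e₀ b₁ i l ⊆ conePos e₀ b₂ i l := by
  intro t
  have h1 := h i l
  have h2 := h (i - 1) l
  simp only [mem_conePos]
  omega

theorem card_conePos {e : DimSeq V} (he : ∀ i l, (e i l : ℤ) = e₀ i l + b i l + b (i - 1) l)
    (i : ℤ) (l : V) : (conePos e₀ b i l).card = e i l := by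
  have := he i l
  rw [conePos, Int.card_Ico]
  omega

theorem card_conePos_sdiff {e₁ e₂ : DimSeq V}
    (he₁ : ∀ i l, (e₁ i l : ℤ) = e₀ i l + b₁ i l + b₁ (i - 1) l)
    (he₂ : ∀ i l, (e₂ i l : ℤ) = e₀ i l + b₂ i l + b₂ (i - 1) l)
    (h : ∀ i l, b₁ i l ≤ b₂ i l) (i : ℤ) (l : V) :
    (conePos e₀ b₂ i l \ conePos e₀ b₁ i l).card = (e₂ - e₁) i l := by
  rw [Finset.card_sdiff_of_subset (conePos_subset h i l), card_conePos he₁, card_conePos he₂]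
  rfl

/-- Enlarging b adds [-b₂ i, -b₁ i) on the left in degree i and [b₁ i + e₀ (i + 1), b₂ i + e₀ (i +
1)) on the right in degree i + 1. The reflection exchanges these two; its -1 comes from the
intervals being half-open. Non-negativity of e₁ keeps left and right additions apart. -/
theorem isContraction_cone {e₁ : DimSeq V}
    (he₁ : ∀ i l, (e₁ i l : ℤ) = e₀ i l + b₁ i l + b₁ (i - 1) l)
    (h : ∀ i l, b₁ i l ≤ b₂ i l) :
    IsContraction (fun i l => conePos e₀ b₂ i l \ conePos e₀ b₁ i l) (coneSource b₁ b₂)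
      (fun i l => e₀ (i + 1) l - 1) where
  subset i l m := by
    have h1 := he₁ i l
    have h2 := h (i - 1) l
    simp only [Finset.mem_sdiff, mem_conePos, mem_coneSource]
    omega
  target_mem i l m := by
    have h1 := he₁ (i + 1) l
    have h2 := h (i + 1) l
    simp only [Finset.mem_sdiff, mem_conePos, mem_coneSource, add_sub_cancel_right] at h1 ⊢
    omega
  target_not_mem i l m := by
    have h1 := he₁ (i + 1) l
    have h2 := h (i + 1) l
    simp only [mem_coneSource, add_sub_cancel_right] at h1 ⊢
    omega
  source_mem i l m := by
    simp only [Finset.mem_sdiff, mem_conePos, mem_coneSource, add_sub_cancel_right]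
    omega

/-- A position below the right end of the b₂-interval reflects to one that is at least -b₂ i, so the
lower bounds -b₂ i and -b₃ i are both automatic. -/
theorem mem_coneSource_left (h : ∀ i l, b₁ i l ≤ b₂ i l) (h' : ∀ i l, b₂ i l ≤ b₃ i l) (i : ℤ)
    (l : V) (t : ℤ) (ht : t ∈ conePos e₀ b₂ (i + 1) l) :
    e₀ (i + 1) l - 1 - t ∈ coneSource b₁ b₂ i l ↔
      e₀ (i + 1) l - 1 - t ∈ coneSource b₁ b₃ i l := by
  have h1 := h i l
  have h2 := h' i l
  simp only [mem_conePos, mem_coneSource, add_sub_cancel_right] at ht ⊢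
  omega

/-- Outside the b₂-interval, `t` lies either to the right, and reflects below -b₂ i, or to the left,
and then non-negativity of e₁ makes the reflection at least -b₁ i, which is outside both source
sets. -/
theorem mem_coneSource_right (h : ∀ i l, b₁ i l ≤ b₂ i l) (h' : ∀ i l, b₂ i l ≤ b₃ i l) (i : ℤ)
    (l : V) (t : ℤ) (ht : t ∈ conePos e₀ b₃ (i + 1) l) (ht' : t ∉ conePos e₀ b₂ (i + 1) l)
    {e₁ : DimSeq V} (he₁ : ∀ i l, (e₁ i l : ℤ) = e₀ i l + b₁ i l + b₁ (i - 1) l) :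
    e₀ (i + 1) l - 1 - t ∈ coneSource b₂ b₃ i l ↔
      e₀ (i + 1) l - 1 - t ∈ coneSource b₁ b₃ i l := by
  have h1 := h i l
  have h2 := h' i l
  have h4 := h (i + 1) l
  have h3 := he₁ (i + 1) l
  simp only [mem_conePos, mem_coneSource, add_sub_cancel_right] at ht ht' h3 ⊢
  omega

end Intervals

end System

/-! ### Existence of coherent systems and directedness -/

section System

variable {V : Type} [Quiver.{0} V] [Fintype V] [DecidableEq V] (R : Relations V)
  [Module.Finite ℂ (Alg R)]

/-- A representation that realises the projective module of a vertex. -/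
noncomputable def projRep (l : V) : QRep fun k => Sp (vtxDim R (Proj R l) k) :=
  (exists_rep (Proj R l)).choose

theorem satisfies_projRep (l : V) : Satisfies R (projRep R l) :=
  (exists_rep (Proj R l)).choose_spec.choose

theorem nonempty_proj_equiv (l : V) :
    Nonempty (Proj R l ≃ₗ[Alg R] RepMod R (projRep R l) (satisfies_projRep R l)) :=
  (exists_rep (Proj R l)).choose_spec.choose_spec

variable {R}

theorem card_slot {T : ℤ → V → Finset ℤ} {e : DimSeq V} (h : ∀ i l, (T i l).card = e i l)
    (i : ℤ) (k : V) : Fintype.card (Fin (dimOf R e i k)) =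
      Fintype.card (Slot (fun l k => vtxDim R (Proj R l) k) (T i) k) := by
  simp [dimOf_apply, h]

variable (R) in
/-- A labelling of the coordinates of the terms of projective complexes. -/
noncomputable def projLabelling {T : ℤ → V → Finset ℤ} {e : DimSeq V}
    (h : ∀ i l, (T i l).card = e i l) :
    Labelling (fun l k => vtxDim R (Proj R l) k) T (dimOf R e) :=
  fun i k => Fintype.equivOfCardEq (card_slot h i k)

variable (R) in
/-- The contractible projective complex that belongs to positions of summands. -/
noncomputable def projContraction {T L : ℤ → V → Finset ℤ} {s : ℤ → V → ℤ} {e : DimSeq V}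
    (h : ∀ i l, (T i l).card = e i l) (hc : IsContraction T L s) : PPoint R e :=
  ⟨contractionPoint (satisfies_projRep R) hc (projLabelling R h), fun i => by
    obtain ⟨φ⟩ := nonempty_mod_contractionPoint (satisfies_projRep R) hc (projLabelling R h) i
    have ψ := fun l => Classical.choice (nonempty_proj_equiv R l)
    exact ⟨φ.trans (LinearEquiv.piCongrRight fun l =>
      (LinearEquiv.piCongrRight fun _ : T i l => (ψ l).symm).trans
        (LinearEquiv.funCongrLeft (Alg R) (Proj R l)
          (Fintype.equivOfCardEq (by simp [h]) : Fin (e i l) ≃ T i l)))⟩⟩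

theorem acyclic_projContraction {T L : ℤ → V → Finset ℤ} {s : ℤ → V → ℤ} {e : DimSeq V}
    (h : ∀ i l, (T i l).card = e i l) (hc : IsContraction T L s) :
    (projContraction R h hc).1.complex.Acyclic :=
  acyclic_contractionPoint (satisfies_projRep R) hc (projLabelling R h)

-- The converse of `PLE.exists_coneSeq`: the interval construction based at `e`, going from b = 0 to
-- b = a, provides the acyclic complex.
variable (R) in
theorem ple_add_coneSeq (e a : DimSeq V) : PLE R e (e + coneSeq a) := by
  have he : ∀ i l, (e i l : ℤ) = e i l + (0 : ℤ → V → ℤ) i l + (0 : ℤ → V → ℤ) (i - 1) l := by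
    simp
  have he' : ∀ i l, ((e + coneSeq a) i l : ℤ) = e i l + (a i l : ℤ) + (a (i - 1) l : ℤ) := by
    intro i l
    rw [Finsupp.add_apply, Pi.add_apply, coneSeq_apply]
    push_cast
    ring
  have h : ∀ i l, (0 : ℤ → V → ℤ) i l ≤ a i l := fun i l => Int.natCast_nonneg _
  exact ⟨le_self_add, _, acyclic_projContraction (R := R)
    (card_conePos_sdiff (b₂ := fun i l => (a i l : ℤ)) he he' h)
    (isContraction_cone (b₂ := fun i l => (a i l : ℤ)) he h)⟩

/-- If b = p - m is the virtual difference with positive part p and negative part m, then e + cone p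
= e' + cone m bounds both. -/
theorem exists_ple (hR : R.Admissible) (hgl : FiniteGlobalDimension (Alg R)) {d : K0 R}
    (e e' : Idx R d) : ∃ e'' : Idx R d, PLE R e.1 e''.1 ∧ PLE R e'.1 e''.1 := by
  obtain ⟨b, hb, hb'⟩ := exists_virtual_coneSeq hR hgl (e.2.trans e'.2.symm)
  have hfin : ∀ g : ℤ → ℕ, g 0 = 0 → (Function.support fun i j => g (b i j)).Finite := by
    intro g hg
    refine Set.Finite.subset (Set.finite_iUnion fun j => hb j) fun i hi => ?_
    obtain ⟨j, hj⟩ := Function.ne_iff.1 hi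
    refine Set.mem_iUnion.2 ⟨j, fun h0 => hj ?_⟩
    simp only at h0
    simp [h0, hg]
  let p : DimSeq V := Finsupp.ofSupportFinite _ (hfin Int.toNat rfl)
  let m : DimSeq V := Finsupp.ofSupportFinite _ (hfin (fun z => (-z).toNat) rfl)
  have hpm : e.1 + coneSeq p = e'.1 + coneSeq m := by
    ext i j
    have h1 := hb' i j
    have h2 : ∀ i j, p i j = (b i j).toNat := fun _ _ => rfl
    have h3 : ∀ i j, m i j = (-b i j).toNat := fun _ _ => rfl
    simp only [Finsupp.add_apply, Pi.add_apply, coneSeq_apply, h2, h3]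
    omega
  refine ⟨⟨e.1 + coneSeq p, (dimClass_dimOf_add_coneSeq _ _).trans e.2⟩,
    ple_add_coneSeq R _ _, ?_⟩
  change PLE R e'.1 (e.1 + coneSeq p)
  rw [hpm]
  exact ple_add_coneSeq R _ _

/-- Both b₂ and b₁ + a, with a ≥ 0 from `PLE.exists_coneSeq`, solve the same equation, so they
coincide. -/
theorem PLE.le_of_virtual (hR : R.Admissible) (hgl : FiniteGlobalDimension (Alg R))
    {e₀ e₁ e₂ : DimSeq V} (h : PLE R e₁ e₂) {b₁ b₂ : ℤ → V → ℤ}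
    (hb₁ : ∀ j, Function.HasFiniteSupport fun i => b₁ i j)
    (hb₂ : ∀ j, Function.HasFiniteSupport fun i => b₂ i j)
    (he₁ : ∀ i l, (e₁ i l : ℤ) = e₀ i l + b₁ i l + b₁ (i - 1) l)
    (he₂ : ∀ i l, (e₂ i l : ℤ) = e₀ i l + b₂ i l + b₂ (i - 1) l) (i : ℤ) (l : V) :
    b₁ i l ≤ b₂ i l := by
  obtain ⟨a, rfl⟩ := h.exists_coneSeq hR hgl
  have h0 := eq_zero_of_add_pred_eq_zero
    (b := fun i => b₁ i l + (a i l : ℤ) + -b₂ i l)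
    (((hb₁ l).fun_add (hasFiniteSupport_apply a l)).fun_add
      ((hb₂ l).subset fun i hi h0 => hi (by simpa using h0)))
    (fun i => by
      have h1 := he₁ i l
      have h2 := he₂ i l
      rw [Finsupp.add_apply, Pi.add_apply, coneSeq_apply] at h2
      push_cast at h2
      linarith)
  have h1 := congrFun h0 i
  simp only [Pi.zero_apply] at h1
  omega

theorem nonempty_contractibleSystem (hR : R.Admissible) (hgl : FiniteGlobalDimension (Alg R))
    (d : K0 R) : Nonempty (ContractibleSystem R d) := by
  rcases isEmpty_or_nonempty (Idx R d) with hd | ⟨⟨e₀⟩⟩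
  · exact ⟨{
      compl := fun {e₁} => isEmptyElim e₁
      acyclic := fun {e₁} => isEmptyElim e₁
      coords := fun {e₁} => isEmptyElim e₁
      coords_trans := fun {e₁} => isEmptyElim e₁
      compl_trans := fun {e₁} => isEmptyElim e₁ }⟩
  -- Positions, reflection and the labelling `g` depend on the base point and on single sequences,
  -- never on a pair e₁ ≤ e₂; this makes the complements compose on the nose.
  · choose b hb he using fun e : Idx R d => exists_virtual_coneSeq hR hgl (e₀.2.trans e.2.symm)
    have hle : ∀ {e₁ e₂ : Idx R d}, PLE R e₁.1 e₂.1 → ∀ i l, b e₁ i l ≤ b e₂ i l :=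
      fun {e₁ e₂} h => h.le_of_virtual hR hgl (hb e₁) (hb e₂) (he e₁) (he e₂)
    let g := fun e : Idx R d => projLabelling R (card_conePos (he e))
    let g' := fun {e₁ e₂ : Idx R d} (h : PLE R e₁.1 e₂.1) =>
      projLabelling R (card_conePos_sdiff (he e₁) (he e₂) (hle h))
    have hc := fun {e₁ e₂ : Idx R d} (h : PLE R e₁.1 e₂.1) =>
      isContraction_cone (he e₁) (hle h)
    exact ⟨{
      compl := fun {e₁ e₂} h => projContraction R
        (card_conePos_sdiff (he e₁) (he e₂) (hle h)) (hc h)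
      acyclic := fun h => acyclic_projContraction _ _
      coords := fun {e₁ e₂} h => slotCoords (conePos_subset (hle h)) (g e₁) (g' h) (g e₂)
      coords_trans := fun {e₁ e₂ e₃} h h' h'' => slotCoords_trans _ _ _ _ _ _ _ _ _
      compl_trans := fun {e₁ e₂ e₃} h h' h'' X => Subtype.ext
        (sumPoint_contractionPoint_trans (satisfies_projRep R) (conePos_subset (hle h))
          (conePos_subset (hle h')) (conePos_subset (hle h'')) (g e₁) (g e₂) (g e₃)
          (g' h) (g' h') (g' h'') (hc h) (hc h') (hc h'')
          (fun i l t ht _ => mem_coneSource_left (hle h) (hle h') i l t ht)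
          (fun i l t ht ht' => mem_coneSource_right (hle h) (hle h') i l t ht ht' (he e₁))
          X.1) }⟩

end System

/-! ### The direct limits and the induced action -/

section Order

variable {V : Type} [Quiver.{0} V] [Fintype V] [DecidableEq V] {R : Relations V}

theorem PLE.refl [Module.Finite ℂ (Alg R)] (e : DimSeq V) : PLE R e e := by
  have h := ple_add_coneSeq R e 0
  rwa [show e + coneSeq 0 = e by ext i j; simp [coneSeq_apply]] at h

theorem PLE.trans [Module.Finite ℂ (Alg R)] (hR : R.Admissible)
    (hgl : FiniteGlobalDimension (Alg R)) {e₁ e₂ e₃ : DimSeq V} (h : PLE R e₁ e₂)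
    (h' : PLE R e₂ e₃) : PLE R e₁ e₃ := by
  obtain ⟨a, rfl⟩ := h.exists_coneSeq hR hgl
  obtain ⟨b, rfl⟩ := h'.exists_coneSeq hR hgl
  rw [add_assoc, ← coneSeq_add]
  exact ple_add_coneSeq R _ _

theorem glSum_apply_inl {d d' d'' : DimSeq V} (s : CoordSum d d' d'') (g : GLSeq d) (i : ℤ) (j : V)
    (v : Sp (d'' i j)) (c : Fin (d i j)) :
    glSum s g i j v (s i j (Sum.inl c)) = g i j (fun c => v (s i j (Sum.inl c))) c :=
  blockSum_apply_inl (s i j) (s i j) (g i j).toLinearMap LinearMap.id v c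

theorem glSum_apply_inr {d d' d'' : DimSeq V} (s : CoordSum d d' d'') (g : GLSeq d) (i : ℤ) (j : V)
    (v : Sp (d'' i j)) (c : Fin (d' i j)) :
    glSum s g i j v (s i j (Sum.inr c)) = v (s i j (Sum.inr c)) :=
  blockSum_apply_inr (s i j) (s i j) (g i j).toLinearMap LinearMap.id v c

variable (R) in
/-- The order on the projective dimension sequences over a class is directed. -/
structure DirectedOver (d : K0 R) : Prop where
  directed : ∀ e e' : Idx R d, ∃ e'' : Idx R d, PLE R e.1 e''.1 ∧ PLE R e'.1 e''.1
  refl : ∀ e : DimSeq V, PLE R e e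
  trans : ∀ {e₁ e₂ e₃ : DimSeq V}, PLE R e₁ e₂ → PLE R e₂ e₃ → PLE R e₁ e₃

namespace ContractibleSystem

variable {d : K0 R} (S : ContractibleSystem R d)

/-- Coherence for e ≤ e ≤ e makes the inclusion idempotent, and an injective idempotent is the
identity. Thus no normalisation has to be part of a coherent system. -/
theorem coords_refl {e : Idx R d} (h : PLE R e.1 e.1) (i : ℤ) (j : V)
    (c : Fin (dimOf R e.1 i j)) : S.coords h i j (Sum.inl c) = c :=
  Sum.inl_injective ((S.coords h i j).injective (S.coords_trans h h h i j c))

theorem t_refl {e : Idx R d} (h : PLE R e.1 e.1) (X : PPoint R e.1) : S.t h X = X := by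
  refine Subtype.ext (CPoint.ext ?_ ?_)
  · funext i j k a
    refine LinearMap.ext fun v => funext fun r => ?_
    have := blockSum_apply_inl (S.coords h i j) (S.coords h i k) (X.1.x i j k a)
      ((S.compl h).1.x i j k a) v r
    simp only [S.coords_refl] at this
    exact this
  · funext i j
    refine LinearMap.ext fun v => funext fun r => ?_
    have := blockSum_apply_inl (S.coords h i j) (S.coords h (i + 1) j) (X.1.diff i j)
      ((S.compl h).1.diff i j) v r
    simp only [S.coords_refl] at this
    exact this

theorem f_refl {e : Idx R d} (h : PLE R e.1 e.1) (g : PGL R e.1) : S.f h g = g := by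
  funext i j
  refine LinearEquiv.ext fun v => funext fun r => ?_
  have := glSum_apply_inl (S.coords h) g i j v r
  simp only [S.coords_refl] at this
  exact this

theorem t_trans {e₁ e₂ e₃ : Idx R d} (h : PLE R e₁.1 e₂.1) (h' : PLE R e₂.1 e₃.1)
    (h'' : PLE R e₁.1 e₃.1) (X : PPoint R e₁.1) : S.t h' (S.t h X) = S.t h'' X :=
  S.compl_trans h h' h'' X

theorem f_trans {e₁ e₂ e₃ : Idx R d} (h : PLE R e₁.1 e₂.1) (h' : PLE R e₂.1 e₃.1)
    (h'' : PLE R e₁.1 e₃.1) (g : PGL R e₁.1) : S.f h' (S.f h g) = S.f h'' g := by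
  have key := S.coords_trans h h' h''
  funext i j
  refine LinearEquiv.ext fun v => funext fun r => ?_
  change glSum (S.coords h') (glSum (S.coords h) g) i j v r = glSum (S.coords h'') g i j v r
  obtain ⟨c | c, rfl⟩ := (S.coords h'' i j).surjective r
  · rw [glSum_apply_inl, ← key, glSum_apply_inl, glSum_apply_inl]
    simp only [key]
  -- A coordinate outside the e₁-block either lies outside the e₂-block or in its part complementary
  -- to e₁; the iterated extension is the identity in both cases.
  · rw [glSum_apply_inr]
    obtain ⟨q | q, hq⟩ := (S.coords h' i j).surjective (S.coords h'' i j (Sum.inr c))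
    · rw [← hq, glSum_apply_inl]
      obtain ⟨u | u, rfl⟩ := (S.coords h i j).surjective q
      · rw [key] at hq
        exact absurd ((S.coords h'' i j).injective hq) Sum.inl_ne_inr
      · rw [glSum_apply_inr]
    · rw [← hq, glSum_apply_inr]

theorem toPLim_t {e₁ e₂ : Idx R d} (h : PLE R e₁.1 e₂.1) (X : PPoint R e₁.1) :
    S.toPLim e₂ (S.t h X) = S.toPLim e₁ X :=
  (Quot.sound ⟨h, rfl⟩).symm

theorem exists_toPLim (x : S.PLim) : ∃ (e : Idx R d) (X : PPoint R e.1), S.toPLim e X = x := by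
  obtain ⟨⟨e, X⟩, rfl⟩ := Quot.exists_rep x
  exact ⟨e, X, rfl⟩

theorem toGLim_f {e₁ e₂ : Idx R d} (h : PLE R e₁.1 e₂.1) (g : PGL R e₁.1) :
    S.toGLim e₂ (S.f h g) = S.toGLim e₁ g := by
  rw [← div_eq_one]
  refine (QuotientGroup.eq_one_iff _).2 (Subgroup.subset_normalClosure ⟨e₁, e₂, h, g, ?_⟩)
  exact div_eq_mul_inv _ _

/-- Products of elements from two levels are formed at a common upper bound. The index `e` only
serves to represent the neutral element. -/
theorem exists_toGLim (H : DirectedOver R d) (e : Idx R d) (γ : S.GLim) :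
    ∃ (e' : Idx R d) (g : PGL R e'.1), S.toGLim e' g = γ := by
  obtain ⟨γ, rfl⟩ := QuotientGroup.mk_surjective γ
  induction γ using Monoid.CoprodI.induction_on with
  | one => exact ⟨e, 1, map_one _⟩
  | of e g => exact ⟨e, g, rfl⟩
  | mul a b ha hb =>
    obtain ⟨e₁, g₁, h₁⟩ := ha
    obtain ⟨e₂, g₂, h₂⟩ := hb
    obtain ⟨e₃, h, h'⟩ := H.directed e₁ e₂
    refine ⟨e₃, S.f h g₁ * S.f h' g₂, ?_⟩
    rw [map_mul, S.toGLim_f, S.toGLim_f, h₁, h₂]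
    rfl

/-- At a common upper bound of e₁ and e₂ both sides agree, by equivariance of `t` and coherence. -/
theorem smul_t_well_defined (H : DirectedOver R d) {e e' e₁ e₂ : Idx R d} (h₁ : PLE R e.1 e₁.1) (h₁' : PLE R e'.1 e₁.1)
    (h₂ : PLE R e.1 e₂.1) (h₂' : PLE R e'.1 e₂.1) (g : PGL R e.1) (X : PPoint R e'.1) :
    S.toPLim e₁ (S.f h₁ g • S.t h₁' X) = S.toPLim e₂ (S.f h₂ g • S.t h₂' X) := by
  obtain ⟨e₃, k₁, k₂⟩ := H.directed e₁ e₂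
  rw [← S.toPLim_t k₁, ← S.toPLim_t k₂, ← f_smul_t, ← f_smul_t,
    S.f_trans h₁ k₁ (H.trans h₁ k₁), S.f_trans h₂ k₂ (H.trans h₁ k₁),
    S.t_trans h₁' k₁ (H.trans h₁' k₁), S.t_trans h₂' k₂ (H.trans h₁' k₁)]

/-- The action of the elements of `G_{d(e)}` on the limit. -/
noncomputable def limSMul (H : DirectedOver R d) (e : Idx R d) (g : PGL R e.1) : S.PLim → S.PLim :=
  Quot.lift (fun a => S.toPLim (H.directed e a.1).choose
    (S.f (H.directed e a.1).choose_spec.1 g • S.t (H.directed e a.1).choose_spec.2 a.2)) (by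
    rintro ⟨e₁, X⟩ ⟨e₂, Y⟩ ⟨h, hY⟩
    have h : PLE R e₁.1 e₂.1 := h
    obtain rfl : Y = S.t h X := hY
    have h2 := (H.directed e e₂).choose_spec.2
    change S.toPLim _ _ = S.toPLim _ (_ • S.t h2 (S.t h X))
    rw [S.t_trans h h2 (H.trans h h2)]
    exact S.smul_t_well_defined H _ _ _ _ _ _)

theorem limSMul_toPLim (H : DirectedOver R d) {e e' e'' : Idx R d} (h : PLE R e.1 e''.1) (h' : PLE R e'.1 e''.1)
    (g : PGL R e.1) (X : PPoint R e'.1) : S.limSMul H e g (S.toPLim e' X) =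
      S.toPLim e'' (S.f h g • S.t h' X) :=
  S.smul_t_well_defined H _ _ _ _ _ _

/-- The action of `G_{d(e)}` on the limit. -/
noncomputable def limSMulHom (H : DirectedOver R d) (e : Idx R d) : PGL R e.1 →* Function.End S.PLim where
  toFun := S.limSMul H e
  map_one' := by
    funext x
    obtain ⟨e', X, rfl⟩ := S.exists_toPLim x
    obtain ⟨e'', h, h'⟩ := H.directed e e'
    rw [S.limSMul_toPLim H h h', map_one, one_smul, S.toPLim_t]
    rfl
  map_mul' g g' := by
    funext x
    obtain ⟨e', X, rfl⟩ := S.exists_toPLim x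
    obtain ⟨e'', h, h'⟩ := H.directed e e'
    rw [S.limSMul_toPLim H h h', map_mul, mul_smul]
    change _ = S.limSMul H e g (S.limSMul H e g' (S.toPLim e' X))
    rw [S.limSMul_toPLim H h h', S.limSMul_toPLim H h (H.refl e''.1), S.t_refl]

theorem limSMulHom_f (H : DirectedOver R d) {e₁ e₂ : Idx R d} (h : PLE R e₁.1 e₂.1) (g : PGL R e₁.1) :
    S.limSMulHom H e₂ (S.f h g) = S.limSMulHom H e₁ g := by
  funext x
  obtain ⟨e', X, rfl⟩ := S.exists_toPLim x
  obtain ⟨e'', k, k'⟩ := H.directed e₂ e'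
  change S.limSMul H e₂ (S.f h g) (S.toPLim e' X) = S.limSMul H e₁ g (S.toPLim e' X)
  rw [S.limSMul_toPLim H k k', S.limSMul_toPLim H (H.trans h k) k',
    S.f_trans h k (H.trans h k)]

/-- The action of `G_d` on the limit as a homomorphism. -/
noncomputable def actHom (H : DirectedOver R d) : S.GLim →* Function.End S.PLim :=
  QuotientGroup.lift _ (Monoid.CoprodI.lift (S.limSMulHom H)) (by
    refine Subgroup.normalClosure_le_normal ?_
    rintro _ ⟨e₁, e₂, h, g, rfl⟩
    rw [SetLike.mem_coe, MonoidHom.mem_ker, map_mul, Monoid.CoprodI.lift_of, S.limSMulHom_f,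
      ← Monoid.CoprodI.lift_of (S.limSMulHom H) g, ← map_mul, mul_inv_cancel,
      map_one])

/-- The action of `G_d` on the limit. -/
noncomputable abbrev limAction (H : DirectedOver R d) : MulAction S.GLim S.PLim :=
  MulAction.compHom _ (S.actHom H)

theorem limAction_smul (H : DirectedOver R d) (e : Idx R d) (g : PGL R e.1) (x : S.PLim) :
    (S.limAction H).smul (S.toGLim e g) x = S.limSMul H e g x := by
  change S.actHom H (S.toGLim e g) x = S.limSMulHom H e g x
  refine congrFun ?_ x
  exact Monoid.CoprodI.lift_of (S.limSMulHom H) g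

theorem isInducedAction_limAction (H : DirectedOver R d) : S.IsInducedAction (S.limAction H) := by
  intro e e' e'' h h' g X
  rw [limAction_smul, limSMul_toPLim]

theorem IsInducedAction.eq (H : DirectedOver R d) {act act' : MulAction S.GLim S.PLim} (h : S.IsInducedAction act)
    (h' : S.IsInducedAction act') : act' = act := by
  refine MulAction.ext (funext fun γ => funext fun x => ?_)
  obtain ⟨e', X, rfl⟩ := S.exists_toPLim x
  obtain ⟨e, g, rfl⟩ := S.exists_toGLim H e' γ
  obtain ⟨e'', k, k'⟩ := H.directed e e'
  exact (h' e e' e'' k k' g X).trans (h e e' e'' k k' g X).symm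

end ContractibleSystem

end Order

/-! ### Quasi-isomorphism classes, orbits and the homeomorphisms -/

section QuasiIsomorphism

variable {V : Type} [Quiver.{0} V] [Fintype V] [DecidableEq V] {R : Relations V}

theorem LinCplx.IsPerfect.of_iso {X Y : LinCplx (Alg R)} (φ : LinCplx.Iso X Y)
    (h : X.IsPerfect) : Y.IsPerfect where
  bounded := by
    obtain ⟨n, hn⟩ := h.bounded
    exact ⟨n, fun i hi => have := hn i hi; (φ.e i).symm.injective.subsingleton⟩
  projective i := have := h.projective i; Module.Projective.of_equiv (φ.e i)
  finite i := have := h.finite i; Module.Finite.equiv (φ.e i)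

theorem PPoint.isPerfect {e : DimSeq V} (X : PPoint R e) : X.1.lin.IsPerfect where
  bounded := X.1.bounded_lin
  projective i :=
    have ⟨φ⟩ := X.2 i
    Module.Projective.of_equiv φ.symm
  finite := X.1.finite_lin

theorem PPoint.vtxDim_lin {e : DimSeq V} (X : PPoint R e) (i : ℤ) (k : V) :
    vtxDim R (X.1.lin.X i) k = dimOf R e i k :=
  (vtxDim_repMod (X.1.sat i) k).trans (by simp)

namespace ContractibleSystem

variable {d : K0 R} (S : ContractibleSystem R d)

/-- The elementary complex of `X ⊕ P(e₁, e₂)`. -/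
noncomputable def tIso {e₁ e₂ : Idx R d} (h : PLE R e₁.1 e₂.1) (X : PPoint R e₁.1) :
    LinCplx.Iso (S.t h X).1.lin (X.1.lin.prod (S.compl h).1.lin) :=
  CPoint.linSum (S.coords h) X.1 (S.compl h).1

/-- Quasi-isomorphic projective complexes become conjugate after adding contractible complexes. -/
theorem exists_smul_t_eq [Module.Finite ℂ (Alg R)] (hR : R.Admissible)
    (hgl : FiniteGlobalDimension (Alg R)) {e₁ e₂ e₃ : Idx R d} {X : PPoint R e₁.1}
    {Y : PPoint R e₂.1} {f : LinCplx.Hom X.1.lin Y.1.lin} (hf : LinCplx.IsQis f)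
    (h₁ : PLE R e₁.1 e₃.1) (h₂ : PLE R e₂.1 e₃.1) :
    ∃ (e₄ : Idx R d) (k : PLE R e₃.1 e₄.1) (g : PGL R e₄.1),
      g • S.t k (S.t h₁ X) = S.t k (S.t h₂ Y) := by
  -- The complement from e₃ to e₄ must have the dimensions of the cone of an identity at level e₃,
  -- that is e₃ (i + 1) + e₃ i in degree i; hence a i = e₃ (i + 1).
  let a : DimSeq V := e₃.1.equivMapDomain (Equiv.subRight 1)
  have ha : ∀ i, a i = e₃.1 (i + 1) := fun i => by
    simp [a, Finsupp.equivMapDomain_apply]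
  let e₄ : Idx R d := ⟨e₃.1 + coneSeq a, (dimClass_dimOf_add_coneSeq _ _).trans e₃.2⟩
  have k : PLE R e₃.1 e₄.1 := ple_add_coneSeq R _ _
  have hq := hf.extend ((CPoint.acyclic_iff _).1 (S.acyclic h₁))
    ((CPoint.acyclic_iff _).1 (S.acyclic h₂))
  have hdim : ∀ i j, dimOf R (e₄.1 - e₃.1) i j = dimOf R e₃.1 (i + 1) j + dimOf R e₃.1 i j := by
    intro i j
    have h0 : e₄.1 - e₃.1 = coneSeq a := add_tsub_cancel_left _ _
    have h1 : dimOf R a i j = dimOf R e₃.1 (i + 1) j := by rw [dimOf_apply, dimOf_apply, ha]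
    have h2 : dimOf R (shiftSeq a) i j = dimOf R e₃.1 i j := by
      rw [dimOf_apply, dimOf_apply, shiftSeq_apply, ha, sub_add_cancel]
    rw [h0, coneSeq, dimOf_add, Finsupp.add_apply, Pi.add_apply, h1, h2]
  have dX : ∀ i j, vtxDim R ((X.1.lin.prod (S.compl h₁).1.lin).X i) j = dimOf R e₃.1 i j :=
    fun i j => (vtxDim_congr ((S.tIso h₁ X).e i) j).symm.trans ((S.t h₁ X).vtxDim_lin i j)
  have dY : ∀ i j, vtxDim R ((Y.1.lin.prod (S.compl h₂).1.lin).X i) j = dimOf R e₃.1 i j :=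
    fun i j => (vtxDim_congr ((S.tIso h₂ Y).e i) j).symm.trans ((S.t h₂ Y).vtxDim_lin i j)
  obtain ⟨Φ⟩ := hq.nonempty_iso_prod hR hgl ((S.t h₁ X).isPerfect.of_iso (S.tIso h₁ X))
    ((S.t h₂ Y).isPerfect.of_iso (S.tIso h₂ Y)) (S.compl k).isPerfect
    ((CPoint.acyclic_iff _).1 (S.acyclic k))
    (fun i j => (dX i j).trans (dY i j).symm)
    (fun i j => by rw [dX, dX, PPoint.vtxDim_lin, hdim])
  -- An isomorphism of complexes on the same coordinate spaces is an element of the group.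
  obtain ⟨g, hg⟩ := CPoint.exists_smul_eq_of_iso
    ((S.tIso k (S.t h₁ X)).trans (((S.tIso h₁ X).prodCongr (.refl _)).trans
      (Φ.trans (((S.tIso h₂ Y).prodCongr (.refl _)).symm.trans (S.tIso k (S.t h₂ Y)).symm))))
  exact ⟨e₄, k, g, Subtype.ext hg⟩

theorem IsInducedAction.smul_toPLim {act : MulAction S.GLim S.PLim} (h : S.IsInducedAction act)
    (H : DirectedOver R d) {e : Idx R d} (g : PGL R e.1) (X : PPoint R e.1) :
    S.toGLim e g • S.toPLim e X = S.toPLim e (g • X) := by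
  have := h e e e (H.refl e.1) (H.refl e.1) g X
  rw [S.f_refl, S.t_refl] at this
  exact this

theorem exists_common_toPLim (H : DirectedOver R d) (γ : S.GLim) (x : S.PLim) :
    ∃ (e : Idx R d) (g : PGL R e.1) (X : PPoint R e.1), S.toGLim e g = γ ∧ S.toPLim e X = x := by
  obtain ⟨e, X, rfl⟩ := S.exists_toPLim x
  obtain ⟨e', g, rfl⟩ := S.exists_toGLim H e γ
  obtain ⟨e'', h, h'⟩ := H.directed e' e
  exact ⟨e'', S.f h g, S.t h' X, S.toGLim_f h g, S.toPLim_t h' X⟩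

/-- A quasi-isomorphism of representatives becomes a conjugation after enlarging the level, which
the limit does not see. Conversely, γ and y have representatives at one level, where conjugate
points have isomorphic complexes. -/
theorem quasiIsomorphic_iff [Module.Finite ℂ (Alg R)] (hR : R.Admissible)
    (hgl : FiniteGlobalDimension (Alg R)) (H : DirectedOver R d)
    {act : MulAction S.GLim S.PLim} (h : S.IsInducedAction act) (x y : S.PLim) :
    S.QuasiIsomorphic x y ↔ ∃ γ : S.GLim, γ • y = x := by
  constructor
  · rintro ⟨⟨e₁, X⟩, ⟨e₂, Y⟩, rfl, rfl, ⟨ε⟩⟩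
    obtain ⟨f, hf⟩ := CPoint.exists_isQis_of_iso Y.isPerfect.projective X.isPerfect.projective
      ε.symm
    obtain ⟨e₃, h₂, h₁⟩ := H.directed e₂ e₁
    obtain ⟨e₄, k, g, hg⟩ := S.exists_smul_t_eq hR hgl hf h₂ h₁
    refine ⟨S.toGLim e₄ g, ?_⟩
    change S.toGLim e₄ g • S.toPLim e₂ Y = S.toPLim e₁ X
    rw [← S.toPLim_t h₂, ← S.toPLim_t k, ← S.toPLim_t h₁, ← S.toPLim_t k,
      IsInducedAction.smul_toPLim S h H, hg]
  · rintro ⟨γ, rfl⟩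
    obtain ⟨e, g, Y, rfl, rfl⟩ := S.exists_common_toPLim H γ y
    exact ⟨⟨e, g • Y⟩, ⟨e, Y⟩, (IsInducedAction.smul_toPLim S h H g Y).symm, rfl,
      ⟨DerivedCategory.Q.mapIso (CPoint.complexSMulIso g Y.1).symm⟩⟩

/-- The two relations on `S.PLim` coincide, so its identity descends in both directions. -/
theorem exists_homeomorph_orbits {act : MulAction S.GLim S.PLim}
    (h : ∀ x y : S.PLim, S.QuasiIsomorphic x y ↔ ∃ γ : S.GLim, γ • y = x) :
    ∃ φ : S.QP ≃ₜ MulAction.orbitRel.Quotient S.GLim S.PLim,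
      ∀ x : S.PLim, φ (Quot.mk _ x) = Quotient.mk'' x :=
  ⟨{  toFun := Quot.lift (fun x => Quotient.mk'' x) fun x y hxy => Quotient.sound ((h x y).1 hxy)
      invFun := Quotient.lift (fun x => Quot.mk _ x) fun x y hxy => Quot.sound ((h x y).2 hxy)
      left_inv := by rintro ⟨x⟩; rfl
      right_inv := by rintro ⟨x⟩; rfl
      continuous_toFun := continuous_quot_lift _ continuous_quotient_mk'
      continuous_invFun := continuous_quot_mk.quotient_lift _ }, fun _ => rfl⟩

theorem continuous_toPLim (e : Idx R d) : Continuous (S.toPLim e) :=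
  continuous_quot_mk.comp continuous_sigmaMk

theorem continuous_toQPLim (e : Idx R d) : Continuous (S.toQPLim e) :=
  continuous_quot_mk.comp (continuous_sigmaMk.comp continuous_quotient_mk')

theorem toQPLim_t {e₁ e₂ : Idx R d} (h : PLE R e₁.1 e₂.1) (X : PPoint R e₁.1) :
    S.toQPLim e₂ (S.t h X) = S.toQPLim e₁ X :=
  (Quot.sound ⟨h, rfl⟩).symm

theorem toQPLim_smul {e : Idx R d} (g : PGL R e.1) (X : PPoint R e.1) :
    S.toQPLim e (g • X) = S.toQPLim e X :=
  congrArg (fun q => (Quot.mk _ ⟨e, q⟩ : S.QPLim)) (Quotient.sound ⟨g, rfl⟩)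

/-- The map from the limit of the spaces of complexes to the limit of the orbit spaces. -/
noncomputable def toQP : S.PLim → S.QPLim :=
  Quot.lift (fun a => S.toQPLim a.1 a.2) (by
    rintro ⟨e₁, X⟩ ⟨e₂, Y⟩ ⟨h, hY⟩
    have h : PLE R e₁.1 e₂.1 := h
    obtain rfl : Y = S.t h X := hY
    exact (S.toQPLim_t h X).symm)

/-- Both spaces are iterated quotients of the disjoint union of the spaces P^b(A, e) by the same
identifications, so continuity follows from universal properties. The inverse respects
quasi-isomorphism because this is conjugation by an element that lives at one level with the point.
-/
theorem exists_homeomorph_limit (H : DirectedOver R d) {act : MulAction S.GLim S.PLim}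
    (hact : S.IsInducedAction act)
    (h : ∀ x y : S.PLim, S.QuasiIsomorphic x y ↔ ∃ γ : S.GLim, γ • y = x) :
    ∃ ψ : S.QPLim ≃ₜ S.QP, ∀ (e : Idx R d) (X : PPoint R e.1),
      ψ (S.toQPLim e X) = Quot.mk _ (S.toPLim e X) := by
  let u : ∀ e : Idx R d, MulAction.orbitRel.Quotient (PGL R e.1) (PPoint R e.1) → S.QP := fun e =>
    Quotient.lift (fun X => Quot.mk _ (S.toPLim e X)) (by
      rintro _ X ⟨g, rfl⟩
      exact Quot.sound ((h _ _).2 ⟨S.toGLim e g, IsInducedAction.smul_toPLim S hact H g X⟩))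
  have hu : ∀ e, Continuous (u e) := fun e =>
    (continuous_quot_mk.comp (S.continuous_toPLim e)).quotient_lift _
  let v : (Σ e : Idx R d, MulAction.orbitRel.Quotient (PGL R e.1) (PPoint R e.1)) → S.QP :=
    fun a => u a.1 a.2
  have hv : Continuous v := continuous_sigma hu
  let w : (Σ e : Idx R d, PPoint R e.1) → S.QPLim := fun a => S.toQPLim a.1 a.2
  have hw : Continuous w := continuous_sigma S.continuous_toQPLim
  refine ⟨{
    toFun := Quot.lift v ?_
    invFun := Quot.lift S.toQP ?_
    left_inv := ?_
    right_inv := ?_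
    continuous_toFun := continuous_quot_lift _ hv
    continuous_invFun := continuous_quot_lift _ (continuous_quot_lift _ hw) }, fun _ _ => rfl⟩
  · rintro ⟨e₁, ⟨X⟩⟩ ⟨e₂, q⟩ ⟨k, hq⟩
    have k : PLE R e₁.1 e₂.1 := k
    obtain rfl : q = Quotient.mk'' (S.t k X) := hq
    exact congrArg (Quot.mk _) (S.toPLim_t k X).symm
  · intro x y hxy
    obtain ⟨γ, rfl⟩ := (h x y).1 hxy
    obtain ⟨e, g, Y, rfl, rfl⟩ := S.exists_common_toPLim H γ y
    rw [IsInducedAction.smul_toPLim S hact H]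
    exact S.toQPLim_smul g Y
  · rintro ⟨⟨e, ⟨X⟩⟩⟩
    rfl
  · rintro ⟨⟨⟨e, X⟩⟩⟩
    rfl

end ContractibleSystem

end QuasiIsomorphism

end BoundQuiver

theorem mainTheorem9 {V : Type} [Quiver.{0} V] [Fintype V] [DecidableEq V]
    [∀ j k : V, Finite (j ⟶ k)]
    (R : BoundQuiver.Relations V) (hR : R.Admissible)
    (hgl : BoundQuiver.FiniteGlobalDimension (BoundQuiver.Alg R)) (d : BoundQuiver.K0 R) :
    Nonempty (BoundQuiver.ContractibleSystem R d) ∧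
    (∀ e e' : BoundQuiver.Idx R d, ∃ e'' : BoundQuiver.Idx R d,
      BoundQuiver.PLE R e.1 e''.1 ∧ BoundQuiver.PLE R e'.1 e''.1) ∧
    ∀ S : BoundQuiver.ContractibleSystem R d,
      ∃ act : MulAction S.GLim S.PLim,
        S.IsInducedAction act ∧
        (∀ act' : MulAction S.GLim S.PLim, S.IsInducedAction act' → act' = act) ∧
        (∀ x y : S.PLim, S.QuasiIsomorphic x y ↔ ∃ g : S.GLim, g • y = x) ∧
        (∃ φ : S.QP ≃ₜ MulAction.orbitRel.Quotient S.GLim S.PLim,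
          ∀ x : S.PLim, φ (Quot.mk _ x) = Quotient.mk'' x) ∧
        (∃ ψ : S.QPLim ≃ₜ S.QP,
          ∀ (e : BoundQuiver.Idx R d) (X : BoundQuiver.PPoint R e.1),
            ψ (S.toQPLim e X) = Quot.mk _ (S.toPLim e X)) := by
  have := hR.finite
  have H : BoundQuiver.DirectedOver R d :=
    ⟨BoundQuiver.exists_ple hR hgl, BoundQuiver.PLE.refl, BoundQuiver.PLE.trans hR hgl⟩
  refine ⟨BoundQuiver.nonempty_contractibleSystem hR hgl d, H.directed, fun S => ?_⟩
  have hact := S.isInducedAction_limAction H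
  have hiff := S.quasiIsomorphic_iff hR hgl H hact
  exact ⟨S.limAction H, hact, fun act' h' => BoundQuiver.ContractibleSystem.IsInducedAction.eq S H
    hact h', hiff, S.exists_homeomorph_orbits hiff, S.exists_homeomorph_limit H hact hiff⟩
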